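/- All graphs are finite and simple, $\log$ is the natural logarithm, and $W$ is the principal branch of the Lambert function, i.e. for $y\ge -1/e$, $W(y)$ is the unique $x\ge -1$ with $xe^x=y$. **Definitions.** Write $\mathcal I(G)$ for the family of independent sets of $G$ (including $\varnothing$) and $Z_G(\lambda)=\sum_{I\in\mathcal I(G)}\lambda^{|I|}$. The *hard-core model on $G$ at fugacity $\lambda>0$* is the random $\mathbf I\in\mathcal I(G)$ with $\Pr(\mathbf I=I)=\lambda^{|I|}/Z_G(\lambda)$; its *occupancy fraction* is $\mathbb E|\mathbf I|/|V(G)|=\frac{1}{|V(G)|}\frac{\lambda Z_G'(\lambda)}{Z_G(\lambda)}$. A *fractional $r$-colouring* of $G$ assigns to the independent sets $I$ of $G$ pairwise disjoint intervals $w(I)\subseteq[0,r)$ with $\sum_{I\ni v}|w(I)|=1$ for every vertex $v$; the vertex $v$ is then coloured with the set $\bigcup_{I\ni v}w(I)$. The *fractional chromatic number* $\chi_f(G)$ is the least $r$ for which $G$ has a fractional $r$-colouring. A *cover* of $G$ is a pair $\mathscr H=(L,H)$ of a graph $H$ and a map $L$ from $V(G)$ to subsets of $V(H)$ such that the sets $L(u)$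 partition $V(H)$ (empty parts allowed), each $H[L(u)]$ is complete, there are no edges of $H$ between $L(u)$ and $L(v)$ if $u\ne v$ are non-adjacent, and the edges of $H$ between $L(u)$ and $L(v)$ form a (possibly empty) matching if $uv\in E(G)$. $G$ is *$\mathscr H$-colourable* if $H$ has an independent set of size $|V(G)|$. The *correspondence chromatic number* $\chi_c(G)$ is the least $q$ such that $G$ is $\mathscr H$-colourable for every cover $\mathscr H$ with $|L(u)|=q$ for all $u$. **Theorem.** The following hold, where in each part $G$ ranges over all graphs, and $k$ over all integers, such that, with $\Delta$ the maximum degree of $G$, $k\in\{3,\dots,\Delta+1\}$ and $G$ contains no (not necessarily induced) subgraph isomorphic to the cycle $C_k$. The constants $\delta_0,\Delta_0,K,\eta$ depend only on $\varepsilon$. (i) For every such $G,k$ and every $\lambda>0$, the occupancy fraction of the hard-core model on $G$ at fugacity $\lambda$ is at least $$\max_{0\le x\le\lambda}\left\{\frac{x}{1+x}\,\frac{W(\Delta(1+x)^{k-3}\log(1+x))}{\Delta(1+x)^{k-3}\log(1+x)}\right\},$$ where the expression is read as $0$ at $x=0$, and the maximum is attained. (ii) For every $\varepsilon>0$ there is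 $\delta_0>1$ such that every such $G$ has a fractional colouring in which each vertex $u$ is coloured with a subset of the interval $$\left[0,\ (1+\varepsilon)\max\left\{\frac{\deg(u)}{\log(\deg(u)/k)},\ \frac{\delta_0}{\log\delta_0}k\right\}\right).$$ In particular, $\chi_f(G)\le(1+o(1))\Delta/\log(\Delta/k)$ as $\Delta/k\to\infty$: for every $\varepsilon>0$ there is $K>1$ such that $\Delta\ge Kk$ implies $\chi_f(G)\le(1+\varepsilon)\Delta/\log(\Delta/k)$. (iii) For every $\varepsilon>0$ there are $\delta_0>1$ and $\Delta_0$ such that, for every such $G$ with $\Delta\ge\Delta_0$, if $\mathscr H=(L,H)$ is a cover of $G$ with $$|L(u)|\ge(1+\varepsilon)\max\left\{\frac{\deg(u)}{\log(\deg(u)/(k\log\Delta))},\ \frac{\delta_0}{\log\delta_0}k\log\Delta\right\}\quad\text{for every } u\in V(G),$$ then $G$ is $\mathscr H$-colourable. In particular, if $k=\Delta^{o(1)}$ then $\chi_c(G)\le(1+o(1))\Delta/\log\Delta$ as $\Delta\to\infty$: for every $\varepsilon>0$ there are $\eta>0$ and $\Delta_0$ such that $\Delta\ge\Delta_0$ and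 $k\le\Delta^{\eta}$ imply $\chi_c(G)\le(1+\varepsilon)\Delta/\log\Delta$. In (ii) and (iii), when the denominator $\log(\cdot)$ in the first argument of a maximum is zero or undefined, or $\deg(u)=0$, that argument is read as $0$. -/

import Mathlib

universe u w

noncomputable section

namespace LocalOccupancy

/-- The principal branch of the Lambert `W`-function: for `y ≥ -1/e` it is the unique
`x ≥ -1` with `x * exp x = y`. -/
def lambertW (y : ℝ) : ℝ :=
  Function.invFunOn (fun x : ℝ => x * Real.exp x) (Set.Ici (-1)) y

/-- The defining property of `lambertW` at nonnegative arguments. -/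
theorem lambertW_spec {y : ℝ} (hy : 0 ≤ y) :
    -1 ≤ lambertW y ∧ lambertW y * Real.exp (lambertW y) = y := by
  have hex : ∃ x ∈ Set.Ici (-1 : ℝ), (fun x : ℝ => x * Real.exp x) x = y := by
    have hc : ContinuousOn (fun x : ℝ => x * Real.exp x) (Set.Icc 0 y) := by fun_prop
    have hmem : y ∈ Set.Icc ((fun x : ℝ => x * Real.exp x) 0)
        ((fun x : ℝ => x * Real.exp x) y) := by
      refine ⟨by simpa using hy, ?_⟩
      have h1 : 1 ≤ Real.exp y := Real.one_le_exp hy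
      simpa using mul_le_mul_of_nonneg_left h1 hy
    obtain ⟨x, hx, hxy⟩ := intermediate_value_Icc hy hc hmem
    exact ⟨x, by have := hx.1; simp only [Set.mem_Ici]; linarith, hxy⟩
  exact ⟨Function.invFunOn_mem hex, Function.invFunOn_eq hex⟩

variable {V : Type u} [Fintype V]

open Classical in
/-- The family of independent sets of `G`, including the empty set. -/
def indepSets (G : SimpleGraph V) : Finset (Finset V) :=
  Finset.univ.filter fun I => G.IsIndepSet (I : Set V)

/-- The partition function (independence polynomial) `Z_G(x)`. -/
def partitionFunction (G : SimpleGraph V) (x : ℝ) : ℝ :=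
  ∑ I ∈ indepSets G, x ^ I.card

/-- The probability of the independent set `I` in the hard-core model at fugacity `x`. -/
def hardCoreProb (G : SimpleGraph V) (x : ℝ) (I : Finset V) : ℝ :=
  x ^ I.card / partitionFunction G x

/-- The occupancy fraction `E|I| / |V(G)|` of the hard-core model on `G` at fugacity `x`. -/
def occupancyFraction (G : SimpleGraph V) (x : ℝ) : ℝ :=
  (∑ I ∈ indepSets G, hardCoreProb G x I * (I.card : ℝ)) / (Fintype.card V : ℝ)

/-- The occupancy fraction written as `(1/|V(G)|) * x Z'_G(x) / Z_G(x)`. -/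
theorem occupancyFraction_eq (G : SimpleGraph V) (x : ℝ) :
    occupancyFraction G x = 1 / (Fintype.card V : ℝ) *
      (x * deriv (partitionFunction G) x / partitionFunction G x) := by
  have hd : HasDerivAt (partitionFunction G)
      (∑ I ∈ indepSets G, (I.card : ℝ) * x ^ (I.card - 1)) x := by
    unfold partitionFunction
    exact HasDerivAt.fun_sum fun I _ => hasDerivAt_pow I.card x
  have hs : ∑ I ∈ indepSets G, hardCoreProb G x I * (I.card : ℝ) =
      x * (∑ I ∈ indepSets G, (I.card : ℝ) * x ^ (I.card - 1)) / partitionFunction G x := by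
    rw [Finset.mul_sum, Finset.sum_div]
    refine Finset.sum_congr rfl fun I _ => ?_
    unfold hardCoreProb
    rcases Nat.eq_zero_or_pos I.card with h | h
    · simp [h]
    · obtain ⟨m, hm⟩ := Nat.exists_eq_succ_of_ne_zero h.ne'
      rw [hm, Nat.succ_sub_one, pow_succ]
      ring
  rw [hd.deriv, occupancyFraction, hs]
  ring

open Classical in
/-- A fractional `k`-colouring: pairwise disjoint intervals `w I ⊆ [0, k)` assigned to the
independent sets `I` of `G`, such that for each vertex `v` the lengths of the intervals
of the independent sets containing `v` sum to `1`. -/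
structure IsFractionalColouring (G : SimpleGraph V) (k : ℝ) (w : Finset V → Set ℝ) : Prop where
  interval : ∀ I ∈ indepSets G, (w I).OrdConnected
  subset : ∀ I ∈ indepSets G, w I ⊆ Set.Ico 0 k
  disjoint : ∀ I ∈ indepSets G, ∀ J ∈ indepSets G, I ≠ J → Disjoint (w I) (w J)
  measure_eq_one : ∀ v : V,
    ∑ I ∈ (indepSets G).filter (fun I => v ∈ I), MeasureTheory.volume (w I) = 1

/-- The set of colours that a fractional colouring `w` gives to the vertex `v`: the union of
the intervals of the independent sets containing `v`. -/
def colourSet (G : SimpleGraph V) (w : Finset V → Set ℝ) (v : V) : Set ℝ :=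
  {t | ∃ I ∈ indepSets G, v ∈ I ∧ t ∈ w I}

/-- The fractional chromatic number: the least `k` for which there is a fractional
`k`-colouring. -/
def fractionalChromaticNumber (G : SimpleGraph V) : ℝ :=
  sInf {k : ℝ | 0 ≤ k ∧ ∃ w : Finset V → Set ℝ, IsFractionalColouring G k w}

/-- A cover of `G` (as in correspondence colouring) by a graph `H` on the vertex type `W`:
the sets `L u` partition `W` and induce cliques of `H`, the edges of `H` between `L u` and
`L v` form a matching if `u` and `v` are adjacent, and there are none if `u` and `v` are
distinct and non-adjacent. -/
structure Cover (G : SimpleGraph V) (W : Type w) where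
  H : SimpleGraph W
  L : V → Finset W
  partition : ∀ x : W, ∃! v : V, x ∈ L v
  clique : ∀ v : V, H.IsClique (L v : Set W)
  adj_or_eq : ∀ v v' : V, ∀ x ∈ L v, ∀ y ∈ L v', H.Adj x y → v = v' ∨ G.Adj v v'
  matching : ∀ v v' : V, G.Adj v v' →
    ∀ x ∈ L v, ∀ y ∈ L v', ∀ z ∈ L v', H.Adj x y → H.Adj x z → y = z

/-- `G` is `C`-colourable: the cover graph has an independent set of size `|V(G)|`. -/
def Cover.Colourable {G : SimpleGraph V} {W : Type w} (C : Cover G W) : Prop :=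
  ∃ S : Finset W, C.H.IsIndepSet (S : Set W) ∧ S.card = Fintype.card V

/-- The correspondence (DP-) chromatic number: the least `k` such that `G` is colourable with
respect to every `k`-fold cover. Cover graphs of finite graphs are finite, so cover graphs in
`Type` suffice. -/
def correspondenceChromaticNumber (G : SimpleGraph V) : ℕ :=
  sInf {k : ℕ | ∀ (W : Type) (C : Cover G W), (∀ v : V, (C.L v).card = k) → C.Colourable}

end LocalOccupancy

end

/-! Since `G` has no `C_k`, a neighbourhood contains no path on `k - 1` vertices. By Erdős–Gallai,
every `F` inside a neighbourhood then has average degree at most `k - 3`. In the hard-core model at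
fugacity `x` on `F`, a vertex of degree `d` is occupied with probability at least `x / (1 + x) ^ (d
+ 1)`. Convexity turns this into an expected size of at least `|F| * x / (1 + x) ^ (k - 2)`, while
the partition function of `F` is at most `(1 + x) ^ |F|`. So a small `F` is empty with decent
probability and a large `F` is well occupied. Conditioning on the independent set outside the
neighbourhood gives `partitionIn_le_vertex_occupancy`: a weighted sum of the occupancy of `v` and
the expected number of occupied neighbours is at least `1`, with a free parameter `t`.

Part (i): sum over all vertices and take for `t` the optimal value, which is a value of the Lambert
function. Monotonicity in the fugacity then covers the maximum over smaller `x`.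

Part (ii): build a fractional colouring greedily, at each moment using the hard-core distribution on
the vertices whose demand is unmet. Local occupancy makes the deadline `β v * r v + γ v * ∑ r u` of
such a vertex fall at least at unit rate, so each vertex is finished by its initial deadline. Take
`x = η / k` with `η` small, so that `(1 + x) ^ (k - 2)` is nearly `1`, and choose `t` vertex by
vertex.

Part (iii): draw a hard-core partial colouring from the cover graph. Conflict sets of colours
inherit the path bound, since they project injectively to neighbourhoods of `G`. An exponential
moment bound shows that each vertex probably keeps many available colours, and a partition function
bound shows that an available colour probably has few conflicts that are still free. The lopsided
local lemma (`exists_avoiding`) makes both hold everywhere, and a counting argument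
(`exists_transversal`) completes the colouring. -/

noncomputable section

namespace LocalOccupancy

open Finset Filter

open scoped Classical

/-! ### Longest paths, the Erdős–Gallai degree bound, and neighbourhoods in `C_k`-free graphs. -/

section PathsInGraphs

variable {W : Type w}

/-- A path of `H` inside the vertex set `P`, given by its list of vertices. -/
def IsPathIn (H : SimpleGraph W) (P : Finset W) (l : List W) : Prop :=
  l.IsChain H.Adj ∧ l.Nodup ∧ ∀ x ∈ l, x ∈ P

/-- Every path of `H` inside `P` has at most `m` vertices. -/
def PathBound (H : SimpleGraph W) (P : Finset W) (m : ℕ) : Prop :=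
  ∀ l : List W, IsPathIn H P l → l.length ≤ m

theorem PathBound.mono {H : SimpleGraph W} {P Q : Finset W} {m : ℕ} (h : PathBound H P m)
    (hQ : Q ⊆ P) : PathBound H Q m :=
  fun l hl => h l ⟨hl.1, hl.2.1, fun x hx => hQ (hl.2.2 x hx)⟩

theorem isChain_reverse_adj {H : SimpleGraph W} {l : List W} (h : l.IsChain H.Adj) :
    l.reverse.IsChain H.Adj := by
  rw [List.isChain_reverse]
  exact h.imp fun a b hab => hab.symm

theorem IsPathIn.reverse {H : SimpleGraph W} {P : Finset W} {l : List W} (h : IsPathIn H P l) :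
    IsPathIn H P l.reverse :=
  ⟨isChain_reverse_adj h.1, List.nodup_reverse.2 h.2.1,
    fun x hx => h.2.2 x (List.mem_reverse.1 hx)⟩

theorem exists_longest_path {H : SimpleGraph W} {P : Finset W} {m : ℕ} (h : PathBound H P m) :
    ∃ l, IsPathIn H P l ∧ PathBound H P l.length := by
  -- Here `n` is the deficit below the bound `m`; its least value comes from a longest path.
  have hex : ∃ n, ∃ l, IsPathIn H P l ∧ l.length + n = m := by
    refine ⟨m, [], ⟨by simp, by simp, by simp⟩, by simp⟩
  obtain ⟨l, hl, hlen⟩ := Nat.find_spec hex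
  refine ⟨l, hl, fun l' hl' => ?_⟩
  by_contra! hlt
  have h' := h l' hl'
  refine Nat.find_min hex (m := m - l'.length) (by omega) ⟨l', hl', by omega⟩

/-- A neighbour off the path could be prepended, making a longer path. -/
theorem mem_of_adj_head {H : SimpleGraph W} {P : Finset W} {a : W} {l : List W}
    (hl : IsPathIn H P (a :: l)) (hmax : PathBound H P (a :: l).length) {y : W} (hy : y ∈ P)
    (hay : H.Adj a y) : y ∈ a :: l := by
  by_contra hn
  have := hmax (y :: a :: l) ⟨by
    rw [List.isChain_cons]
    exact ⟨by simpa using hay.symm, hl.1⟩, List.nodup_cons.2 ⟨hn, hl.2.1⟩, by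
    intro x hx
    rcases List.mem_cons.1 hx with rfl | hx
    · exact hy
    · exact hl.2.2 x hx⟩
  simp at this

/-- A longest path whose vertex set carries a cycle leaves no edge to the rest of `P`. -/
theorem mem_of_adj_closed {H : SimpleGraph W} {P : Finset W} {c : List W}
    (hc : IsPathIn H P c) (hmax : PathBound H P c.length)
    (hclose : ∀ x ∈ c.getLast?, ∀ y ∈ c.head?, x ≠ y → H.Adj x y) {x y : W} (hx : x ∈ c)
    (hy : y ∈ P) (hxy : H.Adj x y) : y ∈ c := by
  obtain ⟨s, t, rfl⟩ := List.append_of_mem hx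
  -- The closing edge lets the cycle be cut open just before `x`, which gives another longest path,
  -- now starting at `x`.
  have hp : IsPathIn H P (x :: (t ++ s)) := by
    obtain ⟨h1, h2, h3⟩ := hc
    rw [List.isChain_append] at h1
    have hperm : (s ++ x :: t).Perm (x :: (t ++ s)) := by
      simpa using (List.perm_append_comm : (s ++ (x :: t)).Perm ((x :: t) ++ s))
    refine ⟨?_, hperm.nodup_iff.1 h2, fun z hz => h3 z (hperm.mem_iff.2 hz)⟩
    rw [← List.cons_append, List.isChain_append]
    refine ⟨h1.2.1, h1.1, fun a ha b hb => ?_⟩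
    refine hclose a ?_ b ?_ ?_
    · rw [List.getLast?_append]
      simp only [Option.mem_def] at ha ⊢
      rw [ha]; rfl
    · rw [List.head?_append]
      simp only [Option.mem_def] at hb ⊢
      rw [hb]; rfl
    · rintro rfl
      have ha' := List.mem_of_mem_getLast? ha
      have hb' := List.mem_of_mem_head? hb
      exact (List.nodup_append.1 h2).2.2 _ hb' _ ha' rfl
  have hlen : (s ++ x :: t).length = (x :: (t ++ s)).length := by
    simp; omega
  rw [hlen] at hmax
  have := mem_of_adj_head hp hmax hy hxy
  simp at this ⊢
  tauto

/-- The degree of `v` inside `P`. -/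
def degIn (H : SimpleGraph W) (P : Finset W) (v : W) : ℕ := #{y ∈ P | H.Adj v y}

theorem sum_degIn_erase (H : SimpleGraph W) (P : Finset W) {v : W} (hv : v ∈ P) :
    ∑ x ∈ P, (degIn H P x + 1) =
      ∑ x ∈ P.erase v, (degIn H (P.erase v) x + 1) + (2 * degIn H P v + 1) := by
  rw [← Finset.sum_erase_add _ _ hv]
  have h1 : ∀ x ∈ P.erase v, degIn H P x + 1 =
      degIn H (P.erase v) x + 1 + if H.Adj v x then 1 else 0 := by
    intro x hx
    unfold degIn
    rw [← Finset.insert_erase hv, Finset.filter_insert, Finset.erase_insert (by simp)]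
    by_cases hxv : H.Adj x v
    · rw [if_pos hxv, if_pos hxv.symm, Finset.card_insert_of_notMem (by simp)]
    · rw [if_neg hxv, if_neg (fun h => hxv h.symm)]
  rw [Finset.sum_congr rfl h1, Finset.sum_add_distrib]
  have h2 : ∑ x ∈ P.erase v, (if H.Adj v x then 1 else 0) = degIn H P v := by
    rw [← Finset.card_filter, degIn, Finset.filter_erase, Finset.erase_eq_of_notMem]
    simp
  rw [h2]; ring

/-- By maximality all neighbours of both ends lie on the path. Neighbours of `a`, shifted back by
one position, and neighbours of `b` occupy disjoint sets among the first `l.length - 1` positions.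
-/
theorem degIn_add_degIn_of_no_crossing {H : SimpleGraph W} {P : Finset W} {l : List W} {a b : W}
    (hl : IsPathIn H P l) (hmax : PathBound H P l.length) (ha : a ∈ l.head?)
    (hb : b ∈ l.getLast?)
    (hcross : ∀ (i : ℕ) (hi : i + 1 < l.length), H.Adj a l[i + 1] → ¬ H.Adj b l[i]) :
    degIn H P a + degIn H P b + 1 ≤ l.length := by
  have hne : l ≠ [] := by rintro rfl; simp at ha
  have hpos : 0 < l.length := List.length_pos_iff.2 hne
  have ha0 : a = l[0] := by
    rw [List.head?_eq_some_head hne] at ha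
    simpa [List.head_eq_getElem, eq_comm] using ha
  have hbl : b = l[l.length - 1] := by
    rw [List.getLast?_eq_some_getLast hne] at hb
    simpa [List.getLast_eq_getElem, eq_comm] using hb
  have hNa : ∀ y ∈ P, H.Adj a y → y ∈ l := by
    intro y hy hay
    obtain ⟨a', l', rfl⟩ := List.exists_cons_of_ne_nil hne
    obtain rfl : a' = a := by simpa using ha
    exact mem_of_adj_head hl hmax hy hay
  have hNb : ∀ y ∈ P, H.Adj b y → y ∈ l := by
    intro y hy hby
    have hr := hl.reverse
    have hb' : b ∈ l.reverse.head? := by simpa using hb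
    rw [← List.mem_reverse]
    have hmax' : PathBound H P l.reverse.length := by simpa using hmax
    have hne' : l.reverse ≠ [] := by simpa using hne
    obtain ⟨a', l', h'⟩ := List.exists_cons_of_ne_nil hne'
    rw [h'] at hr hb' hmax' ⊢
    obtain rfl : a' = b := by simpa using hb'
    exact mem_of_adj_head hr hmax' hy hby
  let A : Finset ℕ := (range (l.length - 1)).filter
    fun i => ∃ hi : i + 1 < l.length, H.Adj a l[i + 1]
  let B : Finset ℕ := (range (l.length - 1)).filter
    fun i => ∃ hi : i + 1 < l.length, H.Adj b l[i]
  have hA : degIn H P a ≤ A.card := by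
    refine Finset.card_le_card_of_surjOn (fun i => l.getD (i + 1) a) ?_
    intro y hy
    simp only [coe_filter, Set.mem_ofPred_eq] at hy
    obtain ⟨i, hi, rfl⟩ := List.getElem_of_mem (hNa y hy.1 hy.2)
    have hi0 : i ≠ 0 := by
      rintro rfl
      exact H.loopless.irrefl a (by simpa [← ha0] using hy.2)
    obtain ⟨j, rfl⟩ := Nat.exists_eq_succ_of_ne_zero hi0
    refine ⟨j, ?_, ?_⟩
    · simp only [A, coe_filter, Set.mem_ofPred_eq, mem_range]
      exact ⟨by omega, hi, hy.2⟩
    · exact List.getD_eq_getElem _ _ hi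
  have hB : degIn H P b ≤ B.card := by
    refine Finset.card_le_card_of_surjOn (fun i => l.getD i a) ?_
    intro y hy
    simp only [coe_filter, Set.mem_ofPred_eq] at hy
    obtain ⟨i, hi, rfl⟩ := List.getElem_of_mem (hNb y hy.1 hy.2)
    have hi0 : i ≠ l.length - 1 := by
      rintro rfl
      exact H.loopless.irrefl b (by simpa [← hbl] using hy.2)
    refine ⟨i, ?_, ?_⟩
    · simp only [B, coe_filter, Set.mem_ofPred_eq, mem_range]
      exact ⟨by omega, by omega, hy.2⟩
    · exact List.getD_eq_getElem _ _ hi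
  have hAB : Disjoint A B := by
    rw [Finset.disjoint_left]
    intro i hiA hiB
    obtain ⟨-, hi, h1⟩ := Finset.mem_filter.1 hiA
    obtain ⟨-, _, h2⟩ := Finset.mem_filter.1 hiB
    exact hcross i hi h1 h2
  have hcard : A.card + B.card ≤ l.length - 1 := by
    rw [← Finset.card_union_of_disjoint hAB]
    calc (A ∪ B).card ≤ (range (l.length - 1)).card :=
          Finset.card_le_card (Finset.union_subset (filter_subset _ _) (filter_subset _ _))
      _ = _ := card_range _
  omega

/-- **Erdős–Gallai**: if all paths inside `P` have at most `m` vertices, then the average degree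
inside `P` is at most `m - 1`. -/
theorem PathBound.sum_degIn_le {H : SimpleGraph W} {P : Finset W} {m : ℕ}
    (h : PathBound H P m) : ∑ v ∈ P, (degIn H P v + 1) ≤ m * P.card := by
  induction hn : P.card using Nat.strong_induction_on generalizing P with
  | _ n ih =>
  subst hn
  rcases P.eq_empty_or_nonempty with rfl | ⟨v₀, hv₀⟩
  · simp
  -- Deleting `v` lowers the sum by `2 * degIn H P v + 1`, so a vertex of low degree can be removed
  -- by induction. Without a crossing, one of the two ends of a longest path is such a vertex.
  have hdel : ∀ v ∈ P, 2 * degIn H P v + 1 ≤ m → ∑ v ∈ P, (degIn H P v + 1) ≤ m * P.card := by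
    intro v hv hd
    have hc := Finset.card_erase_add_one hv
    have := ih _ (by omega) (h.mono (erase_subset v P)) rfl
    rw [sum_degIn_erase H P hv, ← hc]
    nlinarith
  obtain ⟨l, hl, hmax⟩ := exists_longest_path h
  have hlm : l.length ≤ m := h l hl
  have hne : l ≠ [] := by
    rintro rfl
    have := hmax [v₀] ⟨by simp, by simp, by simpa using hv₀⟩
    simp at this
  have ha := List.head?_eq_some_head hne
  have hb := List.getLast?_eq_some_getLast hne
  set a := l.head hne
  set b := l.getLast hne
  have haP : a ∈ P := hl.2.2 _ (List.head_mem hne)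
  have hbP : b ∈ P := hl.2.2 _ (List.getLast_mem hne)
  by_cases hcross : ∀ (i : ℕ) (hi : i + 1 < l.length), H.Adj a l[i + 1] → ¬ H.Adj b l[i]
  · have := degIn_add_degIn_of_no_crossing hl hmax ha hb hcross
    rcases le_total (degIn H P a) (degIn H P b) with h' | h'
    · exact hdel a haP (by omega)
    · exact hdel b hbP (by omega)
  push Not at hcross
  obtain ⟨i, hi, hai, hbi⟩ := hcross
  -- Reversing the initial segment uses the edge from `a` to `l[i + 1]`; the edge from `b` to `l[i]`
  -- closes the new path into a cycle.
  let c := (l.take (i + 1)).reverse ++ l.drop (i + 1)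
  have hperm : c.Perm l := by
    conv_rhs => rw [← List.take_append_drop (i + 1) l]
    exact (List.reverse_perm _).append_right _
  have hclen : c.length = l.length := hperm.length_eq
  have htd := hl.1
  rw [← List.take_append_drop (i + 1) l, List.isChain_append] at htd
  have hlast : (l.take (i + 1)).getLast? = some l[i] := by
    rw [List.getLast?_eq_getElem?]
    have : (l.take (i + 1)).length - 1 = i := by rw [List.length_take]; omega
    rw [this, List.getElem?_take_of_lt (by omega), List.getElem?_eq_getElem]
  have hhead : (l.take (i + 1)).head? = some a := by
    rw [List.head?_take]; simp [ha]
  have hdhead : (l.drop (i + 1)).head? = some l[i + 1] := by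
    rw [List.head?_drop, List.getElem?_eq_getElem]
  have hdlast : (l.drop (i + 1)).getLast? = some b := by
    rw [List.getLast?_drop, if_neg (by omega), hb]
  have hc : IsPathIn H P c := by
    refine ⟨?_, hperm.nodup_iff.2 hl.2.1, fun x hx => hl.2.2 x (hperm.mem_iff.1 hx)⟩
    rw [List.isChain_append]
    refine ⟨isChain_reverse_adj htd.1, htd.2.1, fun x hx y hy => ?_⟩
    rw [List.getLast?_reverse, hhead] at hx
    rw [hdhead] at hy
    obtain rfl : a = x := by simpa using hx
    obtain rfl : l[i + 1] = y := by simpa using hy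
    exact hai
  have hclose : ∀ x ∈ c.getLast?, ∀ y ∈ c.head?, x ≠ y → H.Adj x y := by
    intro x hx y hy _
    rw [List.getLast?_append, hdlast] at hx
    rw [List.head?_append, List.head?_reverse, hlast] at hy
    obtain rfl : b = x := by simpa using hx
    obtain rfl : l[i] = y := by simpa using hy
    exact hbi
  have hmaxc : PathBound H P c.length := by rwa [hclen]
  set C := c.toFinset with hCdef
  have hCP : C ⊆ P := fun x hx => hc.2.2 x (List.mem_toFinset.1 hx)
  have hCcard : C.card = l.length := by
    rw [hCdef, List.toFinset_card_of_nodup hc.2.1, hclen]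
  -- No edge leaves `C`, so `P` splits: induction handles `P \ C`, and inside `C` degrees are below
  -- `C.card ≤ m`.
  have hstay : ∀ x ∈ C, ∀ y ∈ P, H.Adj x y → y ∈ C := fun x hx y hy hxy =>
    List.mem_toFinset.2 (mem_of_adj_closed hc hmaxc hclose (List.mem_toFinset.1 hx) hy hxy)
  have hCpos : 0 < C.card := by rw [hCcard]; omega
  have hcards := Finset.card_sdiff_add_card_eq_card hCP
  have hrec := ih (P \ C).card (by omega) (h.mono sdiff_subset) rfl
  rw [← Finset.sum_sdiff hCP, ← hcards, mul_add]
  refine add_le_add ?_ ?_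
  · refine le_trans (Finset.sum_le_sum fun x hx => ?_) hrec
    rw [Finset.mem_sdiff] at hx
    unfold degIn
    refine Nat.add_le_add_right (Finset.card_le_card fun y hy => ?_) 1
    rw [Finset.mem_filter] at hy ⊢
    exact ⟨Finset.mem_sdiff.2 ⟨hy.1, fun hyC => hx.2 (hstay y hyC x hx.1 hy.2.symm)⟩, hy.2⟩
  · rw [mul_comm, ← smul_eq_mul]
    refine Finset.sum_le_card_nsmul _ _ _ fun x hx => ?_
    have : degIn H P x ≤ (C.erase x).card := by
      refine Finset.card_le_card fun y hy => ?_
      rw [Finset.mem_filter] at hy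
      exact Finset.mem_erase.2 ⟨hy.2.ne', hstay x hx y hy.1 hy.2⟩
    rw [Finset.card_erase_of_mem hx] at this
    omega

/-- In a `C_k`-free graph, paths inside a neighbourhood have at most `k - 2` vertices. -/
theorem pathBound_neighbors {G : SimpleGraph W} {k : ℕ} (hk : 3 ≤ k)
    (hfree : (SimpleGraph.cycleGraph k).Free G) {P : Finset W} {v : W}
    (hP : ∀ x ∈ P, G.Adj v x) : PathBound G P (k - 2) := by
  intro l ⟨hc, hnd, hmem⟩
  by_contra! hlt
  obtain ⟨n, rfl⟩ : ∃ n, k = n + 3 := ⟨k - 3, by omega⟩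
  apply hfree
  have hlen : n + 2 ≤ l.length := by omega
  rw [List.isChain_iff_getElem] at hc
  -- The cycle is `v` followed by the first `k - 1 = n + 2` vertices of the path.
  let f : Fin (n + 3) → W := Fin.cons v fun i : Fin (n + 2) => l[i]
  have hadj : ∀ a b : Fin (n + 3), b - a = 1 → G.Adj (f a) (f b) := by
    intro a b hab
    obtain rfl : b = a + 1 := by rw [← hab, add_sub_cancel]
    refine Fin.cases ?_ (fun i => ?_) a
    · have : (0 : Fin (n + 3)) + 1 = Fin.succ 0 := by simp
      rw [this]
      exact hP _ (hmem _ (List.getElem_mem _))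
    · refine Fin.lastCases ?_ (fun j => ?_) i
      · have : (Fin.last (n + 1)).succ + 1 = (0 : Fin (n + 3)) := by simp
        rw [this]
        exact (hP _ (hmem _ (List.getElem_mem _))).symm
      · have : j.castSucc.succ + 1 = j.succ.succ := by
          rw [← Fin.castSucc_succ, Fin.coeSucc_eq_succ]
        rw [this]
        exact hc j (by have := j.2; omega)
  refine ⟨⟨⟨f, fun {a b} hab => ?_⟩, ?_⟩⟩
  · rcases SimpleGraph.cycleGraph_adj.1 hab with h | h
    · exact (hadj b a h).symm
    · exact hadj a b h
  · change Function.Injective f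
    rw [Fin.cons_injective_iff]
    refine ⟨?_, ?_⟩
    · rintro ⟨i, hi⟩
      have := hP _ (hmem _ (List.getElem_mem (l := l) (n := i) (by have := i.2; omega)))
      exact this.ne hi.symm
    · intro i j hij
      have := (List.Nodup.getElem_inj_iff hnd).1 hij
      exact Fin.ext this

end PathsInGraphs

/-! ### The hard-core model: conditioning, expected size and local occupancy. -/

section HardCore

variable {W : Type w}

/-- The independent sets of `H` contained in `U`. -/
def indepIn (H : SimpleGraph W) (U : Finset W) : Finset (Finset W) :=
  U.powerset.filter fun I => H.IsIndepSet (I : Set W)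

/-- The partition function of the subgraph of `H` induced on `U`. -/
def partitionIn (H : SimpleGraph W) (U : Finset W) (x : ℝ) : ℝ :=
  ∑ I ∈ indepIn H U, x ^ I.card

/-- The vertices of `P` with no neighbour in `J`. -/
def freeIn (H : SimpleGraph W) (P J : Finset W) : Finset W :=
  P.filter fun y => ∀ z ∈ J, ¬ H.Adj y z

theorem mem_indepIn {H : SimpleGraph W} {U I : Finset W} :
    I ∈ indepIn H U ↔ I ⊆ U ∧ ∀ x ∈ I, ∀ y ∈ I, ¬ H.Adj x y := by
  unfold indepIn
  rw [mem_filter, mem_powerset, SimpleGraph.IsIndepSet]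
  refine and_congr_right fun _ => ⟨fun h x hx y hy hxy => h hx hy hxy.ne hxy,
    fun h x hx y hy _ => h x hx y hy⟩

theorem mem_freeIn {H : SimpleGraph W} {P J : Finset W} {y : W} :
    y ∈ freeIn H P J ↔ y ∈ P ∧ ∀ z ∈ J, ¬ H.Adj y z := mem_filter

theorem freeIn_subset (H : SimpleGraph W) (P J : Finset W) : freeIn H P J ⊆ P :=
  filter_subset _ _

theorem empty_mem_indepIn (H : SimpleGraph W) (U : Finset W) : ∅ ∈ indepIn H U := by
  rw [mem_indepIn]; simp

/-- The spatial Markov property: once the part `J` outside `P` is fixed, the rest is an arbitrary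
independent set among the vertices of `P` that `J` does not block. -/
theorem sum_indepIn_fiber (H : SimpleGraph W) {U P : Finset W} (hP : P ⊆ U)
    (f : Finset W → ℝ) :
    ∑ I ∈ indepIn H U, f I =
      ∑ J ∈ indepIn H (U \ P), ∑ T ∈ indepIn H (freeIn H P J), f (J ∪ T) := by
  rw [Finset.sum_sigma']
  refine Finset.sum_bij' (fun I _ => ⟨I \ P, I ∩ P⟩) (fun p _ => p.1 ∪ p.2) ?_ ?_ ?_ ?_ ?_
  · intro I hI
    rw [mem_indepIn] at hI
    rw [mem_sigma, mem_indepIn, mem_indepIn]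
    refine ⟨⟨sdiff_subset_sdiff hI.1 le_rfl, fun x hx y hy =>
      hI.2 x (mem_sdiff.1 hx).1 y (mem_sdiff.1 hy).1⟩, fun x hx => ?_, fun x hx y hy =>
      hI.2 x (mem_inter.1 hx).1 y (mem_inter.1 hy).1⟩
    exact mem_freeIn.2 ⟨(mem_inter.1 hx).2, fun z hz =>
      hI.2 x (mem_inter.1 hx).1 z (mem_sdiff.1 hz).1⟩
  · rintro ⟨J, T⟩ hp
    rw [mem_sigma, mem_indepIn, mem_indepIn] at hp
    obtain ⟨⟨h1, h2⟩, h3, h4⟩ := hp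
    rw [mem_indepIn]
    refine ⟨union_subset (h1.trans sdiff_subset) ((h3.trans (freeIn_subset _ _ _)).trans hP), ?_⟩
    intro x hx y hy
    rcases mem_union.1 hx with hx | hx <;> rcases mem_union.1 hy with hy | hy
    · exact h2 x hx y hy
    · exact fun h => (mem_freeIn.1 (h3 hy)).2 x hx h.symm
    · exact (mem_freeIn.1 (h3 hx)).2 y hy
    · exact h4 x hx y hy
  · intro I _
    simp [sdiff_union_inter]
  · rintro ⟨J, T⟩ hp
    rw [mem_sigma, mem_indepIn, mem_indepIn] at hp
    obtain ⟨⟨h1, h2⟩, h3, h4⟩ := hp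
    have hT : T ⊆ P := h3.trans (freeIn_subset _ _ _)
    have hJ : Disjoint J P := (subset_sdiff.1 h1).2
    simp only [union_sdiff_distrib, union_inter_distrib_right]
    rw [sdiff_eq_self_of_disjoint hJ, sdiff_eq_empty_iff_subset.2 hT, disjoint_iff_inter_eq_empty.1 hJ,
      inter_eq_left.2 hT, union_empty, empty_union]
  · intro I _
    simp [sdiff_union_inter]

/-- To compare two weighted sums over independent sets of `U` it suffices to compare them
conditionally on the part of the independent set outside `P`. -/
theorem sum_indepIn_le_of_fiber (H : SimpleGraph W) {U P : Finset W} (hP : P ⊆ U) {x : ℝ}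
    (hx : 0 ≤ x) {f g : Finset W → ℝ}
    (h : ∀ J ∈ indepIn H (U \ P),
      ∑ T ∈ indepIn H (freeIn H P J), x ^ T.card * f (J ∪ T) ≤
        ∑ T ∈ indepIn H (freeIn H P J), x ^ T.card * g (J ∪ T)) :
    ∑ I ∈ indepIn H U, x ^ I.card * f I ≤ ∑ I ∈ indepIn H U, x ^ I.card * g I := by
  rw [sum_indepIn_fiber H hP, sum_indepIn_fiber H hP]
  refine Finset.sum_le_sum fun J hJ => ?_
  have key : ∀ f : Finset W → ℝ,
      ∑ T ∈ indepIn H (freeIn H P J), x ^ (J ∪ T).card * f (J ∪ T) =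
        x ^ J.card * ∑ T ∈ indepIn H (freeIn H P J), x ^ T.card * f (J ∪ T) := by
    intro f
    rw [Finset.mul_sum]
    refine Finset.sum_congr rfl fun T hT => ?_
    have hd : Disjoint J T := by
      have h1 := (subset_sdiff.1 (mem_indepIn.1 hJ).1).2
      exact h1.mono_right ((mem_indepIn.1 hT).1.trans (freeIn_subset _ _ _))
    rw [card_union_of_disjoint hd, pow_add]; ring
  rw [key, key]
  exact mul_le_mul_of_nonneg_left (h J hJ) (by positivity)

theorem one_le_partitionIn (H : SimpleGraph W) (U : Finset W) {x : ℝ} (hx : 0 ≤ x) :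
    1 ≤ partitionIn H U x := by
  unfold partitionIn
  have := Finset.single_le_sum (f := fun I : Finset W => x ^ I.card)
    (fun I _ => by positivity) (empty_mem_indepIn H U)
  simpa using this

theorem partitionIn_pos (H : SimpleGraph W) (U : Finset W) {x : ℝ} (hx : 0 ≤ x) :
    0 < partitionIn H U x := zero_lt_one.trans_le (one_le_partitionIn H U hx)

theorem partitionIn_le (H : SimpleGraph W) (U : Finset W) {x : ℝ} (hx : 0 ≤ x) :
    partitionIn H U x ≤ (1 + x) ^ U.card := by
  have h1 : ∑ I ∈ U.powerset, x ^ I.card = (1 + x) ^ U.card := by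
    have := Finset.sum_pow_mul_eq_add_pow x 1 U
    simpa [add_comm] using this
  rw [← h1]
  exact Finset.sum_le_sum_of_subset_of_nonneg (filter_subset _ _) fun _ _ _ => by positivity

/-- Condition on everything outside the closed neighbourhood of `v`. Then `v` is unblocked, `{v}`
has weight `x`, and at most `degIn H F v + 1` vertices are undecided. -/
theorem sum_indepIn_mem_ge (H : SimpleGraph W) {F : Finset W} {v : W} (hv : v ∈ F) {x : ℝ}
    (hx : 0 ≤ x) :
    x * ((1 + x) ^ (degIn H F v + 1))⁻¹ * partitionIn H F x ≤
      ∑ T ∈ indepIn H F, x ^ T.card * (if v ∈ T then 1 else 0) := by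
  set c := x * ((1 + x) ^ (degIn H F v + 1))⁻¹
  have hc : 0 ≤ c := by positivity
  have h1 : c * partitionIn H F x = ∑ T ∈ indepIn H F, x ^ T.card * c := by
    rw [partitionIn, mul_comm, Finset.sum_mul]
  rw [h1]
  set P := insert v (F.filter fun y => H.Adj v y)
  have hP : P ⊆ F := insert_subset hv (filter_subset _ _)
  refine sum_indepIn_le_of_fiber H hP hx fun J hJ => ?_
  have hvJ : v ∉ J := fun h => by
    have := (mem_sdiff.1 ((mem_indepIn.1 hJ).1 h)).2
    exact this (mem_insert_self _ _)
  have hvfree : v ∈ freeIn H P J := by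
    refine mem_freeIn.2 ⟨mem_insert_self _ _, fun z hz hvz => ?_⟩
    have := mem_sdiff.1 ((mem_indepIn.1 hJ).1 hz)
    exact this.2 (mem_insert_of_mem (mem_filter.2 ⟨this.1, hvz⟩))
  have hvT : {v} ∈ indepIn H (freeIn H P J) := by
    rw [mem_indepIn]
    exact ⟨singleton_subset_iff.2 hvfree, by simp⟩
  have h2 : x ≤ ∑ T ∈ indepIn H (freeIn H P J), x ^ T.card * (if v ∈ J ∪ T then 1 else 0) := by
    have := Finset.single_le_sum
      (f := fun T : Finset W => x ^ T.card * (if v ∈ J ∪ T then (1 : ℝ) else 0))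
      (fun T _ => by positivity) hvT
    simpa using this
  refine le_trans ?_ h2
  rw [← Finset.sum_mul]
  have h3 := partitionIn_le H (freeIn H P J) hx
  have h4 : (1 + x) ^ (freeIn H P J).card ≤ (1 + x) ^ (degIn H F v + 1) := by
    refine pow_le_pow_right₀ (by linarith) ((card_le_card (freeIn_subset _ _ _)).trans ?_)
    exact card_insert_le _ _
  calc partitionIn H (freeIn H P J) x * c ≤ (1 + x) ^ (degIn H F v + 1) * c :=
        mul_le_mul_of_nonneg_right (h3.trans h4) hc
    _ = x := by
        have : (1 + x) ^ (degIn H F v + 1) ≠ 0 := by positivity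
        simp only [c]; field_simp

/-- Jensen's inequality for the convex function `(1 + x) ^ (-n)`, proved through its tangent at `n =
m`; the Erdős–Gallai bound controls the mean of `degIn H F v + 1`. -/
theorem sum_inv_pow_ge {H : SimpleGraph W} {F : Finset W} {m : ℕ} (h : PathBound H F m) {x : ℝ}
    (hx : 0 ≤ x) :
    (F.card : ℝ) * ((1 + x) ^ m)⁻¹ ≤ ∑ v ∈ F, ((1 + x) ^ (degIn H F v + 1))⁻¹ := by
  set L := Real.log (1 + x)
  have hL : 0 ≤ L := Real.log_nonneg (by linarith)
  have hpow : ∀ n : ℕ, ((1 + x) ^ n)⁻¹ = Real.exp (-(L * n)) := by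
    intro n
    rw [Real.exp_neg, mul_comm, Real.exp_nat_mul, Real.exp_log (by linarith)]
  have hS : (∑ v ∈ F, ((degIn H F v + 1 : ℕ) : ℝ)) ≤ m * F.card := by
    exact_mod_cast h.sum_degIn_le
  have htan : ∀ v ∈ F, Real.exp (-(L * m)) * (1 + L * m - L * ((degIn H F v + 1 : ℕ) : ℝ)) ≤
      ((1 + x) ^ (degIn H F v + 1))⁻¹ := by
    intro v _
    rw [hpow]
    have h1 := Real.add_one_le_exp (L * m - L * ((degIn H F v + 1 : ℕ) : ℝ))
    calc _ ≤ Real.exp (-(L * m)) * Real.exp (L * m - L * ((degIn H F v + 1 : ℕ) : ℝ)) :=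
          mul_le_mul_of_nonneg_left (by linarith) (Real.exp_pos _).le
      _ = _ := by rw [← Real.exp_add]; ring_nf
  refine le_trans ?_ (Finset.sum_le_sum htan)
  rw [← Finset.mul_sum, Finset.sum_sub_distrib, Finset.sum_const, ← Finset.mul_sum, hpow,
    mul_comm, nsmul_eq_mul]
  refine mul_le_mul_of_nonneg_left ?_ (Real.exp_pos _).le
  nlinarith [mul_le_mul_of_nonneg_left hS hL]

/-- Lower bound for the expected size of a hard-core independent set. -/
theorem sum_card_ge {H : SimpleGraph W} {F : Finset W} {m : ℕ} (h : PathBound H F m) {x : ℝ}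
    (hx : 0 ≤ x) :
    (F.card : ℝ) * (x * ((1 + x) ^ m)⁻¹) * partitionIn H F x ≤
      ∑ T ∈ indepIn H F, x ^ T.card * (T.card : ℝ) := by
  have h1 : ∑ T ∈ indepIn H F, x ^ T.card * (T.card : ℝ) =
      ∑ v ∈ F, ∑ T ∈ indepIn H F, x ^ T.card * (if v ∈ T then 1 else 0) := by
    rw [Finset.sum_comm]
    refine Finset.sum_congr rfl fun T hT => ?_
    rw [← Finset.mul_sum, Finset.sum_boole, Finset.filter_mem_eq_inter,
      inter_eq_right.2 (mem_indepIn.1 hT).1]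
  rw [h1]
  refine le_trans ?_ (Finset.sum_le_sum fun v hv => sum_indepIn_mem_ge H hv hx)
  rw [← Finset.sum_mul, ← Finset.mul_sum]
  refine mul_le_mul_of_nonneg_right ?_ (partitionIn_pos H F hx).le
  have := mul_le_mul_of_nonneg_left (sum_inv_pow_ge h hx) hx
  linarith

/-- The ratio of the two partition functions is the mean of `exp (s * |T|)` at fugacity `x`, so
Jensen bounds it below through the expected size. The tangent is taken at the lower bound `e` for
that size. -/
theorem partitionIn_mul_exp_ge {H : SimpleGraph W} {F : Finset W} {m : ℕ} (h : PathBound H F m)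
    {x s : ℝ} (hx : 0 ≤ x) (hs : 0 ≤ s) :
    Real.exp (s * (F.card * (x * ((1 + x) ^ m)⁻¹))) * partitionIn H F x ≤
      partitionIn H F (x * Real.exp s) := by
  set e := (F.card : ℝ) * (x * ((1 + x) ^ m)⁻¹)
  have h1 := sum_card_ge h hx
  have h2 : ∀ T ∈ indepIn H F,
      Real.exp (s * e) * (x ^ T.card * (1 + s * (T.card - e))) ≤ (x * Real.exp s) ^ T.card := by
    intro T _
    have h3 := Real.add_one_le_exp (s * (T.card - e))
    have h4 : (Real.exp s) ^ T.card = Real.exp (s * e) * Real.exp (s * (T.card - e)) := by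
      rw [← Real.exp_nat_mul, ← Real.exp_add]; ring_nf
    rw [mul_pow, h4]
    have h5 := mul_le_mul_of_nonneg_left (add_comm _ (1 : ℝ) ▸ h3)
      (mul_nonneg (Real.exp_pos (s * e)).le (pow_nonneg hx T.card))
    linarith
  refine le_trans ?_ (Finset.sum_le_sum h2)
  rw [← Finset.mul_sum]
  refine mul_le_mul_of_nonneg_left ?_ (Real.exp_pos _).le
  have h6 : ∑ T ∈ indepIn H F, x ^ T.card * (1 + s * (T.card - e)) =
      partitionIn H F x + s * (∑ T ∈ indepIn H F, x ^ T.card * (T.card : ℝ) -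
        e * partitionIn H F x) := by
    rw [partitionIn, Finset.mul_sum, ← Finset.sum_sub_distrib, Finset.mul_sum,
      ← Finset.sum_add_distrib]
    exact Finset.sum_congr rfl fun T _ => by ring
  rw [h6]
  have := mul_nonneg hs (sub_nonneg.2 h1)
  linarith

/-- **Local occupancy** of a graph all of whose paths have at most `m` vertices. -/
theorem partitionIn_le_local_occupancy {H : SimpleGraph W} {F : Finset W} {m : ℕ}
    (h : PathBound H F m) {x t : ℝ} (hx : 0 < x) (ht : -1 < t) :
    partitionIn H F x ≤ Real.exp t / (1 + t) +
      (1 + x) ^ m * Real.log (1 + x) / (x * (1 + t)) *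
        ∑ T ∈ indepIn H F, x ^ T.card * (T.card : ℝ) := by
  have ht' : 0 < 1 + t := by linarith
  set L := Real.log (1 + x)
  have hL : 0 ≤ L := Real.log_nonneg (by linarith)
  set Z := partitionIn H F x
  have hZ : 0 < Z := partitionIn_pos H F hx.le
  have hZ1 : Z * Real.exp (-(L * F.card)) ≤ 1 := by
    have h1 := partitionIn_le H F hx.le
    have h2 : (1 + x) ^ F.card = Real.exp (L * F.card) := by
      rw [mul_comm, Real.exp_nat_mul, Real.exp_log (by linarith)]
    rw [h2] at h1
    calc _ ≤ Real.exp (L * F.card) * Real.exp (-(L * F.card)) :=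
          mul_le_mul_of_nonneg_right h1 (Real.exp_pos _).le
      _ = 1 := by rw [← Real.exp_add]; simp
  have h3 := sum_card_ge h hx.le
  have h4 : (1 + x) ^ m * L / (x * (1 + t)) * ((F.card : ℝ) * (x * ((1 + x) ^ m)⁻¹) * Z) =
      L * F.card * Z / (1 + t) := by
    field_simp
  have h5 := mul_le_mul_of_nonneg_left h3
    (show 0 ≤ (1 + x) ^ m * L / (x * (1 + t)) by positivity)
  rw [h4] at h5
  refine le_trans ?_ (add_le_add_right h5 _)
  rw [← add_div, le_div_iff₀ ht']
  -- With `z = L * F.card` and `Z ≤ exp z`, this tangent gives `(1 + t - z) * Z ≤ exp t`; the term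
  -- `z * Z` is absorbed by the expected size.
  have h6 := Real.add_one_le_exp (t - L * F.card)
  have h7 : Z * Real.exp (t - L * F.card) ≤ Real.exp t := by
    calc _ = Real.exp t * (Z * Real.exp (-(L * F.card))) := by
          rw [sub_eq_add_neg, Real.exp_add]; ring
      _ ≤ Real.exp t * 1 := mul_le_mul_of_nonneg_left hZ1 (Real.exp_pos _).le
      _ = _ := mul_one _
  have h8 := mul_le_mul_of_nonneg_left h6 hZ.le
  nlinarith

/-- Local occupancy around a vertex, in the hard-core model on `U`. -/
theorem partitionIn_le_vertex_occupancy {H : SimpleGraph W} {U : Finset W} {v : W} (hv : v ∈ U)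
    {m : ℕ} (h : PathBound H (U.filter fun y => H.Adj v y) m) {x t : ℝ} (hx : 0 < x)
    (ht : -1 < t) :
    partitionIn H U x ≤
      (1 + x) / x * (Real.exp t / (1 + t)) *
          ∑ I ∈ indepIn H U, x ^ I.card * (if v ∈ I then 1 else 0) +
        (1 + x) ^ m * Real.log (1 + x) / (x * (1 + t)) *
          ∑ I ∈ indepIn H U, x ^ I.card * ((I.filter fun y => H.Adj v y).card : ℝ) := by
  have ht' : 0 < 1 + t := by linarith
  set N := U.filter fun y => H.Adj v y
  set β := Real.exp t / (1 + t)
  have hβ : 0 < β := by positivity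
  set γ := (1 + x) ^ m * Real.log (1 + x) / (x * (1 + t))
  -- When no neighbour of `v` is occupied, `v` itself is occupied with conditional probability `x /
  -- (1 + x)`; otherwise the left side vanishes.
  have hA : ∑ I ∈ indepIn H U, x ^ I.card *
        (if (I.filter fun y => H.Adj v y) = ∅ then 1 else 0) ≤
      ∑ I ∈ indepIn H U, x ^ I.card * ((1 + x) / x * (if v ∈ I then 1 else 0)) := by
    refine sum_indepIn_le_of_fiber H (singleton_subset_iff.2 hv) hx.le fun J hJ => ?_
    have hvJ : v ∉ J := fun h => by
      have := (mem_sdiff.1 ((mem_indepIn.1 hJ).1 h)).2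
      simp at this
    by_cases hJN : (J.filter fun y => H.Adj v y) = ∅
    · have hfree : freeIn H {v} J = {v} := by
        refine filter_eq_self.2 fun y hy z hz hyz => ?_
        rw [mem_singleton] at hy
        subst hy
        have : z ∈ J.filter fun z => H.Adj y z := mem_filter.2 ⟨hz, hyz⟩
        rw [hJN] at this
        simp at this
      have hind : indepIn H {v} = {∅, {v}} := by
        ext T
        rw [mem_indepIn, subset_singleton_iff]
        simp only [mem_insert, mem_singleton, and_iff_left_iff_imp]
        rintro (rfl | rfl) <;> simp
      rw [hfree, hind, sum_pair (singleton_ne_empty v).symm, sum_pair (singleton_ne_empty v).symm]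
      simp only [union_empty, hvJ, card_empty, card_singleton, filter_union, hJN]
      rw [if_pos (by simp)]
      simp
      field_simp
      exact le_rfl
    · refine Finset.sum_le_sum fun T _ => ?_
      rw [if_neg, mul_zero]
      · positivity
      · intro h0
        rw [filter_union, union_eq_empty] at h0
        exact hJN h0.1
  -- Given the set outside `N`, the occupied neighbours follow the hard-core model on the unblocked
  -- part of `N`, where local occupancy applies. The empty set has weight `1` there, which produces
  -- the term `β`.
  have hB : ∑ I ∈ indepIn H U, x ^ I.card * 1 ≤
      ∑ I ∈ indepIn H U, x ^ I.card *
        (β * (if (I.filter fun y => H.Adj v y) = ∅ then 1 else 0) +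
          γ * ((I.filter fun y => H.Adj v y).card : ℝ)) := by
    refine sum_indepIn_le_of_fiber H (P := N) (filter_subset _ _) hx.le fun J hJ => ?_
    have hJN : (J.filter fun y => H.Adj v y) = ∅ := by
      refine filter_eq_empty_iff.2 fun y hy hvy => ?_
      have := mem_sdiff.1 ((mem_indepIn.1 hJ).1 hy)
      exact this.2 (mem_filter.2 ⟨this.1, hvy⟩)
    have hTN : ∀ T ∈ indepIn H (freeIn H N J), ((J ∪ T).filter fun y => H.Adj v y) = T := by
      intro T hT
      rw [filter_union, hJN, empty_union]
      exact filter_eq_self.2 fun y hy =>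
        (mem_filter.1 (freeIn_subset _ _ _ ((mem_indepIn.1 hT).1 hy))).2
    have h1 := partitionIn_le_local_occupancy (h.mono (freeIn_subset H N J)) hx ht
    have h2 : ∑ T ∈ indepIn H (freeIn H N J), x ^ T.card * 1 = partitionIn H (freeIn H N J) x := by
      simp [partitionIn]
    rw [h2]
    refine h1.trans (le_of_eq ?_)
    have h3 : ∀ T ∈ indepIn H (freeIn H N J), x ^ T.card *
        (β * (if ((J ∪ T).filter fun y => H.Adj v y) = ∅ then 1 else 0) +
          γ * (((J ∪ T).filter fun y => H.Adj v y).card : ℝ)) =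
        (if T = ∅ then β else 0) + γ * (x ^ T.card * (T.card : ℝ)) := by
      intro T hT
      rw [hTN T hT]
      split_ifs with h0
      · subst h0; simp
      · ring
    rw [Finset.sum_congr rfl h3, Finset.sum_add_distrib, ← Finset.mul_sum,
      Finset.sum_ite_eq' _ _ fun _ => β, if_pos (empty_mem_indepIn _ _)]
  have h1 : ∑ I ∈ indepIn H U, x ^ I.card * 1 = partitionIn H U x := by simp [partitionIn]
  rw [h1] at hB
  refine hB.trans ?_
  have h2 : ∑ I ∈ indepIn H U, x ^ I.card *
        (β * (if (I.filter fun y => H.Adj v y) = ∅ then 1 else 0) +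
          γ * ((I.filter fun y => H.Adj v y).card : ℝ)) =
      β * ∑ I ∈ indepIn H U, x ^ I.card *
        (if (I.filter fun y => H.Adj v y) = ∅ then 1 else 0) +
      γ * ∑ I ∈ indepIn H U, x ^ I.card * ((I.filter fun y => H.Adj v y).card : ℝ) := by
    rw [Finset.mul_sum, Finset.mul_sum, ← Finset.sum_add_distrib]
    exact Finset.sum_congr rfl fun T _ => by ring
  have h3 : ∑ I ∈ indepIn H U, x ^ I.card * ((1 + x) / x * (if v ∈ I then 1 else 0)) =
      (1 + x) / x * ∑ I ∈ indepIn H U, x ^ I.card * (if v ∈ I then 1 else 0) := by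
    rw [Finset.mul_sum]
    exact Finset.sum_congr rfl fun T _ => by ring
  rw [h3] at hA
  rw [h2]
  refine add_le_add_left ?_ _
  calc _ ≤ β * _ := mul_le_mul_of_nonneg_left hA hβ.le
    _ = _ := by ring

end HardCore

/-! ### Regularity of the Lambert function on nonnegative arguments. -/

section Lambert

theorem lambertW_nonneg {y : ℝ} (hy : 0 ≤ y) : 0 ≤ lambertW y := by
  by_contra! h
  have := mul_neg_of_neg_of_pos h (Real.exp_pos (lambertW y))
  linarith [(lambertW_spec hy).2]

theorem sub_le_sub_mul_exp {a b : ℝ} (ha : 0 ≤ a) (hab : a ≤ b) :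
    b - a ≤ b * Real.exp b - a * Real.exp a := by
  have h1 : Real.exp a ≤ Real.exp b := Real.exp_le_exp.2 hab
  have h2 : 1 ≤ Real.exp b := Real.one_le_exp (ha.trans hab)
  nlinarith [mul_nonneg ha (sub_nonneg.2 h1), mul_nonneg (sub_nonneg.2 hab) (sub_nonneg.2 h2)]

/-- The function `u * exp u` has slope at least `1` for `u ≥ 0`, so its inverse is 1-Lipschitz. -/
theorem lambertW_sub_le {y z : ℝ} (hy : 0 ≤ y) (hz : 0 ≤ z) :
    |lambertW y - lambertW z| ≤ |y - z| := by
  have h1 := (lambertW_spec hy).2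
  have h2 := (lambertW_spec hz).2
  rcases le_total (lambertW y) (lambertW z) with h | h
  · have := sub_le_sub_mul_exp (lambertW_nonneg hy) h
    rw [abs_sub_comm, abs_of_nonneg (by linarith), abs_sub_comm]
    exact le_trans (by linarith) (le_abs_self _)
  · have := sub_le_sub_mul_exp (lambertW_nonneg hz) h
    rw [abs_of_nonneg (by linarith)]
    exact le_trans (by linarith) (le_abs_self _)

theorem continuousOn_lambertW : ContinuousOn lambertW (Set.Ici 0) := by
  refine (LipschitzOnWith.of_dist_le_mul (K := 1) fun y hy z hz => ?_).continuousOn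
  simpa [Real.dist_eq] using lambertW_sub_le hy hz

/-- Replaces the quotient, which is `0 / 0` at the origin, by an expression continuous there. -/
theorem lambertW_div_self {y : ℝ} (hy : 0 < y) :
    lambertW y / y = Real.exp (-lambertW y) := by
  have h := (lambertW_spec hy.le).2
  rw [div_eq_iff hy.ne', Real.exp_neg, eq_comm, inv_mul_eq_iff_eq_mul₀ (Real.exp_ne_zero _)]
  linarith

end Lambert

/-! ### Part (i): the occupancy fraction. -/

section Occupancy

variable {V : Type u} [Fintype V]

theorem indepSets_eq (G : SimpleGraph V) : indepSets G = indepIn G univ := by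
  unfold indepSets indepIn
  rw [powerset_univ]

theorem occupancyFraction_eq_div (G : SimpleGraph V) (x : ℝ) :
    occupancyFraction G x = (∑ I ∈ indepIn G univ, x ^ I.card * (I.card : ℝ)) /
      partitionIn G univ x / Fintype.card V := by
  unfold occupancyFraction hardCoreProb partitionFunction
  rw [indepSets_eq]
  congr 1
  rw [Finset.sum_div]
  exact Finset.sum_congr rfl fun I _ => by rw [partitionIn, div_mul_eq_mul_div]

/-- The expected size of a hard-core independent set increases with the fugacity. -/
theorem occupancyFraction_mono (G : SimpleGraph V) {x y : ℝ} (hx : 0 ≤ x) (hxy : x ≤ y) :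
    occupancyFraction G x ≤ occupancyFraction G y := by
  have hy := hx.trans hxy
  rw [occupancyFraction_eq_div, occupancyFraction_eq_div]
  refine div_le_div_of_nonneg_right ?_ (by positivity)
  rw [div_le_div_iff₀ (partitionIn_pos _ _ hx) (partitionIn_pos _ _ hy)]
  unfold partitionIn
  rw [Finset.sum_mul_sum, Finset.sum_mul_sum]
  -- After cross-multiplying, the difference of the two sides is half of a double sum symmetrised in
  -- `I` and `J`, and each symmetrised term is nonnegative.
  have hterm : ∀ i j : ℕ, 0 ≤ ((i : ℝ) - j) * (y ^ i * x ^ j - x ^ i * y ^ j) := by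
    have key : ∀ i j : ℕ, j ≤ i → x ^ i * y ^ j ≤ y ^ i * x ^ j := by
      intro i j hij
      obtain ⟨n, rfl⟩ := Nat.exists_eq_add_of_le hij
      have h1 : x ^ n ≤ y ^ n := pow_le_pow_left₀ hx hxy n
      have h2 : 0 ≤ x ^ j * y ^ j := by positivity
      rw [pow_add, pow_add]
      nlinarith
    intro i j
    rcases le_total j i with h | h
    · refine mul_nonneg (sub_nonneg.2 (by exact_mod_cast h)) (sub_nonneg.2 (key i j h))
    · refine mul_nonneg_of_nonpos_of_nonpos (sub_nonpos.2 (by exact_mod_cast h))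
        (sub_nonpos.2 ?_)
      have := key j i h
      linarith
  have h0 : 0 ≤ ∑ I ∈ indepIn G univ, ∑ J ∈ indepIn G univ,
      ((I.card : ℝ) - J.card) * (y ^ I.card * x ^ J.card - x ^ I.card * y ^ J.card) :=
    Finset.sum_nonneg fun I _ => Finset.sum_nonneg fun J _ => hterm _ _
  have h1 : ∑ I ∈ indepIn G univ, ∑ J ∈ indepIn G univ,
      ((I.card : ℝ) - J.card) * (y ^ I.card * x ^ J.card - x ^ I.card * y ^ J.card) =
      (∑ I ∈ indepIn G univ, ∑ J ∈ indepIn G univ,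
          (y ^ I.card * (I.card : ℝ) * x ^ J.card - x ^ I.card * (I.card : ℝ) * y ^ J.card)) +
        ∑ I ∈ indepIn G univ, ∑ J ∈ indepIn G univ,
          (y ^ J.card * (J.card : ℝ) * x ^ I.card - x ^ J.card * (J.card : ℝ) * y ^ I.card) := by
    rw [← Finset.sum_add_distrib]
    refine Finset.sum_congr rfl fun I _ => ?_
    rw [← Finset.sum_add_distrib]
    exact Finset.sum_congr rfl fun J _ => by ring
  rw [h1, Finset.sum_comm (f := fun I J : Finset V =>
    y ^ J.card * (J.card : ℝ) * x ^ I.card - x ^ J.card * (J.card : ℝ) * y ^ I.card)] at h0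
  simp only [Finset.sum_sub_distrib] at h0
  linarith

omit [Fintype V] in
theorem filter_adj_pathBound {G : SimpleGraph V} {k : ℕ} (hk : 3 ≤ k)
    (hfree : (SimpleGraph.cycleGraph k).Free G) (U : Finset V) (v : V) :
    PathBound G (U.filter fun y => G.Adj v y) (k - 2) :=
  pathBound_neighbors hk hfree fun _ hx => (mem_filter.1 hx).2

/-- Summing vertex occupancy over all `v` counts each occupied vertex once for itself and at most
`G.maxDegree` times as a neighbour. -/
theorem occupancyFraction_ge [Nonempty V] (G : SimpleGraph V) [DecidableRel G.Adj] {k : ℕ}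
    (hk : 3 ≤ k) (hΔ : 0 < G.maxDegree) (hfree : (SimpleGraph.cycleGraph k).Free G) {x : ℝ}
    (hx : 0 < x) :
    x / (1 + x) * Real.exp (-lambertW ((G.maxDegree : ℝ) * (1 + x) ^ (k - 3) *
      Real.log (1 + x))) ≤ occupancyFraction G x := by
  set y := (G.maxDegree : ℝ) * (1 + x) ^ (k - 3) * Real.log (1 + x) with hy
  have hL : 0 < Real.log (1 + x) := Real.log_pos (by linarith)
  have hΔ' : (0 : ℝ) < G.maxDegree := by exact_mod_cast hΔ
  have hy0 : 0 < y := by positivity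
  set t := lambertW y
  have ht : 0 ≤ t := lambertW_nonneg hy0.le
  have hty : t * Real.exp t = y := (lambertW_spec hy0.le).2
  set Z := partitionIn G univ x
  have hZ : 0 < Z := partitionIn_pos _ _ hx.le
  set E := ∑ I ∈ indepIn G univ, x ^ I.card * (I.card : ℝ) with hE
  set β := (1 + x) / x * (Real.exp t / (1 + t))
  set γ := (1 + x) ^ (k - 2) * Real.log (1 + x) / (x * (1 + t))
  have hγ : 0 ≤ γ := by positivity
  have hvert : ∀ v : V, Z ≤
      β * ∑ I ∈ indepIn G univ, x ^ I.card * (if v ∈ I then 1 else 0) +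
      γ * ∑ I ∈ indepIn G univ, x ^ I.card * ((I.filter fun y => G.Adj v y).card : ℝ) :=
    fun v => by
      convert partitionIn_le_vertex_occupancy (t := t) (mem_univ v)
        (filter_adj_pathBound hk hfree _ v) hx (by linarith)
  have hsum := Finset.sum_le_sum fun v (_ : v ∈ (univ : Finset V)) => hvert v
  rw [Finset.sum_const, card_univ, nsmul_eq_mul, Finset.sum_add_distrib, ← Finset.mul_sum,
    ← Finset.mul_sum] at hsum
  have h1 : ∑ I ∈ indepIn G univ, ∑ v : V, x ^ I.card * (if v ∈ I then (1 : ℝ) else 0) = E := by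
    refine Finset.sum_congr rfl fun I _ => ?_
    rw [← Finset.mul_sum, Finset.sum_boole, Finset.filter_mem_eq_inter, univ_inter]
  have h2 : ∑ I ∈ indepIn G univ, ∑ v : V,
      x ^ I.card * ((I.filter fun y => G.Adj v y).card : ℝ) ≤ G.maxDegree * E := by
    rw [hE, Finset.mul_sum]
    refine Finset.sum_le_sum fun I _ => ?_
    rw [← Finset.mul_sum]
    have h3 : ∑ v : V, (I.filter fun y => G.Adj v y).card = ∑ y ∈ I, G.degree y := by
      simp only [Finset.card_filter]
      rw [Finset.sum_comm]
      refine Finset.sum_congr rfl fun y _ => ?_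
      rw [← Finset.card_filter, ← SimpleGraph.card_neighborFinset_eq_degree]
      congr 1
      ext v
      simp [G.adj_comm]
    have h4 : ∑ y ∈ I, G.degree y ≤ I.card * G.maxDegree := by
      rw [← smul_eq_mul]
      exact Finset.sum_le_card_nsmul _ _ _ fun y _ => G.degree_le_maxDegree y
    have h5 : (∑ v : V, ((I.filter fun y => G.Adj v y).card : ℝ)) ≤ I.card * G.maxDegree := by
      rw [← h3] at h4
      exact_mod_cast h4
    calc _ ≤ x ^ I.card * (I.card * G.maxDegree) :=
          mul_le_mul_of_nonneg_left h5 (by positivity)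
      _ = _ := by ring
  rw [Finset.sum_comm] at h1 h2
  rw [h1] at hsum
  have h6 : Fintype.card V * Z ≤ (β + γ * G.maxDegree) * E := by
    have := mul_le_mul_of_nonneg_left h2 hγ
    linarith
  -- The value `t = W(y)` minimises `(exp t + y) / (1 + t)`; since `y = t * exp t`, the minimum is
  -- `exp t`. One factor `1 + x` leaves the power `k - 2`, which explains the exponent `k - 3` in
  -- `y`.
  have h7 : β + γ * G.maxDegree = (1 + x) / x * Real.exp t := by
    have hk2 : (1 + x) ^ (k - 2) = (1 + x) * (1 + x) ^ (k - 3) := by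
      rw [← pow_succ']; congr 1; omega
    have : γ * G.maxDegree = (1 + x) / x * (y / (1 + t)) := by
      simp only [γ, hy, hk2]
      field_simp
    rw [this, ← hty]
    simp only [β]
    field_simp
  rw [h7] at h6
  rw [occupancyFraction_eq_div, le_div_iff₀ (by positivity), le_div_iff₀ hZ, Real.exp_neg]
  calc x / (1 + x) * (Real.exp t)⁻¹ * Fintype.card V * Z =
        x / (1 + x) * (Real.exp t)⁻¹ * (Fintype.card V * Z) := by ring
    _ ≤ x / (1 + x) * (Real.exp t)⁻¹ * ((1 + x) / x * Real.exp t * E) :=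
        mul_le_mul_of_nonneg_left h6 (by positivity)
    _ = E := by field_simp

theorem occupancy_bound_attained (G : SimpleGraph V) [DecidableRel G.Adj] {k : ℕ} (hk : 3 ≤ k)
    (hΔ : 0 < G.maxDegree) (hfree : (SimpleGraph.cycleGraph k).Free G) {lam : ℝ}
    (hlam : 0 < lam) :
    ∃ m : ℝ,
      IsGreatest ((fun x : ℝ => x / (1 + x) *
        (lambertW ((G.maxDegree : ℝ) * (1 + x) ^ (k - 3) * Real.log (1 + x)) /
          ((G.maxDegree : ℝ) * (1 + x) ^ (k - 3) * Real.log (1 + x)))) ''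
        Set.Icc 0 lam) m ∧
      m ≤ occupancyFraction G lam := by
  have hΔ' : (0 : ℝ) < G.maxDegree := by exact_mod_cast hΔ
  have : Nonempty V := by
    by_contra hV
    rw [not_nonempty_iff] at hV
    simp at hΔ
  set φ : ℝ → ℝ := fun x => x / (1 + x) * Real.exp (-lambertW ((G.maxDegree : ℝ) *
    (1 + x) ^ (k - 3) * Real.log (1 + x)))
  have heq : ∀ x ∈ Set.Icc 0 lam, x / (1 + x) *
        (lambertW ((G.maxDegree : ℝ) * (1 + x) ^ (k - 3) * Real.log (1 + x)) /
          ((G.maxDegree : ℝ) * (1 + x) ^ (k - 3) * Real.log (1 + x))) = φ x := by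
    intro x hx
    rcases hx.1.eq_or_lt with h | h
    · simp [φ, ← h]
    · have hL : 0 < Real.log (1 + x) := Real.log_pos (by linarith)
      have : 0 < 1 + x := by linarith
      rw [lambertW_div_self (by positivity)]
  rw [Set.image_congr heq]
  have hcont : ContinuousOn φ (Set.Icc 0 lam) := by
    have h1 : ∀ x ∈ Set.Icc 0 lam, 1 + x ≠ 0 := fun x hx => by
      have := hx.1
      positivity
    have hlog : ContinuousOn (fun x : ℝ => (G.maxDegree : ℝ) * (1 + x) ^ (k - 3) *
        Real.log (1 + x)) (Set.Icc 0 lam) :=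
      ContinuousOn.mul (by fun_prop) (ContinuousOn.log (by fun_prop) h1)
    refine ContinuousOn.mul (ContinuousOn.div (by fun_prop) (by fun_prop) h1) ?_
    refine Real.continuous_exp.comp_continuousOn (ContinuousOn.neg ?_)
    refine continuousOn_lambertW.comp hlog fun x hx => ?_
    have h2 := hx.1
    have hL : 0 ≤ Real.log (1 + x) := Real.log_nonneg (by linarith)
    simp only [Set.mem_Ici]
    positivity
  obtain ⟨x₀, hx₀, hmax⟩ := isCompact_Icc.exists_isMaxOn (Set.nonempty_Icc.2 hlam.le) hcont
  refine ⟨φ x₀, ⟨⟨x₀, hx₀, rfl⟩, ?_⟩, ?_⟩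
  · rintro _ ⟨x, hx, rfl⟩
    exact hmax hx
  · have h1 : φ lam ≤ φ x₀ := hmax ⟨hlam.le, le_rfl⟩
    -- The maximiser is not `0`, because the expression vanishes there and is positive at `lam`. At
    -- a positive maximiser the pointwise bound and monotonicity in the fugacity apply.
    rcases hx₀.1.eq_or_lt with h | h
    · have h2 : φ x₀ = 0 := by simp [φ, ← h]
      have h3 : 0 < φ lam := by positivity
      linarith
    · exact (occupancyFraction_ge G hk hΔ hfree h).trans (occupancyFraction_mono G h.le hx₀.2)

end Occupancy

/-! ### Part (ii): greedy fractional colouring. -/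

section Fractional

variable {V : Type u} [Fintype V]

/-- The time by which the greedy fractional colouring has met the demand `r v`. -/
def deadline (G : SimpleGraph V) (β γ r : V → ℝ) (v : V) : ℝ :=
  β v * r v + γ v * ∑ u ∈ univ.filter (fun u => G.Adj v u), r u

/-- Greedy fractional colouring with demands `r`. -/
theorem exists_fractional_weights (G : SimpleGraph V) {β γ : V → ℝ} (hβ : ∀ v, 0 ≤ β v)
    (hγ : ∀ v, 0 ≤ γ v)
    (hocc : ∀ U : Finset V, ∃ p : Finset V → ℝ, (∀ I, 0 ≤ p I) ∧
      ∑ I ∈ indepIn G U, p I = 1 ∧ ∀ v ∈ U,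
        0 < ∑ I ∈ indepIn G U, p I * (if v ∈ I then 1 else 0) ∧
        1 ≤ β v * ∑ I ∈ indepIn G U, p I * (if v ∈ I then 1 else 0) +
          γ v * ∑ I ∈ indepIn G U, p I * ((I.filter fun y => G.Adj v y).card : ℝ))
    (r : V → ℝ) (hr : ∀ v, 0 ≤ r v) :
    ∃ w : Finset V → ℝ, (∀ I, 0 ≤ w I) ∧
      (∀ v, ∑ I ∈ indepIn G univ, w I * (if v ∈ I then 1 else 0) = r v) ∧
      ∀ (S : Finset V) (B : ℝ), 0 ≤ B → (∀ v ∈ S, 0 < r v → deadline G β γ r v ≤ B) →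
        ∑ I ∈ indepIn G univ, w I * (if (I ∩ S).Nonempty then 1 else 0) ≤ B := by
  induction hn : (univ.filter fun v => r v ≠ 0).card using Nat.strong_induction_on
    generalizing r with
  | _ n ih =>
  subst hn
  set U := univ.filter fun v => r v ≠ 0 with hU
  have hmemU : ∀ v, v ∈ U ↔ 0 < r v := by
    intro v
    rw [hU, mem_filter]
    simp only [mem_univ, true_and]
    exact ⟨fun h => lt_of_le_of_ne (hr v) h.symm, fun h => h.ne'⟩
  rcases U.eq_empty_or_nonempty with h0 | hne
  · refine ⟨fun _ => 0, fun _ => le_rfl, fun v => ?_, fun S B hB _ => by simpa using hB⟩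
    have : v ∉ U := by rw [h0]; simp
    rw [hmemU] at this
    simp only [zero_mul, sum_const_zero]
    linarith [hr v]
  obtain ⟨p, hp0, hp1, hp⟩ := hocc U
  have hsub : indepIn G U ⊆ indepIn G univ := fun I hI => by
    rw [mem_indepIn] at hI ⊢
    exact ⟨subset_univ _, hI.2⟩
  set P : V → ℝ := fun v => ∑ I ∈ indepIn G U, p I * (if v ∈ I then 1 else 0) with hPdef
  have hPpos : ∀ v ∈ U, 0 < P v := fun v hv => (hp v hv).1
  have hP0 : ∀ v, 0 ≤ P v := fun v =>
    Finset.sum_nonneg fun I _ => mul_nonneg (hp0 I) (by positivity)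
  have hPz : ∀ v, v ∉ U → P v = 0 := by
    intro v hv
    refine Finset.sum_eq_zero fun I hI => ?_
    rw [if_neg (fun h => hv ((mem_indepIn.1 hI).1 h)), mul_zero]
  -- Use the distribution `p` for the time `τ` at which the first demand in `U` is met; then fewer
  -- vertices have nonzero demand.
  obtain ⟨v₀, hv₀, hmin⟩ := Finset.exists_min_image U (fun v => r v / P v) hne
  set τ := r v₀ / P v₀ with hτ
  have hτ0 : 0 ≤ τ := div_nonneg (hr _) (hP0 _)
  set r' : V → ℝ := fun v => r v - τ * P v
  have hr' : ∀ v, 0 ≤ r' v := by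
    intro v
    by_cases hv : v ∈ U
    · have := (le_div_iff₀ (hPpos v hv)).1 (hmin v hv)
      simp only [r']; linarith
    · simp only [r', hPz v hv]; linarith [hr v]
  have hr'le : ∀ v, r' v ≤ r v := fun v => by
    have := mul_nonneg hτ0 (hP0 v)
    simp only [r']; linarith
  have hlt : (univ.filter fun v => r' v ≠ 0).card < U.card := by
    refine card_lt_card ⟨fun v hv => ?_, fun h => ?_⟩
    · rw [hmemU]
      have h1 := (mem_filter.1 hv).2
      exact (lt_of_le_of_ne (hr' v) h1.symm).trans_le (hr'le v)
    · have h1 := (mem_filter.1 (h hv₀)).2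
      apply h1
      simp only [r', hτ]
      have := (hPpos v₀ hv₀).ne'
      field_simp
      ring
  obtain ⟨w', hw0, hw1, hw2⟩ := ih _ hlt r' hr' rfl
  set q : Finset V → ℝ := fun I => if I ∈ indepIn G U then p I else 0
  have hqsum : ∀ f : Finset V → ℝ,
      ∑ I ∈ indepIn G univ, q I * f I = ∑ I ∈ indepIn G U, p I * f I := by
    intro f
    rw [← Finset.sum_subset hsub]
    · exact Finset.sum_congr rfl fun I hI => by simp only [q, if_pos hI]
    · intro I _ hI
      simp only [q, if_neg hI, zero_mul]
  have hsplit : ∀ f : Finset V → ℝ,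
      ∑ I ∈ indepIn G univ, (w' I + τ * q I) * f I =
        ∑ I ∈ indepIn G univ, w' I * f I + τ * ∑ I ∈ indepIn G U, p I * f I := by
    intro f
    rw [← hqsum, Finset.mul_sum, ← Finset.sum_add_distrib]
    exact Finset.sum_congr rfl fun I _ => by ring
  refine ⟨fun I => w' I + τ * q I, fun I => ?_, fun v => ?_, fun S B hB hS => ?_⟩
  · have h1 : 0 ≤ q I := by simp only [q]; split_ifs <;> [exact hp0 I; exact le_rfl]
    exact add_nonneg (hw0 I) (mul_nonneg hτ0 h1)
  · rw [hsplit, hw1]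
    simp only [r', P]; ring
  rw [hsplit]
  by_cases hSU : ∃ v ∈ S, v ∈ U
  · have hdl : ∀ v ∈ U, deadline G β γ r' v + τ ≤ deadline G β γ r v := by
      intro v hv
      have h1 := (hp v hv).2
      have h2 : ∑ I ∈ indepIn G U, p I * ((I.filter fun y => G.Adj v y).card : ℝ) =
          ∑ u ∈ univ.filter (fun u => G.Adj v u), P u := by
        rw [hPdef, Finset.sum_comm]
        refine Finset.sum_congr rfl fun I _ => ?_
        rw [← Finset.mul_sum, Finset.sum_boole]
        congr 3
        ext u
        simp [and_comm]
      rw [h2] at h1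
      have h3 := mul_le_mul_of_nonneg_left h1 hτ0
      unfold deadline
      simp only [r', Finset.sum_sub_distrib, ← Finset.mul_sum]
      simp only [hPdef] at h3 ⊢
      linarith
    obtain ⟨v, hvS, hvU⟩ := hSU
    have hτB : 0 ≤ B - τ := by
      have h1 := hdl v hvU
      have h2 := hS v hvS ((hmemU v).1 hvU)
      have h3 : 0 ≤ deadline G β γ r' v :=
        add_nonneg (mul_nonneg (hβ v) (hr' v))
          (mul_nonneg (hγ v) (Finset.sum_nonneg fun u _ => hr' u))
      linarith
    have h4 := hw2 S (B - τ) hτB fun v hv hv' => by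
      have hrv := hv'.trans_le (hr'le v)
      linarith [hdl v ((hmemU v).2 hrv), hS v hv hrv]
    have h5 : ∑ I ∈ indepIn G U, p I * (if (I ∩ S).Nonempty then 1 else 0) ≤ 1 := by
      refine le_trans (Finset.sum_le_sum fun I _ => ?_) hp1.le
      split_ifs <;> linarith [hp0 I]
    nlinarith
  · push Not at hSU
    have h4 := hw2 S 0 le_rfl fun v hv hv' =>
      absurd ((hmemU v).2 (hv'.trans_le (hr'le v))) (hSU v hv)
    have h5 : ∑ I ∈ indepIn G U, p I * (if (I ∩ S).Nonempty then (1 : ℝ) else 0) = 0 := by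
      refine Finset.sum_eq_zero fun I hI => ?_
      rw [if_neg, mul_zero]
      rintro ⟨v, hv⟩
      rw [mem_inter] at hv
      exact hSU v hv.2 ((mem_indepIn.1 hI).1 hv.1)
    rw [h5]
    linarith

/-- Weights on independent sets whose total up to each deadline fits can be laid out as
consecutive intervals, in order of their deadlines. -/
theorem exists_colouring_of_weights (G : SimpleGraph V) {w : Finset V → ℝ} {d : V → ℝ}
    (hw : ∀ I, 0 ≤ w I) (hd : ∀ v, 0 ≤ d v)
    (hsum : ∀ v, ∑ I ∈ indepIn G univ, w I * (if v ∈ I then 1 else 0) = 1)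
    (hdead : ∀ (S : Finset V) (B : ℝ), 0 ≤ B → (∀ v ∈ S, d v ≤ B) →
        ∑ I ∈ indepIn G univ, w I * (if (I ∩ S).Nonempty then 1 else 0) ≤ B) :
    ∃ c : Finset V → Set ℝ, (∀ r : ℝ, (∀ v, d v ≤ r) → IsFractionalColouring G r c) ∧
      ∀ v, colourSet G c v ⊆ Set.Ico 0 (d v) := by
  -- The deadline of a set is the earliest deadline of its vertices.
  let D : Finset V → ℝ := fun I => if h : I.Nonempty then I.inf' h d else 0
  have hD : ∀ I : Finset V, I.Nonempty → ∃ v ∈ I, D I = d v := by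
    intro I hI
    obtain ⟨v, hv, h⟩ := Finset.exists_mem_eq_inf' hI d
    exact ⟨v, hv, by simp only [D, dif_pos hI, h]⟩
  have hDle : ∀ (I : Finset V) (v), v ∈ I → D I ≤ d v := by
    intro I v hv
    have hne : I.Nonempty := ⟨v, hv⟩
    simp only [D, dif_pos hne]
    exact Finset.inf'_le _ hv
  -- An arbitrary enumeration breaks ties between equal deadlines, so the order of the intervals is
  -- strict.
  let key : Finset V → ℝ ×ₗ Fin (Fintype.card (Finset V)) := fun I =>
    toLex (D I, Fintype.equivFin _ I)
  have hkey : Function.Injective key := by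
    intro I J h
    have h1 := congrArg (fun z => (ofLex z).2) h
    simpa [key] using h1
  have hkeyD : ∀ I J, key I ≤ key J → D I ≤ D J := by
    intro I J h
    rcases Prod.Lex.toLex_le_toLex.1 h with h | h
    · exact h.le
    · exact h.1.le
  let A : Finset V → Finset (Finset V) := fun I =>
    (indepIn G univ).filter fun J => J.Nonempty ∧ key J < key I
  let start : Finset V → ℝ := fun I => ∑ J ∈ A I, w J
  have hstart0 : ∀ I, 0 ≤ start I := fun I => Finset.sum_nonneg fun J _ => hw J
  have hstart : ∀ I J, I ∈ indepIn G univ → I.Nonempty → key I < key J →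
      start I + w I ≤ start J := by
    intro I J hI hIne hIJ
    have h1 : I ∉ A I := fun h => lt_irrefl _ (mem_filter.1 h).2.2
    rw [add_comm]
    simp only [start]
    rw [← Finset.sum_insert h1]
    refine Finset.sum_le_sum_of_subset_of_nonneg (fun K hK => ?_) fun K _ _ => hw K
    rcases mem_insert.1 hK with rfl | hK
    · exact mem_filter.2 ⟨hI, hIne, hIJ⟩
    · have := mem_filter.1 hK
      exact mem_filter.2 ⟨this.1, this.2.1, this.2.2.trans hIJ⟩
  -- Every set laid out no later than `I` contains a vertex with deadline at most `D I`; by `hdead`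
  -- the total weight of such sets fits into time `D I`.
  have hend : ∀ I, I ∈ indepIn G univ → I.Nonempty → start I + w I ≤ D I := by
    intro I hI hIne
    obtain ⟨v, hv, hDv⟩ := hD I hIne
    have h2 := hdead (univ.filter fun v => d v ≤ D I) (D I) (hDv ▸ hd v)
      fun v hv => (mem_filter.1 hv).2
    refine le_trans ?_ h2
    have h1 : I ∉ A I := fun h => lt_irrefl _ (mem_filter.1 h).2.2
    rw [add_comm]
    simp only [start]
    rw [← Finset.sum_insert h1]
    simp only [mul_ite, mul_one, mul_zero]
    rw [← Finset.sum_filter]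
    refine Finset.sum_le_sum_of_subset_of_nonneg (fun K hK => ?_) fun K _ _ => hw K
    have hK' : K ∈ indepIn G univ ∧ K.Nonempty ∧ D K ≤ D I := by
      rcases mem_insert.1 hK with rfl | hK
      · exact ⟨hI, hIne, le_rfl⟩
      · have := mem_filter.1 hK
        exact ⟨this.1, this.2.1, hkeyD _ _ this.2.2.le⟩
    refine mem_filter.2 ⟨hK'.1, ?_⟩
    obtain ⟨u, hu, hDu⟩ := hD K hK'.2.1
    exact ⟨u, mem_inter.2 ⟨hu, mem_filter.2 ⟨mem_univ _, hDu ▸ hK'.2.2⟩⟩⟩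
  let c : Finset V → Set ℝ := fun I =>
    if I.Nonempty then Set.Ico (start I) (start I + w I) else ∅
  refine ⟨c, fun r hr => ⟨fun I _ => ?_, fun I hI => ?_, fun I hI J hJ hIJ => ?_, fun v => ?_⟩,
    fun v => ?_⟩
  · simp only [c]
    split_ifs
    · exact Set.ordConnected_Ico
    · exact Set.ordConnected_empty
  · simp only [c]
    split_ifs with h
    · rw [indepSets_eq] at hI
      obtain ⟨v, hv, hDv⟩ := hD I h
      exact Set.Ico_subset_Ico (hstart0 I) ((hend I hI h).trans (hDv ▸ hr v))
    · exact Set.empty_subset _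
  · rw [indepSets_eq] at hI hJ
    simp only [c]
    split_ifs with h1 h2
    · rw [Set.Ico_disjoint_Ico]
      rcases lt_or_gt_of_ne (hkey.ne hIJ) with h | h
      · exact (min_le_left _ _).trans ((hstart I J hI h1 h).trans (le_max_right _ _))
      · exact (min_le_right _ _).trans ((hstart J I hJ h2 h).trans (le_max_left _ _))
    all_goals simp
  · rw [indepSets_eq]
    have h1 : ∀ I ∈ (indepIn G univ).filter (fun I => v ∈ I),
        MeasureTheory.volume (c I) = ENNReal.ofReal (w I) := by
      intro I hI
      have hne : I.Nonempty := ⟨v, (mem_filter.1 hI).2⟩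
      simp only [c, if_pos hne, Real.volume_Ico, add_sub_cancel_left]
    rw [Finset.sum_congr rfl h1, ← ENNReal.ofReal_sum_of_nonneg fun I _ => hw I,
      Finset.sum_filter]
    have h2 := hsum v
    simp only [mul_ite, mul_one, mul_zero] at h2
    rw [h2, ENNReal.ofReal_one]
  · rintro x ⟨I, hI, hvI, hx⟩
    rw [indepSets_eq] at hI
    have hne : I.Nonempty := ⟨v, hvI⟩
    simp only [c, if_pos hne] at hx
    exact ⟨(hstart0 I).trans hx.1, hx.2.trans_le ((hend I hI hne).trans (hDle I v hvI))⟩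

/-- Fractional colouring of a `C_k`-free graph from the hard-core model at fugacity `x`. -/
theorem exists_local_fractional_colouring (G : SimpleGraph V) [DecidableRel G.Adj] {k : ℕ}
    (hk : 3 ≤ k) (hfree : (SimpleGraph.cycleGraph k).Free G) {x : ℝ} (hx : 0 < x) (t : V → ℝ)
    (ht : ∀ v, -1 < t v) {b : V → ℝ}
    (hb : ∀ v, (1 + x) / x * (Real.exp (t v) / (1 + t v)) +
      (1 + x) ^ (k - 2) * Real.log (1 + x) / (x * (1 + t v)) * G.degree v ≤ b v) :
    ∃ c : Finset V → Set ℝ, (∀ r : ℝ, (∀ v, b v ≤ r) → IsFractionalColouring G r c) ∧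
      ∀ v, colourSet G c v ⊆ Set.Ico 0 (b v) := by
  have ht' : ∀ v, 0 < 1 + t v := fun v => by linarith [ht v]
  have hL : 0 ≤ Real.log (1 + x) := Real.log_nonneg (by linarith)
  set β : V → ℝ := fun v => (1 + x) / x * (Real.exp (t v) / (1 + t v))
  set γ : V → ℝ := fun v => (1 + x) ^ (k - 2) * Real.log (1 + x) / (x * (1 + t v))
  have hβ : ∀ v, 0 ≤ β v := fun v => by have := ht' v; positivity
  have hγ : ∀ v, 0 ≤ γ v := fun v => by have := ht' v; positivity
  obtain ⟨w, hw0, hw1, hw2⟩ := exists_fractional_weights G hβ hγ (fun U => by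
    have hZ := partitionIn_pos G U hx.le
    refine ⟨fun I => x ^ I.card / partitionIn G U x, fun I => by positivity, ?_, fun v hv => ?_⟩
    · rw [← Finset.sum_div]
      exact div_self hZ.ne'
    · have hdiv : ∀ f : Finset V → ℝ, ∑ I ∈ indepIn G U, x ^ I.card / partitionIn G U x * f I =
          (∑ I ∈ indepIn G U, x ^ I.card * f I) / partitionIn G U x := by
        intro f
        rw [Finset.sum_div]
        exact Finset.sum_congr rfl fun I _ => by ring
      rw [hdiv, hdiv]
      refine ⟨div_pos ?_ hZ, ?_⟩
      · refine lt_of_lt_of_le ?_ (sum_indepIn_mem_ge G hv hx.le)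
        positivity
      · have := partitionIn_le_vertex_occupancy hv (filter_adj_pathBound hk hfree U v) hx (ht v)
        rw [← mul_div_assoc, ← mul_div_assoc, ← add_div, le_div_iff₀ hZ, one_mul]
        exact this) (fun _ => 1) (fun _ => zero_le_one)
  have hdl : ∀ v, deadline G β γ (fun _ => 1) v ≤ b v := by
    intro v
    refine le_trans (le_of_eq ?_) (hb v)
    unfold deadline
    rw [Finset.sum_const, nsmul_eq_mul, mul_one, mul_one, ← SimpleGraph.card_neighborFinset_eq_degree,
      SimpleGraph.neighborFinset_eq_filter]
    congr!
  have hdl0 : ∀ v, 0 ≤ deadline G β γ (fun _ => 1) v := fun v =>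
    add_nonneg (mul_nonneg (hβ v) zero_le_one)
      (mul_nonneg (hγ v) (Finset.sum_nonneg fun _ _ => zero_le_one))
  exact exists_colouring_of_weights G hw0 (fun v => (hdl0 v).trans (hdl v)) hw1
    fun S B hB hS => hw2 S B hB fun v hv _ => (hdl v).trans (hS v hv)

end Fractional

/-! ### The lopsided local lemma for finite weighted sums. -/

section LocalLemma

variable {ι α : Type*}

/-- The indicator of the outcomes that avoid all events of `S`. -/
def avoidInd (B : ι → α → Prop) (S : Finset ι) (ω : α) : ℝ := if ∀ v ∈ S, ¬ B v ω then 1 else 0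

theorem avoidInd_nonneg (B : ι → α → Prop) (S : Finset ι) (ω : α) : 0 ≤ avoidInd B S ω := by
  unfold avoidInd; positivity

/-- The total weight of the outcomes that avoid all events of `S`. -/
def avoidWeight (Ω : Finset α) (wt : α → ℝ) (B : ι → α → Prop) (S : Finset ι) : ℝ :=
  ∑ ω ∈ Ω, wt ω * avoidInd B S ω

/-- The total weight of the outcomes in `B u` that avoid all events of `S`. -/
def avoidWeightAnd (Ω : Finset α) (wt : α → ℝ) (B : ι → α → Prop) (u : ι) (S : Finset ι) : ℝ :=
  ∑ ω ∈ Ω, wt ω * (avoidInd B S ω * (if B u ω then 1 else 0))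

theorem avoidWeight_insert (Ω : Finset α) (wt : α → ℝ) (B : ι → α → Prop) (u : ι)
    (S : Finset ι) : avoidWeight Ω wt B (insert u S) =
      avoidWeight Ω wt B S - avoidWeightAnd Ω wt B u S := by
  unfold avoidWeight avoidWeightAnd avoidInd
  rw [← Finset.sum_sub_distrib]
  refine Finset.sum_congr rfl fun ω _ => ?_
  by_cases h1 : ∀ v ∈ S, ¬ B v ω <;> by_cases h2 : B u ω
  · rw [if_pos h1, if_pos h2, if_neg (by simp [h2])]; ring
  · rw [if_pos h1, if_neg h2, if_pos (by simpa [h2] using h1)]; ring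
  · rw [if_neg h1, if_pos h2, if_neg (by simp [h2])]; ring
  · rw [if_neg h1, if_neg h2, if_neg (by simpa [h2] using h1)]; ring

theorem avoidWeightAnd_anti {Ω : Finset α} {wt : α → ℝ} (hwt : ∀ ω ∈ Ω, 0 ≤ wt ω)
    (B : ι → α → Prop) (u : ι) {S T : Finset ι} (h : T ⊆ S) :
    avoidWeightAnd Ω wt B u S ≤ avoidWeightAnd Ω wt B u T := by
  refine Finset.sum_le_sum fun ω hω => mul_le_mul_of_nonneg_left ?_ (hwt ω hω)
  refine mul_le_mul_of_nonneg_right ?_ (by positivity)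
  unfold avoidInd
  by_cases h1 : ∀ v ∈ S, ¬ B v ω
  · rw [if_pos h1, if_pos fun v hv => h1 v (h hv)]
  · rw [if_neg h1]; positivity

/-- A union bound: avoiding `R` in addition to `T` loses at most the weights of the single events of
`R`. -/
theorem avoidWeight_union_ge {Ω : Finset α} {wt : α → ℝ} (hwt : ∀ ω ∈ Ω, 0 ≤ wt ω)
    (B : ι → α → Prop) (T R : Finset ι) :
    avoidWeight Ω wt B T - ∑ v ∈ R, avoidWeightAnd Ω wt B v T ≤
      avoidWeight Ω wt B (R ∪ T) := by
  induction R using Finset.induction_on with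
  | empty => simp
  | insert v R hv ih =>
    rw [Finset.sum_insert hv, insert_union, avoidWeight_insert]
    have := avoidWeightAnd_anti hwt B v (S := R ∪ T) subset_union_right
    linarith

theorem avoidWeight_nonneg {Ω : Finset α} {wt : α → ℝ} (hwt : ∀ ω ∈ Ω, 0 ≤ wt ω)
    (B : ι → α → Prop) (S : Finset ι) : 0 ≤ avoidWeight Ω wt B S :=
  Finset.sum_nonneg fun ω hω => mul_nonneg (hwt ω hω) (avoidInd_nonneg _ _ _)

/-- The usual induction on `S`. Dropping the dependent events `R` costs a factor of at most `2`: by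
induction, their joint conditional probability given avoidance of the others is at most `2 * p * d ≤
1 / 2`. -/
theorem avoidWeightAnd_le {Ω : Finset α} {wt : α → ℝ} (hwt : ∀ ω ∈ Ω, 0 ≤ wt ω)
    {B : ι → α → Prop} {Γ : ι → Finset ι} {p d : ℝ} (hp : 0 ≤ p) (hΓ : ∀ u, ((Γ u).card : ℝ) ≤ d)
    (hpd : 4 * p * d ≤ 1)
    (hB : ∀ u S, (∀ v ∈ S, v ∉ Γ u) → avoidWeightAnd Ω wt B u S ≤ p * avoidWeight Ω wt B S)
    (u : ι) (S : Finset ι) : avoidWeightAnd Ω wt B u S ≤ 2 * p * avoidWeight Ω wt B S := by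
  induction hn : S.card using Nat.strong_induction_on generalizing S u with
  | _ n ih =>
  subst hn
  set T := S.filter fun v => v ∉ Γ u
  set R := S.filter fun v => v ∈ Γ u
  have hRT : R ∪ T = S := filter_union_filter_not_eq _ _
  have h1 : avoidWeightAnd Ω wt B u S ≤ p * avoidWeight Ω wt B T :=
    (avoidWeightAnd_anti hwt B u (filter_subset _ _)).trans
      (hB u T fun v hv => (mem_filter.1 hv).2)
  have hT0 := avoidWeight_nonneg hwt B T
  have h2 : avoidWeight Ω wt B T ≤ 2 * avoidWeight Ω wt B S := by
    rcases R.eq_empty_or_nonempty with hR | hR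
    · have : T = S := by rw [← hRT, hR, empty_union]
      rw [this]
      linarith [avoidWeight_nonneg hwt B S]
    · have hlt : T.card < S.card := by
        refine card_lt_card ⟨filter_subset _ _, fun h => ?_⟩
        obtain ⟨v, hv⟩ := hR
        have hv' := mem_filter.1 hv
        exact (mem_filter.1 (h hv'.1)).2 hv'.2
      have h3 := avoidWeight_union_ge hwt B T R
      rw [hRT] at h3
      have h4 : ∑ v ∈ R, avoidWeightAnd Ω wt B v T ≤ R.card • (2 * p * avoidWeight Ω wt B T) :=
        Finset.sum_le_card_nsmul _ _ _ fun v _ => ih _ hlt v T rfl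
      rw [nsmul_eq_mul] at h4
      have h5 : (R.card : ℝ) ≤ d := by
        refine le_trans ?_ (hΓ u)
        exact_mod_cast card_le_card fun v hv => (mem_filter.1 hv).2
      have h6 : (R.card : ℝ) * (2 * p * avoidWeight Ω wt B T) ≤
          d * (2 * p * avoidWeight Ω wt B T) := mul_le_mul_of_nonneg_right h5 (by positivity)
      have h7 := mul_le_mul_of_nonneg_right hpd hT0
      nlinarith
  have h3 := mul_le_mul_of_nonneg_left h2 hp
  linarith

/-- The lopsided Lovász local lemma, for weighted outcomes. -/
theorem exists_avoiding [Fintype ι] {Ω : Finset α} {wt : α → ℝ} (hwt : ∀ ω ∈ Ω, 0 ≤ wt ω)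
    (hpos : 0 < ∑ ω ∈ Ω, wt ω)
    {B : ι → α → Prop} {Γ : ι → Finset ι} {p d : ℝ} (hp : 0 ≤ p) (hp1 : p < 1 / 2)
    (hΓ : ∀ u, ((Γ u).card : ℝ) ≤ d) (hpd : 4 * p * d ≤ 1)
    (hB : ∀ u S, (∀ v ∈ S, v ∉ Γ u) → avoidWeightAnd Ω wt B u S ≤ p * avoidWeight Ω wt B S) :
    ∃ ω ∈ Ω, ∀ u, ¬ B u ω := by
  have key : ∀ S : Finset ι, 0 < avoidWeight Ω wt B S := by
    intro S
    induction S using Finset.induction_on with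
    | empty => simpa [avoidWeight, avoidInd] using hpos
    | insert u S _ ih =>
      rw [avoidWeight_insert]
      have := avoidWeightAnd_le hwt hp hΓ hpd hB u S
      nlinarith
  by_contra! hcon
  have h := key univ
  rw [avoidWeight, Finset.sum_eq_zero] at h
  · exact lt_irrefl _ h
  · intro ω hω
    rw [avoidInd, if_neg, mul_zero]
    intro hall
    obtain ⟨u, hu⟩ := hcon ω hω
    exact hall u (mem_univ u) hu

end LocalLemma

/-! ### Independent transversals by counting. -/

section Finishing

variable {V : Type u} {W : Type w}

/-- The independent sets of `H` that meet each of the lists `R v`, `v ∈ S`. -/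
def transversals (H : SimpleGraph W) (R : V → Finset W) (S : Finset V) : Finset (Finset W) :=
  (indepIn H (S.biUnion R)).filter fun I => ∀ v ∈ S, ∃ x ∈ I, x ∈ R v

theorem mem_transversals {H : SimpleGraph W} {R : V → Finset W} {S : Finset V} {I : Finset W} :
    I ∈ transversals H R S ↔
      (I ⊆ S.biUnion R ∧ ∀ x ∈ I, ∀ y ∈ I, ¬ H.Adj x y) ∧ ∀ v ∈ S, ∃ x ∈ I, x ∈ R v := by
  rw [transversals, mem_filter, mem_indepIn]

/-- Removing `y` is injective on the sets containing it. As the lists are cliques, `y` was the only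
element from `R v`. -/
theorem card_transversals_mem_le {H : SimpleGraph W} {R : V → Finset W} {S : Finset V}
    (hdisj : ∀ v v' x, x ∈ R v → x ∈ R v' → v = v')
    (hcl : ∀ v, ∀ x ∈ R v, ∀ y ∈ R v, x ≠ y → H.Adj x y) {v : V} (hv : v ∈ S) {y : W}
    (hy : y ∈ R v) :
    ((transversals H R S).filter fun I => y ∈ I).card ≤
      (transversals H R (S.erase v)).card := by
  refine card_le_card_of_injOn (fun I => I.erase y) ?_ ?_
  · intro I hI
    rw [mem_coe, mem_filter, mem_transversals] at hI
    obtain ⟨⟨⟨h1, h2⟩, h3⟩, h4⟩ := hI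
    rw [mem_coe, mem_transversals]
    refine ⟨⟨fun x hx => ?_, fun x hx z hz => h2 x (mem_of_mem_erase hx) z (mem_of_mem_erase hz)⟩,
      fun v' hv' => ?_⟩
    · obtain ⟨hxy, hxI⟩ := mem_erase.1 hx
      obtain ⟨v', hv', hxv'⟩ := mem_biUnion.1 (h1 hxI)
      refine mem_biUnion.2 ⟨v', mem_erase.2 ⟨?_, hv'⟩, hxv'⟩
      rintro rfl
      exact h2 x hxI y h4 (hcl _ x hxv' y hy hxy)
    · obtain ⟨hne, hv'S⟩ := mem_erase.1 hv'
      obtain ⟨x, hxI, hx⟩ := h3 v' hv'S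
      refine ⟨x, mem_erase.2 ⟨?_, hxI⟩, hx⟩
      rintro rfl
      exact hne (hdisj _ _ _ hx hy)
  · intro I hI J hJ hIJ
    rw [mem_coe, mem_filter] at hI hJ
    have := congrArg (insert y) hIJ
    simpa [insert_erase hI.2, insert_erase hJ.2] using this

/-- Adding one vertex multiplies the number of transversals by at least `ℓ / 2`. An extension by `x
∈ R u` fails only when `I` contains one of at most `ℓ / 4` conflicting colours. By induction each of
these lies in at most a `2 / ℓ` fraction of the transversals, so at least half of the pairs `(I, x)`
survive. -/
theorem card_transversals_insert_ge {H : SimpleGraph W} {R : V → Finset W} {A : Finset V} {ℓ : ℝ}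
    (hℓ : 0 < ℓ) (hdisj : ∀ v v' x, x ∈ R v → x ∈ R v' → v = v')
    (hcl : ∀ v, ∀ x ∈ R v, ∀ y ∈ R v, x ≠ y → H.Adj x y)
    (hsize : ∀ v ∈ A, ℓ ≤ (R v).card)
    (hdeg : ∀ v ∈ A, ∀ x ∈ R v,
      (((A.biUnion R \ R v).filter fun y => H.Adj x y).card : ℝ) ≤ ℓ / 4)
    {S : Finset V} (hS : S ⊆ A) {u : V} (hu : u ∈ A) (huS : u ∉ S) :
    ℓ / 2 * ((transversals H R S).card : ℝ) ≤ ((transversals H R (insert u S)).card : ℝ) := by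
  induction hn : S.card using Nat.strong_induction_on generalizing S u with
  | _ n ih =>
  subst hn
  set N := ((transversals H R S).card : ℝ) with hN
  have hnotmem : ∀ I ∈ transversals H R S, ∀ x ∈ R u, x ∉ I := by
    intro I hI x hx hxI
    obtain ⟨v, hv, hxv⟩ := mem_biUnion.1 ((mem_transversals.1 hI).1.1 hxI)
    exact huS (hdisj _ _ _ hx hxv ▸ hv)
  have hinj : ∑ I ∈ transversals H R S, ((R u).filter fun x => ∀ y ∈ I, ¬ H.Adj x y).card ≤
      (transversals H R (insert u S)).card := by
    rw [← Finset.card_sigma]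
    refine card_le_card_of_injOn (fun p => insert p.2 p.1) ?_ ?_
    · rintro ⟨I, x⟩ hp
      rw [mem_coe, mem_sigma, mem_filter] at hp
      obtain ⟨hI, hx, hfree⟩ := hp
      obtain ⟨⟨h1, h2⟩, h3⟩ := mem_transversals.1 hI
      rw [mem_coe, mem_transversals]
      refine ⟨⟨?_, ?_⟩, ?_⟩
      · rw [biUnion_insert]
        exact insert_subset (mem_union_left _ hx) (h1.trans subset_union_right)
      · intro a ha b hb
        rcases mem_insert.1 ha with rfl | ha <;> rcases mem_insert.1 hb with rfl | hb
        · exact H.loopless.irrefl _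
        · exact hfree b hb
        · exact fun h => hfree a ha h.symm
        · exact h2 a ha b hb
      · intro v hv
        rcases mem_insert.1 hv with rfl | hv
        · exact ⟨x, mem_insert_self _ _, hx⟩
        · obtain ⟨y, hy, hyv⟩ := h3 v hv
          exact ⟨y, mem_insert_of_mem hy, hyv⟩
    · rintro ⟨I, x⟩ hp ⟨J, y⟩ hq hpq
      rw [mem_coe, mem_sigma, mem_filter] at hp hq
      simp only at hpq hp hq
      have hxy : x = y := by
        have h1 : x ∈ insert y J := hpq ▸ mem_insert_self x I
        exact (mem_insert.1 h1).resolve_right (hnotmem J hq.1 x hp.2.1)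
      subst hxy
      have h1 := congrArg (fun K => K.erase x) hpq
      simp only [erase_insert (hnotmem I hp.1 x hp.2.1),
        erase_insert (hnotmem J hq.1 x hp.2.1)] at h1
      rw [h1]
  have hcount : ∀ I ∈ transversals H R S,
      ((R u).card : ℝ) - ∑ x ∈ R u, ∑ y ∈ (S.biUnion R).filter (fun y => H.Adj x y),
          (if y ∈ I then (1 : ℝ) else 0) ≤
        (((R u).filter fun x => ∀ y ∈ I, ¬ H.Adj x y).card : ℝ) := by
    intro I hI
    rw [Finset.card_filter, Finset.card_eq_sum_ones]
    push_cast
    rw [← Finset.sum_sub_distrib]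
    refine Finset.sum_le_sum fun x _ => ?_
    have h0 : 0 ≤ ∑ y ∈ (S.biUnion R).filter (fun y => H.Adj x y),
        (if y ∈ I then (1 : ℝ) else 0) := Finset.sum_nonneg fun _ _ => by positivity
    split_ifs with hfree
    · linarith
    · push Not at hfree
      obtain ⟨y, hyI, hxy⟩ := hfree
      have h1 := Finset.single_le_sum (f := fun y => if y ∈ I then (1 : ℝ) else 0)
        (s := (S.biUnion R).filter (fun y => H.Adj x y)) (fun _ _ => by positivity)
        (mem_filter.2 ⟨(mem_transversals.1 hI).1.1 hyI, hxy⟩)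
      simp only [if_pos hyI] at h1
      linarith
  have hpair : ∀ y ∈ S.biUnion R,
      ∑ I ∈ transversals H R S, (if y ∈ I then (1 : ℝ) else 0) ≤ 2 / ℓ * N := by
    intro y hy
    obtain ⟨v, hv, hyv⟩ := mem_biUnion.1 hy
    rw [Finset.sum_boole]
    have h1 : (((transversals H R S).filter fun I => y ∈ I).card : ℝ) ≤
        (transversals H R (S.erase v)).card := by
      exact_mod_cast card_transversals_mem_le hdisj hcl hv hyv
    have h2 := ih _ (card_erase_lt_of_mem hv) ((erase_subset v S).trans hS) (hS hv)
      (notMem_erase v S) rfl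
    rw [insert_erase hv, ← hN] at h2
    refine h1.trans ?_
    rw [div_mul_eq_mul_div, le_div_iff₀ hℓ]
    linarith
  have hN0 : 0 ≤ N := Nat.cast_nonneg _
  have hmid : ∑ I ∈ transversals H R S, ∑ x ∈ R u,
      ∑ y ∈ (S.biUnion R).filter (fun y => H.Adj x y), (if y ∈ I then (1 : ℝ) else 0) ≤
      (R u).card * (N / 2) := by
    rw [Finset.sum_comm, ← nsmul_eq_mul]
    refine Finset.sum_le_card_nsmul _ _ _ fun x hx => ?_
    rw [Finset.sum_comm]
    have h1 := Finset.sum_le_card_nsmul _ _ _ fun y (hy : y ∈ (S.biUnion R).filter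
      (fun y => H.Adj x y)) => hpair y (mem_filter.1 hy).1
    refine h1.trans ?_
    rw [nsmul_eq_mul]
    have h2 : (((S.biUnion R).filter (fun y => H.Adj x y)).card : ℝ) ≤ ℓ / 4 := by
      refine le_trans ?_ (hdeg u hu x hx)
      refine Nat.cast_le.2 (card_le_card fun y hy => ?_)
      obtain ⟨hy1, hy2⟩ := mem_filter.1 hy
      obtain ⟨v, hv, hyv⟩ := mem_biUnion.1 hy1
      refine mem_filter.2 ⟨mem_sdiff.2 ⟨mem_biUnion.2 ⟨v, hS hv, hyv⟩, fun h => ?_⟩, hy2⟩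
      exact huS (hdisj _ _ _ h hyv ▸ hv)
    calc _ ≤ ℓ / 4 * (2 / ℓ * N) := mul_le_mul_of_nonneg_right h2 (by positivity)
      _ = N / 2 := by field_simp; norm_num
  have hfinal : (R u).card * N - (R u).card * (N / 2) ≤
      ((transversals H R (insert u S)).card : ℝ) := by
    have h1 := Finset.sum_le_sum hcount
    rw [Finset.sum_sub_distrib, Finset.sum_const, nsmul_eq_mul] at h1
    have h2 : ∑ I ∈ transversals H R S,
        (((R u).filter fun x => ∀ y ∈ I, ¬ H.Adj x y).card : ℝ) ≤
        ((transversals H R (insert u S)).card : ℝ) := by exact_mod_cast hinj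
    linarith
  have h1 := mul_le_mul_of_nonneg_right (hsize u hu) (half_pos (zero_lt_one' ℝ) |>.le)
  nlinarith [hsize u hu]

/-- An independent transversal exists when the lists are four times as long as the colour
degrees. -/
theorem exists_transversal {H : SimpleGraph W} {R : V → Finset W} {A : Finset V} {ℓ : ℝ}
    (hℓ : 0 < ℓ) (hdisj : ∀ v v' x, x ∈ R v → x ∈ R v' → v = v')
    (hcl : ∀ v, ∀ x ∈ R v, ∀ y ∈ R v, x ≠ y → H.Adj x y)
    (hsize : ∀ v ∈ A, ℓ ≤ (R v).card)
    (hdeg : ∀ v ∈ A, ∀ x ∈ R v,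
      (((A.biUnion R \ R v).filter fun y => H.Adj x y).card : ℝ) ≤ ℓ / 4) :
    ∃ I, I ∈ transversals H R A := by
  have key : ∀ S : Finset V, S ⊆ A → 0 < ((transversals H R S).card : ℝ) := by
    intro S
    induction S using Finset.induction_on with
    | empty =>
      intro _
      rw [Nat.cast_pos, card_pos]
      exact ⟨∅, mem_transversals.2 (by simp)⟩
    | insert u S huS ih =>
      intro h
      have h1 := ih ((subset_insert u S).trans h)
      have h2 := card_transversals_insert_ge hℓ hdisj hcl hsize hdeg
        ((subset_insert u S).trans h) (h (mem_insert_self u S)) huS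
      have : 0 < ℓ / 2 * ((transversals H R S).card : ℝ) := by positivity
      linarith
  have := key A le_rfl
  rw [Nat.cast_pos, card_pos] at this
  exact this

end Finishing

/-! ### Exponential moments and growth of the partition function. -/

section HardCoreTail

variable {V : Type u} {W : Type w}

theorem PathBound.of_map {H : SimpleGraph W} {G : SimpleGraph V} {P : Finset W} {Q : Finset V}
    {m : ℕ} (hQ : PathBound G Q m) (f : W → V) (hmaps : ∀ y ∈ P, f y ∈ Q)
    (hinj : ∀ y ∈ P, ∀ z ∈ P, f y = f z → y = z)
    (hadj : ∀ y ∈ P, ∀ z ∈ P, H.Adj y z → G.Adj (f y) (f z)) : PathBound H P m := by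
  intro l ⟨h1, h2, h3⟩
  have := hQ (l.map f) ⟨?_, ?_, ?_⟩
  · simpa using this
  · rw [List.isChain_iff_getElem] at h1 ⊢
    intro i hi
    rw [List.length_map] at hi
    simp only [List.getElem_map]
    exact hadj _ (h3 _ (List.getElem_mem _)) _ (h3 _ (List.getElem_mem _)) (h1 i hi)
  · exact List.Nodup.map_on (fun y hy z hz => hinj y (h3 y hy) z (h3 z hz)) h2
  · intro v hv
    obtain ⟨y, hy, rfl⟩ := List.mem_map.1 hv
    exact hmaps y (h3 y hy)

/-- The tilting factor used to bound the lower tail of the number of available colours. -/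
def tilt (s : ℝ) (T : Finset W) : ℝ :=
  Real.exp (-(s * T.card)) * (if T = ∅ then 1 / 2 else 1)

theorem tilt_nonneg (s : ℝ) (T : Finset W) : 0 ≤ tilt s T := by
  unfold tilt; positivity

/-- The left side is at most `exp (-(ω * z + exp (-z) / 2))`, and the exponent `ω * z + exp (-z) /
2` is minimal at `z = log (1 / (2 * ω))`. -/
theorem exp_sub_half_exp_le {ω z : ℝ} (hω : 0 < ω) (hz : 0 ≤ z) :
    Real.exp (-(ω * z)) - Real.exp (-z) / 2 ≤
      Real.exp (-(ω * (1 + Real.log (1 / (2 * ω))))) := by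
  set t := Real.log (1 / (2 * ω)) with ht
  have h1 : Real.exp (-(ω * z)) ≤ 1 := Real.exp_le_one_iff.2 (by nlinarith)
  have h2 : 0 < Real.exp (-z) := Real.exp_pos _
  have h3 : 1 - Real.exp (-z) / 2 ≤ Real.exp (-(Real.exp (-z) / 2)) := by
    have := Real.add_one_le_exp (-(Real.exp (-z) / 2)); linarith
  have h4 : ω * (1 + t) ≤ ω * z + Real.exp (-z) / 2 := by
    have h5 : Real.exp (-t) = 2 * ω := by
      rw [ht, Real.exp_neg, Real.exp_log (by positivity)]; simp
    have h6 := Real.add_one_le_exp (t - z)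
    have h7 : Real.exp (-z) = 2 * ω * Real.exp (t - z) := by
      rw [← h5, ← Real.exp_add]; ring_nf
    rw [h7]
    nlinarith
  calc Real.exp (-(ω * z)) - Real.exp (-z) / 2 ≤
        Real.exp (-(ω * z)) * (1 - Real.exp (-z) / 2) := by nlinarith
    _ ≤ Real.exp (-(ω * z)) * Real.exp (-(Real.exp (-z) / 2)) :=
        mul_le_mul_of_nonneg_left h3 (Real.exp_pos _).le
    _ = Real.exp (-(ω * z + Real.exp (-z) / 2)) := by rw [← Real.exp_add]; ring_nf
    _ ≤ _ := Real.exp_le_exp.2 (by linarith)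

/-- The factor `exp (-s)` per element lowers the fugacity to `x'`, and halving the empty set
subtracts `1 / 2`. With `z = x * F.card`, the first effect wins when `z` is large and the second
when `z` is small, as `partitionIn H F x ≤ exp z`. The stated bound is uniform in `F`. -/
theorem sum_tilt_le {H : SimpleGraph W} {F : Finset W} {m : ℕ} (h : PathBound H F m)
    {x s ω : ℝ} (hx : 0 < x) (hs : 0 ≤ s) (hω : 0 < ω)
    (hωs : ω ≤ s * Real.exp (-s) * ((1 + x) ^ m)⁻¹) :
    ∑ T ∈ indepIn H F, x ^ T.card * tilt s T ≤
      Real.exp (-(ω * (1 + Real.log (1 / (2 * ω))))) * partitionIn H F x := by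
  set x' := x * Real.exp (-s) with hx'
  have hx'0 : 0 < x' := by positivity
  have hx'x : x' ≤ x := mul_le_of_le_one_right hx.le (Real.exp_le_one_iff.2 (by linarith))
  set Z := partitionIn H F x
  have hZ : 0 < Z := partitionIn_pos H F hx.le
  have h1 : ∑ T ∈ indepIn H F, x ^ T.card * tilt s T = partitionIn H F x' - 1 / 2 := by
    have h2 : ∀ T ∈ indepIn H F, x ^ T.card * tilt s T =
        x' ^ T.card - if T = ∅ then 1 / 2 else 0 := by
      intro T _
      have h3 : x' ^ T.card = x ^ T.card * Real.exp (-(s * T.card)) := by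
        rw [hx', mul_pow, ← Real.exp_nat_mul]; ring_nf
      rw [tilt, h3]
      split_ifs with h0
      · subst h0; simp; norm_num
      · ring
    rw [Finset.sum_congr rfl h2, Finset.sum_sub_distrib,
      Finset.sum_ite_eq' _ _ fun _ => (1 / 2 : ℝ), if_pos (empty_mem_indepIn _ _), partitionIn]
  set z := x * F.card with hz
  have hz0 : 0 ≤ z := by positivity
  have h4 : partitionIn H F x' ≤ Real.exp (-(ω * z)) * Z := by
    have h5 := partitionIn_mul_exp_ge h hx'0.le hs
    have h6 : x' * Real.exp s = x := by rw [hx', mul_assoc, ← Real.exp_add]; simp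
    rw [h6] at h5
    have h7 : ω * z ≤ s * (F.card * (x' * ((1 + x') ^ m)⁻¹)) := by
      have h8 : ((1 + x) ^ m)⁻¹ ≤ ((1 + x') ^ m)⁻¹ :=
        inv_anti₀ (by positivity) (pow_le_pow_left₀ (by positivity) (by linarith) m)
      calc ω * z ≤ (s * Real.exp (-s) * ((1 + x) ^ m)⁻¹) * z :=
            mul_le_mul_of_nonneg_right hωs hz0
        _ = s * (F.card * (x' * ((1 + x) ^ m)⁻¹)) := by rw [hx', hz]; ring
        _ ≤ _ := by gcongr
    have h9 : Real.exp (ω * z) * partitionIn H F x' ≤ Z :=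
      (mul_le_mul_of_nonneg_right (Real.exp_le_exp.2 h7) (partitionIn_pos H F hx'0.le).le).trans h5
    rw [Real.exp_neg, inv_mul_eq_div, le_div_iff₀ (Real.exp_pos _)]
    linarith
  have h10 : Z * Real.exp (-z) ≤ 1 := by
    have h11 := partitionIn_le H F hx.le
    have h12 : (1 + x) ^ F.card ≤ Real.exp z := by
      rw [hz, mul_comm, Real.exp_nat_mul]
      exact pow_le_pow_left₀ (by positivity) (by linarith [Real.add_one_le_exp x]) _
    calc _ ≤ Real.exp z * Real.exp (-z) :=
          mul_le_mul_of_nonneg_right (h11.trans h12) (Real.exp_pos _).le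
      _ = 1 := by rw [← Real.exp_add]; simp
  rw [h1]
  have h13 := mul_le_mul_of_nonneg_right (exp_sub_half_exp_le hω hz0) hZ.le
  nlinarith

/-- Raise the fugacity from `x / e` to `x`; the expected size at `x / e` bounds the growth of the
logarithm. -/
theorem exp_le_partitionIn {H : SimpleGraph W} {F : Finset W} {m : ℕ} (h : PathBound H F m)
    {x : ℝ} (hx : 0 ≤ x) :
    Real.exp (F.card * (x * Real.exp (-1) * ((1 + x) ^ m)⁻¹)) ≤ partitionIn H F x := by
  set x' := x * Real.exp (-1) with hx'
  have hx'0 : 0 ≤ x' := by positivity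
  have hx'x : x' ≤ x := mul_le_of_le_one_right hx (Real.exp_le_one_iff.2 (by linarith))
  have h5 := partitionIn_mul_exp_ge h hx'0 (zero_le_one' ℝ)
  have h6 : x' * Real.exp 1 = x := by rw [hx', mul_assoc, ← Real.exp_add]; simp
  rw [h6, one_mul] at h5
  refine le_trans ?_ h5
  refine le_trans ?_ (le_mul_of_one_le_right (Real.exp_pos _).le (one_le_partitionIn H F hx'0))
  refine Real.exp_le_exp.2 ?_
  have h8 : ((1 + x) ^ m)⁻¹ ≤ ((1 + x') ^ m)⁻¹ :=
    inv_anti₀ (by positivity) (pow_le_pow_left₀ (by positivity) (by linarith) m)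
  gcongr

end HardCoreTail

/-! ### Part (iii): hard-core partial colourings of a cover and their completion. -/

section Covers

variable {V : Type u} {W : Type w}

/-- Lists of colours for the vertices of `G`, with conflict graph `H`. -/
structure IsListCover (G : SimpleGraph V) (H : SimpleGraph W) (L : V → Finset W) : Prop where
  disj : ∀ v v' x, x ∈ L v → x ∈ L v' → v = v'
  clique : ∀ v, ∀ x ∈ L v, ∀ y ∈ L v, x ≠ y → H.Adj x y
  adj_or_eq : ∀ v v' x y, x ∈ L v → y ∈ L v' → H.Adj x y → v = v' ∨ G.Adj v v'
  matching : ∀ v v', G.Adj v v' → ∀ x ∈ L v, ∀ y ∈ L v', ∀ z ∈ L v', H.Adj x y → H.Adj x z → y = z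

variable [Fintype V] {G : SimpleGraph V} {H : SimpleGraph W} {L : V → Finset W}

/-- The colours outside `L u` that conflict with the colour `y`. -/
def outNbrs (H : SimpleGraph W) (L : V → Finset W) (u : V) (y : W) : Finset W :=
  (univ.biUnion L \ L u).filter fun z => H.Adj y z

theorem outNbrs_subset (u : V) (y : W) : outNbrs H L u y ⊆ univ.biUnion L :=
  (filter_subset _ _).trans sdiff_subset

theorem IsListCover.exists_adj (hC : IsListCover G H L) {u : V} {y z : W} (hy : y ∈ L u)
    (hz : z ∈ outNbrs H L u y) : ∃ v, G.Adj u v ∧ z ∈ L v ∧ H.Adj y z := by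
  obtain ⟨h1, hyz⟩ := mem_filter.1 hz
  obtain ⟨h1, h2⟩ := mem_sdiff.1 h1
  obtain ⟨v, -, hzv⟩ := mem_biUnion.1 h1
  refine ⟨v, ?_, hzv, hyz⟩
  rcases hC.adj_or_eq u v y z hy hzv hyz with rfl | h
  · exact absurd hzv h2
  · exact h

/-- The matching condition puts distinct conflicts of `y` into lists of distinct neighbours of `u`,
so paths among them project to paths in a neighbourhood of `G`. -/
theorem IsListCover.pathBound_outNbrs (hC : IsListCover G H L) {k : ℕ} (hk : 3 ≤ k)
    (hfree : (SimpleGraph.cycleGraph k).Free G) {u : V} {y : W} (hy : y ∈ L u) :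
    PathBound H (outNbrs H L u y) (k - 2) := by
  have hex : ∀ z, ∃ v, z ∈ outNbrs H L u y → G.Adj u v ∧ z ∈ L v ∧ H.Adj y z := by
    intro z
    by_cases hz : z ∈ outNbrs H L u y
    · obtain ⟨v, hv⟩ := hC.exists_adj hy hz
      exact ⟨v, fun _ => hv⟩
    · exact ⟨u, fun h => absurd h hz⟩
  choose f hf using hex
  have hinj : ∀ a ∈ outNbrs H L u y, ∀ b ∈ outNbrs H L u y, f a = f b → a = b := by
    intro a ha b hb hab
    obtain ⟨h1, h2, h3⟩ := hf a ha
    obtain ⟨h4, h5, h6⟩ := hf b hb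
    exact hC.matching u (f a) h1 y hy a h2 b (hab ▸ h5) h3 h6
  refine (filter_adj_pathBound hk hfree univ u).of_map f (fun z hz => ?_) hinj ?_
  · exact mem_filter.2 ⟨mem_univ _, (hf z hz).1⟩
  · intro a ha b hb hab
    rcases hC.adj_or_eq _ _ a b (hf a ha).2.1 (hf b hb).2.1 hab with h | h
    · exact absurd (hinj a ha b hb h) hab.ne
    · exact h

theorem IsListCover.disjoint_outNbrs (hC : IsListCover G H L) {u : V} {y z : W} (hy : y ∈ L u)
    (hz : z ∈ L u) (hyz : y ≠ z) : Disjoint (outNbrs H L u y) (outNbrs H L u z) := by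
  rw [Finset.disjoint_left]
  intro a ha hb
  obtain ⟨v, huv, hav, hya⟩ := hC.exists_adj hy ha
  obtain ⟨v', _, _, hza⟩ := hC.exists_adj hz hb
  exact hyz (hC.matching v u huv.symm a hav y hy z hz hya.symm hza.symm)

/-- `Φ` does not depend on the colours given to the neighbours of `u`. -/
def IgnoresNbrs {α : Type*} (G : SimpleGraph V) (L : V → Finset W) (u : V)
    (Φ : Finset W → α) : Prop :=
  ∀ J T : Finset W, (∀ z ∈ T, ∃ v, G.Adj u v ∧ z ∈ L v) → Φ (J ∪ T) = Φ J

/-- The conflict sets of different colours of `u` are disjoint but may be joined by edges, so the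
factors are not independent. They are removed one at a time: given everything outside the conflict
set of `y`, the factor of `y` has mean at most `ρ` whatever part of that set is free, while all
other factors are fixed. -/
theorem IsListCover.sum_prod_le (hC : IsListCover G H L) {u : V} {x ρ : ℝ} (hx : 0 ≤ x)
    (hρ : 0 ≤ ρ) {g : Finset W → ℝ} (hg0 : ∀ T, 0 ≤ g T)
    (hg : ∀ y ∈ L u, ∀ F ⊆ outNbrs H L u y,
      ∑ T ∈ indepIn H F, x ^ T.card * g T ≤ ρ * partitionIn H F x)
    {Φ : Finset W → ℝ} (hΦ0 : ∀ I, 0 ≤ Φ I) (hΦ : IgnoresNbrs G L u Φ) {Q : Finset W}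
    (hQ : Q ⊆ L u) :
    ∑ I ∈ indepIn H (univ.biUnion L),
        x ^ I.card * (Φ I * ∏ y ∈ Q, g (I ∩ outNbrs H L u y)) ≤
      ρ ^ Q.card * ∑ I ∈ indepIn H (univ.biUnion L), x ^ I.card * Φ I := by
  induction Q using Finset.induction_on with
  | empty => simp
  | insert y Q hyQ ih =>
    have hy := hQ (mem_insert_self y Q)
    have hQ' : Q ⊆ L u := (subset_insert y Q).trans hQ
    have h1 : ∑ I ∈ indepIn H (univ.biUnion L),
          x ^ I.card * (Φ I * ∏ z ∈ insert y Q, g (I ∩ outNbrs H L u z)) ≤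
        ∑ I ∈ indepIn H (univ.biUnion L),
          x ^ I.card * (ρ * (Φ I * ∏ z ∈ Q, g (I ∩ outNbrs H L u z))) := by
      refine sum_indepIn_le_of_fiber H (outNbrs_subset (H := H) u y) hx fun J hJ => ?_
      set F := freeIn H (outNbrs H L u y) J
      have hF : F ⊆ outNbrs H L u y := freeIn_subset _ _ _
      have hJd : Disjoint J (outNbrs H L u y) := (subset_sdiff.1 (mem_indepIn.1 hJ).1).2
      have hT : ∀ T ∈ indepIn H F, T ⊆ outNbrs H L u y := fun T hT =>
        (mem_indepIn.1 hT).1.trans hF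
      have hΦT : ∀ T ∈ indepIn H F, Φ (J ∪ T) = Φ J := fun T hT' =>
        hΦ J T fun z hz => by
          obtain ⟨v, h1, h2, _⟩ := hC.exists_adj hy (hT T hT' hz)
          exact ⟨v, h1, h2⟩
      have hprod : ∀ T ∈ indepIn H F, ∏ z ∈ Q, g ((J ∪ T) ∩ outNbrs H L u z) =
          ∏ z ∈ Q, g (J ∩ outNbrs H L u z) := by
        intro T hT'
        refine Finset.prod_congr rfl fun z hz => ?_
        have hd : Disjoint T (outNbrs H L u z) :=
          (hC.disjoint_outNbrs hy (hQ' hz) (fun h => hyQ (h ▸ hz))).mono_left (hT T hT')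
        rw [union_inter_distrib_right, disjoint_iff_inter_eq_empty.1 hd, union_empty]
      have hself : ∀ T ∈ indepIn H F, (J ∪ T) ∩ outNbrs H L u y = T := by
        intro T hT'
        rw [union_inter_distrib_right, disjoint_iff_inter_eq_empty.1 hJd, empty_union,
          inter_eq_left.2 (hT T hT')]
      set K := Φ J * ∏ z ∈ Q, g (J ∩ outNbrs H L u z)
      have hK : 0 ≤ K := mul_nonneg (hΦ0 J) (Finset.prod_nonneg fun z _ => hg0 _)
      have hl : ∑ T ∈ indepIn H F, x ^ T.card *
          (Φ (J ∪ T) * ∏ z ∈ insert y Q, g ((J ∪ T) ∩ outNbrs H L u z)) =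
          K * ∑ T ∈ indepIn H F, x ^ T.card * g T := by
        rw [Finset.mul_sum]
        refine Finset.sum_congr rfl fun T hT' => ?_
        rw [Finset.prod_insert hyQ, hΦT T hT', hprod T hT', hself T hT']
        ring
      have hr : ∑ T ∈ indepIn H F, x ^ T.card *
          (ρ * (Φ (J ∪ T) * ∏ z ∈ Q, g ((J ∪ T) ∩ outNbrs H L u z))) =
          K * (ρ * partitionIn H F x) := by
        rw [partitionIn, Finset.mul_sum, Finset.mul_sum]
        refine Finset.sum_congr rfl fun T hT' => ?_
        rw [hΦT T hT', hprod T hT']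
        ring
      rw [hl, hr]
      exact mul_le_mul_of_nonneg_left (hg y hy F hF) hK
    have h2 : ∑ I ∈ indepIn H (univ.biUnion L),
          x ^ I.card * (ρ * (Φ I * ∏ z ∈ Q, g (I ∩ outNbrs H L u z))) =
        ρ * ∑ I ∈ indepIn H (univ.biUnion L),
          x ^ I.card * (Φ I * ∏ z ∈ Q, g (I ∩ outNbrs H L u z)) := by
      rw [Finset.mul_sum]
      exact Finset.sum_congr rfl fun I _ => by ring
    rw [h2] at h1
    refine h1.trans ?_
    rw [card_insert_of_notMem hyQ, pow_succ', mul_assoc]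
    exact mul_le_mul_of_nonneg_left (ih hQ') hρ

/-- The colours of `L u` that do not conflict with the colours `I` outside `L u`. -/
def available (H : SimpleGraph W) (L : V → Finset W) (u : V) (I : Finset W) : Finset W :=
  (L u).filter fun y => I ∩ outNbrs H L u y = ∅

/-- Each neighbour of `u` has at most one colour in `I`, and that colour conflicts with at most one
colour of `u`. -/
theorem IsListCover.sum_card_inter_le (hC : IsListCover G H L) {u : V} {I : Finset W}
    (hI : I ∈ indepIn H (univ.biUnion L)) :
    ∑ y ∈ L u, (I ∩ outNbrs H L u y).card ≤ (univ.filter fun v => G.Adj u v).card := by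
  rw [← card_biUnion fun y hy z hz hyz =>
    (hC.disjoint_outNbrs hy hz hyz).mono inter_subset_right inter_subset_right]
  have hex : ∀ z ∈ (L u).biUnion (fun y => I ∩ outNbrs H L u y),
      ∃ v, v ∈ (univ.filter fun v => G.Adj u v) ∧ z ∈ L v := by
    intro z hz
    obtain ⟨y, hy, hz⟩ := mem_biUnion.1 hz
    obtain ⟨v, h1, h2, _⟩ := hC.exists_adj hy (mem_inter.1 hz).2
    exact ⟨v, mem_filter.2 ⟨mem_univ _, h1⟩, h2⟩
  choose f hf1 hf2 using hex
  refine Finset.card_le_card_of_forall_subsingleton (fun z v => z ∈ L v) ?_ ?_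
  · intro z hz
    exact ⟨f z hz, hf1 z hz, hf2 z hz⟩
  · intro v _ a ha b hb
    have hmem : ∀ a, a ∈ (L u).biUnion (fun y => I ∩ outNbrs H L u y) → a ∈ I := fun a ha => by
      obtain ⟨y, _, h⟩ := mem_biUnion.1 ha
      exact (mem_inter.1 h).1
    by_contra hab
    exact (mem_indepIn.1 hI).2 a (hmem a ha.1) b (hmem b hb.1) (hC.clique v a ha.2 b hb.2 hab)

/-- An exponential Markov inequality. The product of the tilts is `exp (-s * (number of conflicts))`
times `2 ^ (-(number of available colours))`. With fewer than `ℓ` available colours and at most `deg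
u` conflicts it is at least `1 / K`. -/
theorem IsListCover.sum_few_available_le (hC : IsListCover G H L) {k : ℕ} (hk : 3 ≤ k)
    (hfree : (SimpleGraph.cycleGraph k).Free G) {u : V} {x s ω ℓ p : ℝ} (hx : 0 < x)
    (hs : 0 ≤ s) (hω : 0 < ω) (hωs : ω ≤ s * Real.exp (-s) * ((1 + x) ^ (k - 2))⁻¹)
    (hp : ℓ * Real.log 2 + s * ((univ.filter fun v => G.Adj u v).card : ℝ) -
      (L u).card * (ω * (1 + Real.log (1 / (2 * ω)))) ≤ Real.log p) (hp0 : 0 < p)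
    {Φ : Finset W → ℝ} (hΦ0 : ∀ I, 0 ≤ Φ I) (hΦ : IgnoresNbrs G L u Φ) :
    ∑ I ∈ indepIn H (univ.biUnion L),
        x ^ I.card * (Φ I * (if ((available H L u I).card : ℝ) < ℓ then 1 else 0)) ≤
      p * ∑ I ∈ indepIn H (univ.biUnion L), x ^ I.card * Φ I := by
  set d : ℝ := ((univ.filter fun v => G.Adj u v).card : ℝ) with hd
  set K := Real.exp (ℓ * Real.log 2 + s * d) with hK
  set ρ := Real.exp (-(ω * (1 + Real.log (1 / (2 * ω)))))
  have h1 := hC.sum_prod_le (u := u) hx.le (Real.exp_pos _).le (tilt_nonneg s)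
    (fun y hy F hF => sum_tilt_le ((hC.pathBound_outNbrs hk hfree hy).mono hF) hx hs hω hωs)
    hΦ0 hΦ (le_refl (L u))
  have h2 : ∀ I ∈ indepIn H (univ.biUnion L),
      x ^ I.card * (Φ I * (if ((available H L u I).card : ℝ) < ℓ then 1 else 0)) ≤
      K * (x ^ I.card * (Φ I * ∏ y ∈ L u, tilt s (I ∩ outNbrs H L u y))) := by
    intro I hI
    have h3 : (if ((available H L u I).card : ℝ) < ℓ then (1 : ℝ) else 0) ≤
        K * ∏ y ∈ L u, tilt s (I ∩ outNbrs H L u y) := by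
      have h0 : 0 ≤ K * ∏ y ∈ L u, tilt s (I ∩ outNbrs H L u y) :=
        mul_nonneg (Real.exp_pos _).le (Finset.prod_nonneg fun y _ => tilt_nonneg _ _)
      split_ifs with hlt
      · unfold tilt
        rw [Finset.prod_mul_distrib, ← Real.exp_sum, Finset.sum_neg_distrib, ← Finset.mul_sum,
          Finset.prod_ite, Finset.prod_const, Finset.prod_const_one, mul_one]
        have h4 : (∑ y ∈ L u, ((I ∩ outNbrs H L u y).card : ℝ)) ≤ d := by
          rw [hd]; exact_mod_cast hC.sum_card_inter_le hI
        have h5 : (1 / 2 : ℝ) ^ ((L u).filter fun y => I ∩ outNbrs H L u y = ∅).card =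
            Real.exp (-((available H L u I).card * Real.log 2)) := by
          rw [Real.exp_neg, Real.exp_nat_mul, Real.exp_log (by norm_num), one_div, inv_pow,
            available]
        rw [h5, hK, ← Real.exp_add, ← Real.exp_add]
        refine Real.one_le_exp ?_
        have h6 : 0 < Real.log 2 := Real.log_pos (by norm_num)
        have h7 := mul_le_mul_of_nonneg_left h4 hs
        nlinarith
      · exact h0
    calc _ ≤ x ^ I.card * (Φ I * (K * ∏ y ∈ L u, tilt s (I ∩ outNbrs H L u y))) :=
          mul_le_mul_of_nonneg_left (mul_le_mul_of_nonneg_left h3 (hΦ0 I)) (by positivity)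
      _ = _ := by ring
  refine (Finset.sum_le_sum h2).trans ?_
  rw [← Finset.mul_sum]
  refine (mul_le_mul_of_nonneg_left h1 (Real.exp_pos _).le).trans ?_
  rw [← mul_assoc]
  refine mul_le_mul_of_nonneg_right ?_
    (Finset.sum_nonneg fun I _ => mul_nonneg (by positivity) (hΦ0 I))
  rw [← Real.exp_nat_mul, ← Real.exp_add]
  calc _ ≤ Real.exp (Real.log p) := Real.exp_le_exp.2 (by linarith)
    _ = p := Real.exp_log hp0

/-- The colours conflicting with `y` that are still free when `I` is given outside. -/
def residual (H : SimpleGraph W) (L : V → Finset W) (u : V) (y : W) (I : Finset W) :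
    Finset W :=
  freeIn H (outNbrs H L u y) (I \ outNbrs H L u y)

/-- Given the set outside the conflicts of `y`, the residual `F` is determined, and the event asks
for the empty set among the independent sets of `F`. This has probability `1 / partitionIn H F x`,
which is tiny when `F` is large. -/
theorem IsListCover.sum_large_residual_le (hC : IsListCover G H L) {k : ℕ} (hk : 3 ≤ k)
    (hfree : (SimpleGraph.cycleGraph k).Free G) {u : V} {y : W} (hy : y ∈ L u) {x b p : ℝ}
    (hx : 0 < x) (hp : -(b * (x * Real.exp (-1) * ((1 + x) ^ (k - 2))⁻¹)) ≤ Real.log p)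
    (hp0 : 0 < p) {Φ : Finset W → ℝ} (hΦ0 : ∀ I, 0 ≤ Φ I) (hΦ : IgnoresNbrs G L u Φ) :
    ∑ I ∈ indepIn H (univ.biUnion L), x ^ I.card * (Φ I *
        (if I ∩ outNbrs H L u y = ∅ ∧ b < ((residual H L u y I).card : ℝ) then 1 else 0)) ≤
      p * ∑ I ∈ indepIn H (univ.biUnion L), x ^ I.card * Φ I := by
  have h0 : p * ∑ I ∈ indepIn H (univ.biUnion L), x ^ I.card * Φ I =
      ∑ I ∈ indepIn H (univ.biUnion L), x ^ I.card * (p * Φ I) := by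
    rw [Finset.mul_sum]
    exact Finset.sum_congr rfl fun I _ => by ring
  rw [h0]
  refine sum_indepIn_le_of_fiber H (outNbrs_subset (H := H) u y) hx.le fun J hJ => ?_
  set P := outNbrs H L u y with hP
  set F := freeIn H P J
  have hFP : F ⊆ P := freeIn_subset _ _ _
  have hJd : Disjoint J P := (subset_sdiff.1 (mem_indepIn.1 hJ).1).2
  have hT : ∀ T ∈ indepIn H F, T ⊆ P := fun T hT => (mem_indepIn.1 hT).1.trans hFP
  have hΦT : ∀ T ∈ indepIn H F, Φ (J ∪ T) = Φ J := fun T hT' =>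
    hΦ J T fun z hz => by
      obtain ⟨v, h1, h2, _⟩ := hC.exists_adj hy (hT T hT' hz)
      exact ⟨v, h1, h2⟩
  have hself : ∀ T ∈ indepIn H F, (J ∪ T) ∩ P = T := by
    intro T hT'
    rw [union_inter_distrib_right, disjoint_iff_inter_eq_empty.1 hJd, empty_union,
      inter_eq_left.2 (hT T hT')]
  have hres : ∀ T ∈ indepIn H F, residual H L u y (J ∪ T) = F := by
    intro T hT'
    rw [residual, ← hP, union_sdiff_distrib, sdiff_eq_self_of_disjoint hJd,
      sdiff_eq_empty_iff_subset.2 (hT T hT'), union_empty]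
  have hl : ∑ T ∈ indepIn H F, x ^ T.card * (Φ (J ∪ T) *
        (if (J ∪ T) ∩ P = ∅ ∧ b < ((residual H L u y (J ∪ T)).card : ℝ) then 1 else 0)) =
      Φ J * (if b < (F.card : ℝ) then 1 else 0) := by
    rw [Finset.sum_eq_single_of_mem ∅ (empty_mem_indepIn _ _)]
    · have h1 := hself ∅ (empty_mem_indepIn _ _)
      have h2 := hres ∅ (empty_mem_indepIn _ _)
      have h3 := hΦT ∅ (empty_mem_indepIn _ _)
      rw [h1, h2, h3]
      simp
    · intro T hT' hne
      rw [hself T hT', if_neg (fun h => hne h.1)]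
      simp
  have hr : ∑ T ∈ indepIn H F, x ^ T.card * (p * Φ (J ∪ T)) = p * partitionIn H F x * Φ J := by
    rw [partitionIn, Finset.mul_sum, Finset.sum_mul]
    exact Finset.sum_congr rfl fun T hT' => by rw [hΦT T hT']; ring
  rw [hl, hr, mul_comm]
  refine mul_le_mul_of_nonneg_right ?_ (hΦ0 J)
  have hZ := partitionIn_pos H F hx.le
  split_ifs with hb
  · have h1 := exp_le_partitionIn ((hC.pathBound_outNbrs hk hfree hy).mono hFP) hx.le
    have h2 : -(F.card * (x * Real.exp (-1) * ((1 + x) ^ (k - 2))⁻¹)) ≤ Real.log p := by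
      refine le_trans (neg_le_neg ?_) hp
      gcongr
    have h3 := Real.exp_le_exp.2 h2
    rw [Real.exp_log hp0] at h3
    calc (1 : ℝ) = Real.exp (-(F.card * (x * Real.exp (-1) * ((1 + x) ^ (k - 2))⁻¹))) *
          Real.exp (F.card * (x * Real.exp (-1) * ((1 + x) ^ (k - 2))⁻¹)) := by
          rw [← Real.exp_add]; simp
      _ ≤ p * partitionIn H F x := mul_le_mul h3 h1 (Real.exp_pos _).le hp0.le
  · positivity

/-- The partial colouring `I` is unsuitable at `u`: too few colours of `u` are available, or some
available colour conflicts with too many colours that are still free. -/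
def Unsuitable (H : SimpleGraph W) (L : V → Finset W) (ℓ : ℝ) (u : V) (I : Finset W) : Prop :=
  ((available H L u I).card : ℝ) < ℓ ∨
    ∃ y ∈ L u, I ∩ outNbrs H L u y = ∅ ∧ ℓ / 4 < ((residual H L u y I).card : ℝ)

/-- The vertices at which suitability may depend on the colours of the neighbours of `u`. -/
def influence (G : SimpleGraph V) (u : V) : Finset V :=
  (univ.filter fun a => G.Adj u a).biUnion fun a =>
    (insert a (univ.filter fun b => G.Adj a b)).biUnion fun b => univ.filter fun v => G.Adj b v

theorem card_influence_le {D : ℕ} (hD : ∀ v, (univ.filter fun a => G.Adj v a).card ≤ D) (u : V) :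
    (influence G u).card ≤ D * ((D + 1) * D) := by
  refine (card_biUnion_le_card_mul _ _ ((D + 1) * D) fun a _ => ?_).trans
    (Nat.mul_le_mul_right _ (hD u))
  refine (card_biUnion_le_card_mul _ _ D fun b _ => hD b).trans (Nat.mul_le_mul_right _ ?_)
  exact (card_insert_le _ _).trans (Nat.add_le_add_right (hD a) 1)

/-- Suitability at `v` looks at colours of neighbours `b` of `v` and at colours that block those,
hence only at vertices equal or adjacent to some such `b`. -/
theorem IsListCover.unsuitable_union_iff (hC : IsListCover G H L) {u v : V} {ℓ : ℝ}
    (hv : v ∉ influence G u) {J T : Finset W} (hT : ∀ z ∈ T, ∃ a, G.Adj u a ∧ z ∈ L a) :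
    Unsuitable H L ℓ v (J ∪ T) ↔ Unsuitable H L ℓ v J := by
  have hfar : ∀ a b, G.Adj u a → (a = b ∨ G.Adj a b) → ¬ G.Adj b v := by
    intro a b hua hab hbv
    refine hv (mem_biUnion.2 ⟨a, mem_filter.2 ⟨mem_univ _, hua⟩, mem_biUnion.2 ⟨b, ?_,
      mem_filter.2 ⟨mem_univ _, hbv⟩⟩⟩)
    rcases hab with rfl | hab
    · exact mem_insert_self _ _
    · exact mem_insert_of_mem (mem_filter.2 ⟨mem_univ _, hab⟩)
  have hinter : ∀ y ∈ L v, (J ∪ T) ∩ outNbrs H L v y = J ∩ outNbrs H L v y := by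
    intro y hy
    rw [union_inter_distrib_right, union_eq_left]
    intro z hz
    exfalso
    obtain ⟨hzT, hz⟩ := mem_inter.1 hz
    obtain ⟨a, hua, hza⟩ := hT z hzT
    obtain ⟨b, hvb, hzb, _⟩ := hC.exists_adj hy hz
    obtain rfl := hC.disj _ _ _ hza hzb
    exact hfar a a hua (Or.inl rfl) hvb.symm
  have hres : ∀ y ∈ L v, residual H L v y (J ∪ T) = residual H L v y J := by
    intro y hy
    refine Finset.filter_congr fun c hc => ⟨fun h z hz => h z ?_, fun h z hz => ?_⟩
    · rw [union_sdiff_distrib]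
      exact mem_union_left _ hz
    · rw [union_sdiff_distrib] at hz
      rcases mem_union.1 hz with hz | hz
      · exact h z hz
      · intro hcz
        obtain ⟨a, hua, hza⟩ := hT z (mem_sdiff.1 hz).1
        obtain ⟨b, hvb, hcb, _⟩ := hC.exists_adj hy hc
        rcases hC.adj_or_eq _ _ z c hza hcb hcz.symm with h' | h'
        · exact hfar a b hua (Or.inl h') hvb.symm
        · exact hfar a b hua (Or.inr h') hvb.symm
  have havail : available H L v (J ∪ T) = available H L v J :=
    Finset.filter_congr fun y hy => by rw [hinter y hy]
  unfold Unsuitable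
  rw [havail]
  refine or_congr Iff.rfl (exists_congr fun y => and_congr_right fun hy => ?_)
  rw [hinter y hy, hres y hy]

/-- Avoidance of events outside `influence G u` ignores the colours of the neighbours of `u`, so it
can serve as `Φ` in both tail bounds. A union bound over the list gives conditional probability at
most `p + N * q`, as the lopsided local lemma requires. -/
theorem IsListCover.exists_suitable (hC : IsListCover G H L) {k : ℕ} (hk : 3 ≤ k)
    (hfree : (SimpleGraph.cycleGraph k).Free G) {D : ℕ}
    (hD : ∀ v, (univ.filter fun a => G.Adj v a).card ≤ D) {x ℓ p q : ℝ} (hx : 0 < x)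
    (hp0 : 0 < p) (hq0 : 0 < q)
    (hp : ∀ u, ∃ s ω : ℝ, 0 ≤ s ∧ 0 < ω ∧ ω ≤ s * Real.exp (-s) * ((1 + x) ^ (k - 2))⁻¹ ∧
      ℓ * Real.log 2 + s * ((univ.filter fun v => G.Adj u v).card : ℝ) -
        (L u).card * (ω * (1 + Real.log (1 / (2 * ω)))) ≤ Real.log p)
    (hq : -(ℓ / 4 * (x * Real.exp (-1) * ((1 + x) ^ (k - 2))⁻¹)) ≤ Real.log q)
    {N : ℕ} (hN : ∀ u, (L u).card ≤ N) (hpq1 : p + N * q < 1 / 2)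
    (hpq : 4 * (p + N * q) * (D * ((D + 1) * D) : ℕ) ≤ 1) :
    ∃ I ∈ indepIn H (univ.biUnion L), ∀ u, ¬ Unsuitable H L ℓ u I := by
  refine exists_avoiding (wt := fun I : Finset W => x ^ I.card) (Γ := influence G)
    (fun I _ => by positivity) (partitionIn_pos H _ hx.le) (by positivity) hpq1
    (fun u => Nat.cast_le.2 (card_influence_le hD u)) hpq fun u S hS => ?_
  set Φ : Finset W → ℝ := avoidInd (Unsuitable H L ℓ) S
  have hΦ0 : ∀ I, 0 ≤ Φ I := avoidInd_nonneg _ _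
  have hΦ : IgnoresNbrs G L u Φ := by
    intro J T hT
    have : (∀ v ∈ S, ¬ Unsuitable H L ℓ v (J ∪ T)) ↔ ∀ v ∈ S, ¬ Unsuitable H L ℓ v J :=
      forall₂_congr fun v hv => not_congr (hC.unsuitable_union_iff (hS v hv) hT)
    simp only [Φ, avoidInd]
    by_cases h : ∀ v ∈ S, ¬ Unsuitable H L ℓ v J
    · rw [if_pos (this.2 h), if_pos h]
    · rw [if_neg (fun h' => h (this.1 h')), if_neg h]
  obtain ⟨s, ω, hs, hω, hωs, hp'⟩ := hp u
  have h1 := hC.sum_few_available_le hk hfree hx hs hω hωs hp' hp0 hΦ0 hΦ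
  have h2 := Finset.sum_le_sum fun y (hy : y ∈ L u) =>
    hC.sum_large_residual_le hk hfree hy hx hq hq0 hΦ0 hΦ
  rw [Finset.sum_const, nsmul_eq_mul, Finset.sum_comm] at h2
  set M := ∑ I ∈ indepIn H (univ.biUnion L), x ^ I.card * Φ I
  have hM0 : 0 ≤ M := Finset.sum_nonneg fun I _ => mul_nonneg (by positivity) (hΦ0 I)
  have h3 : ((L u).card : ℝ) * (q * M) ≤ N * (q * M) :=
    mul_le_mul_of_nonneg_right (Nat.cast_le.2 (hN u)) (by positivity)
  have h4 : avoidWeightAnd (indepIn H (univ.biUnion L)) (fun I : Finset W => x ^ I.card)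
      (Unsuitable H L ℓ) u S ≤
      ∑ I ∈ indepIn H (univ.biUnion L),
        (x ^ I.card * (Φ I * (if ((available H L u I).card : ℝ) < ℓ then 1 else 0)) +
        ∑ y ∈ L u, x ^ I.card * (Φ I * (if I ∩ outNbrs H L u y = ∅ ∧
          ℓ / 4 < ((residual H L u y I).card : ℝ) then 1 else 0))) := by
    refine Finset.sum_le_sum fun I _ => ?_
    rw [← Finset.mul_sum, ← Finset.mul_sum, ← mul_add, ← mul_add]
    refine mul_le_mul_of_nonneg_left (mul_le_mul_of_nonneg_left ?_ (hΦ0 I)) (by positivity)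
    have h0 : 0 ≤ ∑ y ∈ L u, (if I ∩ outNbrs H L u y = ∅ ∧
          ℓ / 4 < ((residual H L u y I).card : ℝ) then (1 : ℝ) else 0) :=
      Finset.sum_nonneg fun _ _ => by positivity
    by_cases hU : Unsuitable H L ℓ u I
    · rw [if_pos hU]
      rcases hU with hU | ⟨y, hy, hU⟩
      · rw [if_pos hU]; linarith
      · have h5 := Finset.single_le_sum (f := fun y => if I ∩ outNbrs H L u y = ∅ ∧
          ℓ / 4 < ((residual H L u y I).card : ℝ) then (1 : ℝ) else 0)
          (fun _ _ => by positivity) hy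
        simp only [if_pos hU] at h5
        have h6 : (0 : ℝ) ≤ if ((available H L u I).card : ℝ) < ℓ then 1 else 0 := by positivity
        linarith
    · rw [if_neg hU]; positivity
  rw [Finset.sum_add_distrib] at h4
  have h5 : avoidWeight (indepIn H (univ.biUnion L)) (fun I : Finset W => x ^ I.card)
      (Unsuitable H L ℓ) S = M := rfl
  rw [h5]
  linarith

/-- A suitable partial colouring extends to an independent set meeting every list. -/
theorem IsListCover.exists_colouring_of_suitable (hC : IsListCover G H L) {ℓ : ℝ} (hℓ : 0 < ℓ)
    {I : Finset W} (hI : I ∈ indepIn H (univ.biUnion L)) (hgood : ∀ u, ¬ Unsuitable H L ℓ u I) :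
    ∃ S : Finset W, H.IsIndepSet (S : Set W) ∧ S.card = Fintype.card V := by
  obtain ⟨hIU, hIind⟩ := mem_indepIn.1 hI
  -- `A` is the set of vertices left uncoloured by `I`; an available colour of such a vertex has no
  -- conflict with `I` at all.
  set A : Finset V := univ.filter fun v => ∀ x ∈ I, x ∉ L v with hA
  have hmemA : ∀ v, v ∈ A ↔ ∀ x ∈ I, x ∉ L v := fun v => by simp [hA]
  set R : V → Finset W := fun v => available H L v I
  have hRL : ∀ v, R v ⊆ L v := fun v => filter_subset _ _
  have hconf : ∀ v ∈ A, ∀ y ∈ R v, ∀ z ∈ I, ¬ H.Adj y z := by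
    intro v hv y hy z hz hyz
    have h1 := (mem_filter.1 hy).2
    have h2 : z ∈ I ∩ outNbrs H L v y := by
      refine mem_inter.2 ⟨hz, mem_filter.2 ⟨mem_sdiff.2 ⟨hIU hz, (hmemA v).1 hv z hz⟩, hyz⟩⟩
    rw [h1] at h2
    simp at h2
  obtain ⟨I', hI'⟩ := exists_transversal (H := H) (R := R) (A := A) hℓ
    (fun v v' x hx hx' => hC.disj v v' x (hRL v hx) (hRL v' hx'))
    (fun v x hx y hy => hC.clique v x (hRL v hx) y (hRL v hy))
    (fun v _ => not_lt.1 fun h => hgood v (Or.inl h))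
    -- Conflicting available colours of other uncoloured vertices are not blocked by `I`, so they
    -- lie in the residual of `x`, which has at most `ℓ / 4` elements.
    (fun v hv x hx => by
      have h1 : ((residual H L v x I).card : ℝ) ≤ ℓ / 4 :=
        not_lt.1 fun h => hgood v (Or.inr ⟨x, hRL v hx, (mem_filter.1 hx).2, h⟩)
      refine le_trans (Nat.cast_le.2 (card_le_card fun y hy => ?_)) h1
      obtain ⟨hy1, hxy⟩ := mem_filter.1 hy
      obtain ⟨hy1, hyv⟩ := mem_sdiff.1 hy1
      obtain ⟨v', hv', hyv'⟩ := mem_biUnion.1 hy1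
      refine mem_freeIn.2 ⟨mem_filter.2 ⟨mem_sdiff.2 ⟨mem_biUnion.2 ⟨v', mem_univ _,
        hRL v' hyv'⟩, fun h => ?_⟩, hxy⟩, fun z hz =>
        hconf v' hv' y hyv' z (mem_sdiff.1 hz).1⟩
      obtain rfl := hC.disj _ _ _ h (hRL v' hyv')
      exact hyv hyv')
  obtain ⟨⟨hI'sub, hI'ind⟩, hI'hit⟩ := mem_transversals.1 hI'
  have hcross : ∀ y ∈ I', ∀ z ∈ I, ¬ H.Adj y z := by
    intro y hy z hz
    obtain ⟨v, hv, hyv⟩ := mem_biUnion.1 (hI'sub hy)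
    exact hconf v hv y hyv z hz
  have hind : ∀ x ∈ I ∪ I', ∀ y ∈ I ∪ I', ¬ H.Adj x y := by
    intro x hx y hy
    rcases mem_union.1 hx with hx | hx <;> rcases mem_union.1 hy with hy | hy
    · exact hIind x hx y hy
    · exact fun h => hcross y hy x hx h.symm
    · exact hcross x hx y hy
    · exact hI'ind x hx y hy
  have hhit : ∀ v, ∃ x, x ∈ I ∪ I' ∧ x ∈ L v := by
    intro v
    by_cases hv : v ∈ A
    · obtain ⟨x, hx, hxv⟩ := hI'hit v hv
      exact ⟨x, mem_union_right _ hx, hRL v hxv⟩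
    · rw [hmemA] at hv
      push Not at hv
      obtain ⟨x, hx, hxv⟩ := hv
      exact ⟨x, mem_union_left _ hx, hxv⟩
  choose f hf1 hf2 using hhit
  refine ⟨univ.image f, ?_, ?_⟩
  · intro x hx y hy _
    obtain ⟨v, -, rfl⟩ := mem_image.1 (mem_coe.1 hx)
    obtain ⟨v', -, rfl⟩ := mem_image.1 (mem_coe.1 hy)
    exact hind _ (hf1 v) _ (hf1 v')
  · rw [card_image_of_injective, card_univ]
    intro v v' h
    exact hC.disj v v' (f v) (hf2 v) (h ▸ hf2 v')

end Covers

/-! ### Choice of parameters and asymptotic estimates. -/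

section Estimates

/-- At fugacity `η / k` the cost of the excluded cycle is a constant factor close to `1`, uniformly
in `k`. -/
theorem one_add_div_pow_le_exp {η : ℝ} (hη : 0 ≤ η) {k m : ℕ} (hmk : m ≤ k) :
    (1 + η / k) ^ m ≤ Real.exp η := by
  rcases Nat.eq_zero_or_pos k with rfl | hk
  · obtain rfl : m = 0 := by omega
    simpa using Real.one_le_exp hη
  have hk' : (0 : ℝ) < k := by exact_mod_cast hk
  have h0 : 0 ≤ η / k := by positivity
  calc (1 + η / k) ^ m ≤ (1 + η / k) ^ k := pow_le_pow_right₀ (by linarith) hmk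
    _ ≤ Real.exp (η / k) ^ k :=
        pow_le_pow_left₀ (by linarith) (by linarith [Real.add_one_le_exp (η / k)]) k
    _ = Real.exp η := by rw [← Real.exp_nat_mul]; congr 1; field_simp

theorem exp_le_one_add_two_mul {η : ℝ} (h0 : 0 ≤ η) (h1 : η ≤ 1) :
    Real.exp η ≤ 1 + η + η ^ 2 := by
  have := Real.abs_exp_sub_one_sub_id_le (x := η) (by rw [abs_of_nonneg h0]; exact h1)
  linarith [(abs_le.1 this).2]

/-- The function `log z / z` decreases for `z ≥ e`, so `z / log z` increases there. -/
theorem div_log_div_mono {M a b : ℝ} (hM : 0 < M) (ha : Real.exp 1 * M ≤ a) (hab : a ≤ b) :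
    a / Real.log (a / M) ≤ b / Real.log (b / M) := by
  have h1 : Real.exp 1 ≤ a / M := (le_div_iff₀ hM).2 ha
  have h2 : a / M ≤ b / M := div_le_div_of_nonneg_right hab hM.le
  have hpos : ∀ z, Real.exp 1 ≤ z → 0 < z ∧ 0 < Real.log z := fun z hz =>
    ⟨(Real.exp_pos 1).trans_le hz, zero_lt_one.trans_le
      ((Real.le_log_iff_exp_le ((Real.exp_pos 1).trans_le hz)).2 hz)⟩
  have h3 := Real.log_div_self_antitoneOn (Set.mem_Ici.2 h1) (Set.mem_Ici.2 (h1.trans h2)) h2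
  obtain ⟨h4, h5⟩ := hpos _ h1
  obtain ⟨h6, h7⟩ := hpos _ (h1.trans h2)
  simp only at h3
  rw [div_le_div_iff₀ h6 h4] at h3
  rw [div_le_div_iff₀ h5 h7]
  have h8 : a = a / M * M := by field_simp
  have h9 : b = b / M * M := by field_simp
  calc a * Real.log (b / M) = (Real.log (b / M) * (a / M)) * M := by
        conv_lhs => rw [h8]
        ring
    _ ≤ (Real.log (a / M) * (b / M)) * M := mul_le_mul_of_nonneg_right h3 hM.le
    _ = b * Real.log (a / M) := by
        conv_rhs => rw [h9]
        ring

/-- If `d` is below the threshold, only the second argument matters; otherwise the two logarithms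
are the same. Default values of the first quotient therefore never play a role. -/
theorem max_div_log_le {M d δ₀ : ℝ} (hM : 0 < M) :
    max d (δ₀ * M) / Real.log (max d (δ₀ * M) / M) ≤
      max (d / Real.log (d / M)) (δ₀ / Real.log δ₀ * M) := by
  rcases le_total d (δ₀ * M) with h | h
  · rw [max_eq_right h, mul_div_cancel_right₀ _ hM.ne']
    refine le_trans (le_of_eq ?_) (le_max_right _ _)
    ring
  · rw [max_eq_left h]
    exact le_max_left _ _

/-- With `x = η / k` and `t = log (η ^ 2 * D / k)`, the first term is `(1 + x) * η * D / (1 + t)`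
and the second at most `exp η * D / (1 + t)`. Together they are at most `(1 + ε / 2) * D / (1 + t)`,
and `1 + t` differs from `log (D / k)` by a constant. -/
theorem exists_fractional_parameters {ε : ℝ} (hε : 0 < ε) :
    ∃ η δ₀ : ℝ, 0 < η ∧ Real.exp 1 < δ₀ ∧ ∀ (k : ℕ) (D d : ℝ), 3 ≤ k → δ₀ * k ≤ D → 0 ≤ d →
      d ≤ D → -1 < Real.log (η ^ 2 * D / k) ∧
      (1 + η / k) / (η / k) *
          (Real.exp (Real.log (η ^ 2 * D / k)) / (1 + Real.log (η ^ 2 * D / k))) +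
        (1 + η / k) ^ (k - 2) * Real.log (1 + η / k) /
          (η / k * (1 + Real.log (η ^ 2 * D / k))) * d ≤
      (1 + ε) * (D / Real.log (D / k)) := by
  set η := min 1 (ε / 8)
  have hη0 : 0 < η := by positivity
  have hη1 : η ≤ 1 := min_le_left _ _
  have hηε : η ≤ ε / 8 := min_le_right _ _
  have hlη : Real.log η ≤ 0 := Real.log_nonpos hη0.le hη1
  -- For `y ≥ Y` the constant `2 * log η` is absorbed: `(1 + ε / 2) * y ≤ (1 + ε) * (1 + 2 * log η +
  -- y)`.
  set Y := 2 + (1 + ε) * 4 * (-Real.log η) / ε with hY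
  have hYε : ε * Y = 2 * ε + (1 + ε) * 4 * (-Real.log η) := by rw [hY]; field_simp
  refine ⟨η, Real.exp Y, hη0, Real.exp_lt_exp.2 ?_, fun k D d hk hD hd hdD => ?_⟩
  · have : 0 ≤ (1 + ε) * 4 * (-Real.log η) / ε := by
      have := neg_nonneg.2 hlη
      positivity
    linarith
  have hk' : (0 : ℝ) < k := by exact_mod_cast (show 0 < k by omega)
  have hk1 : (1 : ℝ) ≤ k := by exact_mod_cast (show 1 ≤ k by omega)
  have hD0 : 0 < D := lt_of_lt_of_le (by positivity) hD
  set y := Real.log (D / k) with hy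
  have hyY : Y ≤ y := by
    rw [hy, Real.le_log_iff_exp_le (by positivity), le_div_iff₀ hk']
    exact hD
  have hyε : ε * Y ≤ ε * y := mul_le_mul_of_nonneg_left hyY hε.le
  have ht : Real.log (η ^ 2 * D / k) = 2 * Real.log η + y := by
    rw [mul_div_assoc, Real.log_mul (by positivity) (by positivity), Real.log_pow]
    norm_num [hy]
  have hexp : Real.exp (Real.log (η ^ 2 * D / k)) = η ^ 2 * D / k :=
    Real.exp_log (by positivity)
  have h4 : 0 ≤ -Real.log η := by linarith
  have hy4 : 4 * (-Real.log η) + 2 ≤ y := by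
    by_contra! hlt
    nlinarith
  have hpos : 0 < 1 + (2 * Real.log η + y) := by linarith
  refine ⟨by rw [ht]; linarith, ?_⟩
  rw [hexp, ht]
  set P := 1 + (2 * Real.log η + y)
  set x := η / k with hx
  have hx0 : 0 < x := by positivity
  have hx1 : x ≤ η := div_le_self hη0.le hk1
  have h5 : (1 + x) / x * (η ^ 2 * D / k / P) = (1 + x) * η * D / P := by
    rw [hx]; field_simp
  have h6 : Real.log (1 + x) / x ≤ 1 := by
    rw [div_le_one hx0]
    linarith [Real.log_le_sub_one_of_pos (show 0 < 1 + x by linarith)]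
  have h7 : (1 + x) ^ (k - 2) ≤ Real.exp η := one_add_div_pow_le_exp hη0.le (by omega)
  have hL : 0 ≤ Real.log (1 + x) / x := div_nonneg (Real.log_nonneg (by linarith)) hx0.le
  have h8 : (1 + x) ^ (k - 2) * Real.log (1 + x) / (x * P) * d ≤ Real.exp η * D / P := by
    calc _ = (1 + x) ^ (k - 2) * (Real.log (1 + x) / x) * d / P := by field_simp
      _ ≤ Real.exp η * 1 * D / P := by gcongr
      _ = _ := by ring
  have h9 : (1 + x) * η * D / P ≤ 2 * η * D / P := by
    gcongr
    linarith
  rw [h5]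
  have h10 := exp_le_one_add_two_mul hη0.le hη1
  have h11 : 2 * η + Real.exp η ≤ 1 + ε / 2 := by nlinarith
  have hy0 : 0 < y := by linarith
  have h12 : (2 * η + Real.exp η) * D / P ≤ (1 + ε) * (D / y) := by
    rw [← mul_div_assoc, div_le_div_iff₀ hpos hy0]
    have h13 : (2 * η + Real.exp η) * y ≤ (1 + ε) * P := by
      have := mul_le_mul_of_nonneg_right h11 hy0.le
      simp only [P]
      nlinarith
    nlinarith
  calc _ ≤ 2 * η * D / P + Real.exp η * D / P := add_le_add h9 h8
    _ = (2 * η + Real.exp η) * D / P := by ring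
    _ ≤ _ := h12

/-- The list threshold is `ℓ = C * k * lgΔ`. The first clause makes the probability of too few
available colours at most `Δ ^ (-7)`, the second that of a large residual at most `Δ ^ (-8)`. -/
theorem exists_cover_parameters {ε : ℝ} (hε : 0 < ε) :
    ∃ η C δ₀ : ℝ, 0 < η ∧ 0 < C ∧ Real.exp 2 ≤ δ₀ ∧
      (∀ (k : ℕ) (D d lgΔ q : ℝ), 3 ≤ k → 0 < lgΔ → δ₀ * (k * lgΔ) ≤ D → 0 ≤ d → d ≤ D →
        (1 + ε) * (D / Real.log (D / (k * lgΔ))) ≤ q →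
        ∃ s ω : ℝ, 0 ≤ s ∧ 0 < ω ∧ ω ≤ s * Real.exp (-s) * ((1 + η / k) ^ (k - 2))⁻¹ ∧
          C * (k * lgΔ) * Real.log 2 + s * d - q * (ω * (1 + Real.log (1 / (2 * ω)))) ≤
            -(7 * lgΔ)) ∧
      ∀ (k : ℕ) (lgΔ : ℝ), 3 ≤ k → 0 < lgΔ →
        -(C * (k * lgΔ) / 4 * (η / k * Real.exp (-1) * ((1 + η / k) ^ (k - 2))⁻¹)) ≤
          -(8 * lgΔ) := by
  set η := min (1 / 2) (ε / 16)
  have hη0 : 0 < η := by positivity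
  have hη1 : η ≤ 1 / 2 := min_le_left _ _
  have hηε : η ≤ ε / 16 := min_le_right _ _
  -- Makes `C * η / 4 = 8 * exp 2`; the surplus `exp 2` covers the factors `exp (-1)` and `exp (-η)`
  -- of the second clause.
  set C := 32 * Real.exp 2 / η with hC
  have hC0 : 0 < C := by positivity
  -- Chosen so that `η * (s * D) = (C + 7) * M` when `s = A * M / D`, which pays for `C * M * log 2`
  -- and `7 * lgΔ`.
  set A := (C + 7) / η with hA
  have hA1 : 1 ≤ A := by
    rw [hA, le_div_iff₀ hη0]; linarith
  have hA0 : 0 < A := by linarith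
  have hlA : 0 ≤ Real.log A := Real.log_nonneg hA1
  have hAη : 1 ≤ A / η := by rw [le_div_iff₀ hη0]; linarith
  -- The middle term makes `log A` negligible against `y`; the last term forces `s ≤ η`.
  set Y := 2 + 2 * (1 + ε) * Real.log A / ε + Real.log (A / η) with hY
  have hY1 : 0 ≤ 2 * (1 + ε) * Real.log A / ε := by positivity
  have hY2 : 0 ≤ Real.log (A / η) := Real.log_nonneg hAη
  have hYε : 2 * (1 + ε) * Real.log A ≤ ε * Y := by
    have : ε * Y = 2 * ε + 2 * (1 + ε) * Real.log A + ε * Real.log (A / η) := by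
      rw [hY]; field_simp
    linarith [mul_nonneg hε.le hY2]
  have hpow : ∀ k : ℕ, Real.exp (-η) ≤ ((1 + η / k) ^ (k - 2))⁻¹ := by
    intro k
    rw [Real.exp_neg]
    exact inv_anti₀ (by positivity) (one_add_div_pow_le_exp hη0.le (by omega))
  refine ⟨η, C, Real.exp Y, hη0, hC0, Real.exp_le_exp.2 (by linarith), ?_, ?_⟩
  · intro k D d lgΔ q hk hlg hD hd hdD hq
    have hk1 : (1 : ℝ) ≤ k := by exact_mod_cast (show 1 ≤ k by omega)
    set M := k * lgΔ
    have hM0 : 0 < M := by positivity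
    have hMlg : lgΔ ≤ M := le_mul_of_one_le_left hlg.le hk1
    have hD0 : 0 < D := lt_of_lt_of_le (by positivity) hD
    set y := Real.log (D / M) with hy
    have hyY : Y ≤ y := by
      rw [hy, Real.le_log_iff_exp_le (by positivity), le_div_iff₀ hM0]
      exact hD
    have hy0 : 0 < y := by linarith
    set s := A * M / D with hs
    have hs0 : 0 < s := by positivity
    have hsη : s ≤ η := by
      have h1 : A / η ≤ Real.exp Y := by
        rw [← Real.log_le_iff_le_exp (by positivity)]
        linarith
      rw [div_le_iff₀ hη0] at h1
      rw [hs, div_le_iff₀ hD0]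
      calc A * M ≤ Real.exp Y * η * M := mul_le_mul_of_nonneg_right h1 hM0.le
        _ = η * (Real.exp Y * M) := by ring
        _ ≤ η * D := mul_le_mul_of_nonneg_left hD hη0.le
    -- Here `exp (-η)` is the lower bound `hpow` for the inverse power.
    set ω := s * Real.exp (-(s + η)) with hω
    have hω0 : 0 < ω := by positivity
    have hlogω : Real.log (1 / (2 * ω)) = -Real.log 2 - Real.log s + (s + η) := by
      rw [one_div, Real.log_inv, hω, Real.log_mul (by norm_num) (by positivity),
        Real.log_mul (by positivity) (by positivity), Real.log_exp]
      ring
    have hlogs : Real.log s = Real.log A - y := by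
      rw [hs, mul_div_assoc, Real.log_mul (by positivity) (by positivity), hy,
        ← inv_div D M, Real.log_inv]
      ring
    refine ⟨s, ω, hs0.le, hω0, ?_, ?_⟩
    · rw [hω, neg_add, Real.exp_add, ← mul_assoc]
      exact mul_le_mul_of_nonneg_left (hpow k) (by positivity)
    have hl2 : Real.log 2 ≤ 1 := by linarith [Real.log_two_lt_d9]
    have h1 : y - Real.log A ≤ 1 + Real.log (1 / (2 * ω)) := by
      rw [hlogω, hlogs]; linarith
    have hq' : (1 + ε) * D ≤ q * y := by
      rw [← mul_div_assoc, div_le_iff₀ hy0] at hq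
      exact hq
    have hq0 : 0 ≤ q := by
      refine le_trans ?_ hq
      positivity
    have h12 : (1 + ε / 2) * y ≤ (1 + ε) * (y - Real.log A) := by
      linarith [mul_le_mul_of_nonneg_left hyY hε.le]
    have hyA : 0 ≤ y - Real.log A :=
      nonneg_of_mul_nonneg_right (le_trans (by positivity) h12) (by linarith)
    have h2 : q * (ω * (y - Real.log A)) ≤ q * (ω * (1 + Real.log (1 / (2 * ω)))) := by
      gcongr
    have hsD : s * D = A * M := by rw [hs]; field_simp
    have hηA : η * A = C + 7 := by rw [hA]; field_simp
    have h3 : C * M * Real.log 2 + s * d + 7 * lgΔ ≤ (1 + η) * (s * D) := by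
      have h4 : C * M * Real.log 2 ≤ C * M := mul_le_of_le_one_right (by positivity) hl2
      have h5 : s * d ≤ s * D := mul_le_mul_of_nonneg_left hdD hs0.le
      have h6 : η * (s * D) = C * M + 7 * M := by
        rw [hsD, ← mul_assoc, hηA]; ring
      linarith
    have h7 : (1 + η) * Real.exp (s + η) ≤ 1 + ε / 2 := by
      have h8 : Real.exp (s + η) ≤ Real.exp (2 * η) := Real.exp_le_exp.2 (by linarith)
      have h9 := exp_le_one_add_two_mul (η := 2 * η) (by linarith) (by linarith)
      have hηη : η * η ≤ 1 / 2 * η := mul_le_mul_of_nonneg_right hη1 hη0.le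
      have h10 : Real.exp (s + η) ≤ 1 + 4 * η := by linarith
      have h11 := mul_le_mul_of_nonneg_left h10 (show 0 ≤ 1 + η by linarith)
      linarith
    have h13 : (1 + η) * (s * D) ≤ q * (ω * (y - Real.log A)) := by
      have hee : Real.exp (s + η) * Real.exp (-(s + η)) = 1 := by
        rw [← Real.exp_add]; simp
      have h14 : (1 + η) * D ≤ q * (y - Real.log A) * Real.exp (-(s + η)) := by
        have h15 : (1 + η) * Real.exp (s + η) * y ≤ (1 + ε) * (y - Real.log A) :=
          (mul_le_mul_of_nonneg_right h7 hy0.le).trans h12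
        have h16 : (1 + η) * Real.exp (s + η) * D * y ≤ q * (y - Real.log A) * y := by
          have h17 := mul_le_mul_of_nonneg_right h15 hD0.le
          have h18 := mul_le_mul_of_nonneg_right hq' hyA
          calc (1 + η) * Real.exp (s + η) * D * y = (1 + η) * Real.exp (s + η) * y * D := by ring
            _ ≤ (1 + ε) * (y - Real.log A) * D := h17
            _ = (1 + ε) * D * (y - Real.log A) := by ring
            _ ≤ q * y * (y - Real.log A) := h18
            _ = _ := by ring
        have h19 : (1 + η) * Real.exp (s + η) * D ≤ q * (y - Real.log A) :=
          le_of_mul_le_mul_right h16 hy0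
        have h20 := mul_le_mul_of_nonneg_right h19 (Real.exp_pos (-(s + η))).le
        calc (1 + η) * D = (1 + η) * Real.exp (s + η) * D * Real.exp (-(s + η)) := by
              linear_combination (-(1 + η) * D) * hee
          _ ≤ _ := h20
      have h21 := mul_le_mul_of_nonneg_left h14 hs0.le
      calc (1 + η) * (s * D) = s * ((1 + η) * D) := by ring
        _ ≤ _ := h21
        _ = _ := by rw [hω]; ring
    linarith
  · intro k lgΔ hk hlg
    have hk' : (0 : ℝ) < k := by exact_mod_cast (show 0 < k by omega)
    have h1 : C * (k * lgΔ) / 4 * (η / k * Real.exp (-1) * ((1 + η / k) ^ (k - 2))⁻¹) =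
        8 * lgΔ * (Real.exp 2 * Real.exp (-1) * ((1 + η / k) ^ (k - 2))⁻¹) := by
      rw [hC]; field_simp; norm_num
    have h2 : 1 ≤ Real.exp 2 * Real.exp (-1) * ((1 + η / k) ^ (k - 2))⁻¹ := by
      calc (1 : ℝ) ≤ Real.exp 2 * Real.exp (-1) * Real.exp (-η) := by
            rw [← Real.exp_add, ← Real.exp_add]
            exact Real.one_le_exp (by linarith)
        _ ≤ _ := mul_le_mul_of_nonneg_left (hpow k) (by positivity)
    rw [h1]
    exact neg_le_neg (le_mul_of_one_le_right (by positivity) h2)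

end Estimates

/-! ### The colouring theorems and the bounds on chromatic numbers. -/

section Main

theorem card_filter_adj_eq_degree {V : Type u} [Fintype V] (G : SimpleGraph V)
    [DecidableRel G.Adj] (v : V) (h : DecidablePred (G.Adj v)) :
    (@Finset.filter V (G.Adj v) h univ).card = G.degree v := by
  rw [← SimpleGraph.card_neighborFinset_eq_degree, SimpleGraph.neighborFinset_eq_filter]
  congr!

/-- Local fractional colouring of `C_k`-free graphs. -/
theorem exists_fractional_colouring {ε : ℝ} (hε : 0 < ε) :
    ∃ δ₀ : ℝ, Real.exp 1 < δ₀ ∧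
      ∀ (V : Type u) [Fintype V] (G : SimpleGraph V) [DecidableRel G.Adj] (k : ℕ),
        3 ≤ k → (SimpleGraph.cycleGraph k).Free G →
        ∃ c : Finset V → Set ℝ,
          (∀ r : ℝ, (∀ v, (1 + ε) * (max (G.degree v : ℝ) (δ₀ * k) /
            Real.log (max (G.degree v : ℝ) (δ₀ * k) / k)) ≤ r) → IsFractionalColouring G r c) ∧
          ∀ v, colourSet G c v ⊆ Set.Ico 0 ((1 + ε) * (max (G.degree v : ℝ) (δ₀ * k) /
            Real.log (max (G.degree v : ℝ) (δ₀ * k) / k))) := by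
  obtain ⟨η, δ₀, hη, hδ, h⟩ := exists_fractional_parameters hε
  refine ⟨δ₀, hδ, fun V _ G _ k hk hfree => ?_⟩
  have hk' : (0 : ℝ) < k := by exact_mod_cast (show 0 < k by omega)
  have hv := fun v : V => h k (max (G.degree v : ℝ) (δ₀ * k)) (G.degree v) hk (le_max_right _ _)
    (Nat.cast_nonneg _) (le_max_left _ _)
  exact exists_local_fractional_colouring G hk hfree (div_pos hη hk') _ (fun v => (hv v).1)
    fun v => (hv v).2

/-- Shortened lists no longer partition the vertices of the cover graph; the conditions that survive
are exactly those of `IsListCover`. -/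
theorem Cover.isListCover {V : Type u} {W : Type w} {G : SimpleGraph V} (C : Cover G W)
    {L : V → Finset W} (hL : ∀ v, L v ⊆ C.L v) : IsListCover G C.H L where
  disj v v' x hx hx' := (C.partition x).unique (hL v hx) (hL v' hx')
  clique v _ hx _ hy hxy := C.clique v (hL v hx) (hL v hy) hxy
  adj_or_eq v v' x y hx hy := C.adj_or_eq v v' x (hL v hx) y (hL v' hy)
  matching v v' h x hx y hy z hz := C.matching v v' h x (hL v hx) y (hL v' hy) z (hL v' hz)

/-- Local correspondence colouring of `C_k`-free graphs. -/
theorem exists_cover_colouring {ε : ℝ} (hε : 0 < ε) :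
    ∃ (δ₀ : ℝ) (Δ₀ : ℕ), Real.exp 2 ≤ δ₀ ∧ 4 ≤ Δ₀ ∧
      ∀ (V : Type u) [Fintype V] (G : SimpleGraph V) [DecidableRel G.Adj] (k : ℕ),
        3 ≤ k → k ≤ G.maxDegree + 1 → (SimpleGraph.cycleGraph k).Free G →
        Δ₀ ≤ G.maxDegree → ∀ (W : Type w) (C : Cover G W),
          (∀ v : V, (1 + ε) *
            (max (G.degree v : ℝ) (δ₀ * (k * Real.log G.maxDegree)) /
              Real.log (max (G.degree v : ℝ) (δ₀ * (k * Real.log G.maxDegree)) /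
                (k * Real.log G.maxDegree))) ≤ ((C.L v).card : ℝ)) → C.Colourable := by
  obtain ⟨η, C₀, δ₀, hη, hC₀, hδ, hpar, hpar'⟩ := exists_cover_parameters hε
  -- Large enough that the required list sizes, which are at most `(1 + ε) * (1 + 2 * δ₀) * Δ ^ 2`,
  -- do not exceed `Δ ^ 3`.
  refine ⟨δ₀, ⌈(1 + ε) * (1 + 2 * δ₀)⌉₊ + 4, hδ, by omega, ?_⟩
  intro V _ G _ k hk hkΔ hfree hΔ W C hC
  set Δ := G.maxDegree
  have hδ0 : 0 < δ₀ := (Real.exp_pos 2).trans_le hδ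
  have hΔ4 : (4 : ℝ) ≤ Δ := by exact_mod_cast (show 4 ≤ Δ by omega)
  have hΔε : (1 + ε) * (1 + 2 * δ₀) ≤ Δ :=
    (Nat.le_ceil _).trans (by exact_mod_cast (show ⌈(1 + ε) * (1 + 2 * δ₀)⌉₊ ≤ Δ by omega))
  have hlg : 0 < Real.log Δ := Real.log_pos (by linarith)
  have hk' : (0 : ℝ) < k := by exact_mod_cast (show 0 < k by omega)
  set M := k * Real.log Δ
  have hM0 : 0 < M := by positivity
  have hM2 : M ≤ 2 * Δ ^ 2 := by
    have h1 : (k : ℝ) ≤ Δ + 1 := by exact_mod_cast hkΔ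
    have h2 : Real.log Δ ≤ Δ := (Real.log_le_sub_one_of_pos (by linarith)).trans (by linarith)
    calc M ≤ (Δ + 1) * Δ := mul_le_mul h1 h2 hlg.le (by linarith)
      _ ≤ _ := by nlinarith
  have hcap : ∀ v : V, (1 + ε) * (max (G.degree v : ℝ) (δ₀ * M) /
      Real.log (max (G.degree v : ℝ) (δ₀ * M) / M)) ≤ ((Δ ^ 3 : ℕ) : ℝ) := by
    intro v
    set D := max (G.degree v : ℝ) (δ₀ * M)
    have hD1 : D ≤ (1 + 2 * δ₀) * Δ ^ 2 := by
      have h1 : (G.degree v : ℝ) ≤ Δ := by exact_mod_cast G.degree_le_maxDegree v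
      have h2 := mul_le_mul_of_nonneg_left hM2 hδ0.le
      refine max_le ?_ ?_
      · nlinarith
      · nlinarith
    have hD0 : 0 < D := lt_of_lt_of_le (by positivity) (le_max_right _ _)
    have hy : 1 ≤ Real.log (D / M) := by
      rw [Real.le_log_iff_exp_le (by positivity), le_div_iff₀ hM0]
      refine le_trans ?_ (le_max_right _ _)
      exact mul_le_mul_of_nonneg_right
        ((Real.exp_le_exp.2 (by norm_num)).trans hδ) hM0.le
    calc (1 + ε) * (D / Real.log (D / M)) ≤ (1 + ε) * D :=
          mul_le_mul_of_nonneg_left (div_le_self hD0.le hy) (by linarith)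
      _ ≤ (1 + ε) * ((1 + 2 * δ₀) * Δ ^ 2) := mul_le_mul_of_nonneg_left hD1 (by linarith)
      _ = ((1 + ε) * (1 + 2 * δ₀)) * Δ ^ 2 := by ring
      _ ≤ Δ * Δ ^ 2 := mul_le_mul_of_nonneg_right hΔε (by positivity)
      _ = _ := by push_cast; ring
  -- Long lists are cut to `Δ ^ 3` colours, so that the union bound over a list stays affordable; by
  -- `hcap` the size hypothesis survives.
  have hsub : ∀ v, ∃ L ⊆ C.L v, L.card = min (C.L v).card (Δ ^ 3) := fun v =>
    exists_subset_card_eq (min_le_left _ _)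
  choose L hL hLcard using hsub
  have hcov := C.isListCover hL
  have hlist : ∀ v, (1 + ε) * (max (G.degree v : ℝ) (δ₀ * M) /
      Real.log (max (G.degree v : ℝ) (δ₀ * M) / M)) ≤ ((L v).card : ℝ) := by
    intro v
    rw [hLcard, Nat.cast_min]
    exact le_min (hC v) (hcap v)
  have hΔ0 : (0 : ℝ) < Δ := by linarith
  have hp7 : Real.log (((Δ : ℝ) ^ 7)⁻¹) = -(7 * Real.log Δ) := by
    rw [Real.log_inv, Real.log_pow]; norm_num
  have hp8 : Real.log (((Δ : ℝ) ^ 8)⁻¹) = -(8 * Real.log Δ) := by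
    rw [Real.log_inv, Real.log_pow]; norm_num
  have hpq : ((Δ : ℝ) ^ 7)⁻¹ + ((Δ ^ 3 : ℕ) : ℝ) * ((Δ : ℝ) ^ 8)⁻¹ ≤ 2 * ((Δ : ℝ) ^ 5)⁻¹ := by
    have h1 : ((Δ ^ 3 : ℕ) : ℝ) * ((Δ : ℝ) ^ 8)⁻¹ = ((Δ : ℝ) ^ 5)⁻¹ := by
      push_cast; field_simp
    have h2 : ((Δ : ℝ) ^ 7)⁻¹ ≤ ((Δ : ℝ) ^ 5)⁻¹ :=
      inv_anti₀ (by positivity) (pow_le_pow_right₀ (by linarith) (by norm_num))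
    rw [h1]; linarith
  have h5 : ((Δ : ℝ) ^ 5)⁻¹ ≤ 1 / 1024 := by
    rw [one_div]
    refine inv_anti₀ (by norm_num) ?_
    calc (1024 : ℝ) = 4 ^ 5 := by norm_num
      _ ≤ _ := pow_le_pow_left₀ (by norm_num) hΔ4 5
  -- The failure probability is at most `2 * Δ ^ (-5)` and the dependency degree at most `2 * Δ ^
  -- 3`, so the local lemma needs only `16 ≤ Δ ^ 2`.
  obtain ⟨I, hI, hgood⟩ := hcov.exists_suitable hk hfree (D := Δ)
    (fun v => (card_filter_adj_eq_degree G v _).le.trans (G.degree_le_maxDegree v))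
    (x := η / k) (ℓ := C₀ * M) (p := ((Δ : ℝ) ^ 7)⁻¹) (q := ((Δ : ℝ) ^ 8)⁻¹)
    (by positivity) (by positivity) (by positivity)
    (fun u => by
      rw [card_filter_adj_eq_degree G u, hp7]
      exact hpar k (max (G.degree u : ℝ) (δ₀ * M)) (G.degree u) (Real.log Δ) (L u).card hk hlg
        (le_max_right _ _) (Nat.cast_nonneg _) (le_max_left _ _) (hlist u))
    (by rw [hp8]; exact hpar' k (Real.log Δ) hk hlg)
    (N := Δ ^ 3) (fun u => by rw [hLcard]; exact min_le_right _ _)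
    (by linarith)
    (by
      have h6 : ((Δ * ((Δ + 1) * Δ) : ℕ) : ℝ) ≤ 2 * (Δ : ℝ) ^ 3 := by
        push_cast
        have : (Δ : ℝ) ^ 3 = Δ * (Δ * Δ) := by ring
        rw [this]
        nlinarith [mul_nonneg hΔ0.le hΔ0.le, mul_nonneg (mul_nonneg hΔ0.le hΔ0.le)
          (sub_nonneg.2 hΔ4)]
      calc _ ≤ 4 * (2 * ((Δ : ℝ) ^ 5)⁻¹) * (2 * (Δ : ℝ) ^ 3) := by gcongr
        _ = 16 / (Δ : ℝ) ^ 2 := by field_simp; norm_num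
        _ ≤ 1 := by
          rw [div_le_one (by positivity)]
          nlinarith)
  exact hcov.exists_colouring_of_suitable (by positivity) hI hgood

theorem fractionalChromaticNumber_bound {ε : ℝ} (hε : 0 < ε) :
    ∃ K : ℝ, 1 < K ∧
      ∀ (V : Type u) [Fintype V] (G : SimpleGraph V) [DecidableRel G.Adj] (k : ℕ),
        3 ≤ k → (SimpleGraph.cycleGraph k).Free G → K * (k : ℝ) ≤ (G.maxDegree : ℝ) →
        fractionalChromaticNumber G ≤
          (1 + ε) * ((G.maxDegree : ℝ) / Real.log ((G.maxDegree : ℝ) / (k : ℝ))) := by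
  obtain ⟨δ₀, hδ, h⟩ := exists_fractional_colouring.{u} hε
  have h1 : (1 : ℝ) < Real.exp 1 := by simp
  refine ⟨δ₀, h1.trans hδ, fun V _ G _ k hk hfree hK => ?_⟩
  obtain ⟨c, hc, -⟩ := h V G k hk hfree
  have hk' : (0 : ℝ) < k := by exact_mod_cast (show 0 < k by omega)
  have hδ0 : 0 < δ₀ := (Real.exp_pos 1).trans hδ
  refine csInf_le ⟨0, fun r hr => hr.1⟩ ⟨?_, c, hc _ fun v => ?_⟩
  · have h2 : 1 ≤ (G.maxDegree : ℝ) / k := by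
      rw [le_div_iff₀ hk']
      exact (mul_le_mul_of_nonneg_right (h1.trans hδ).le hk'.le).trans hK
    have h3 := Real.log_nonneg h2
    positivity
  · refine mul_le_mul_of_nonneg_left (div_log_div_mono hk' ?_ ?_) (by linarith)
    · exact (mul_le_mul_of_nonneg_right hδ.le hk'.le).trans (le_max_right _ _)
    · exact max_le (by exact_mod_cast G.degree_le_maxDegree v) hK

theorem eventually_correspondence_parameters {ε η δ₀ : ℝ} (hε : 0 < ε) (hη : 0 < η)
    (hη2 : 2 * η < 1) :
    ∀ᶠ n : ℕ in atTop, Real.log n ≤ (n : ℝ) ^ η ∧ δ₀ ≤ (n : ℝ) ^ (1 - 2 * η) ∧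
      Real.log n ≤ ε / 4 * n := by
  refine tendsto_natCast_atTop_atTop.eventually (p := fun x : ℝ => Real.log x ≤ x ^ η ∧
    δ₀ ≤ x ^ (1 - 2 * η) ∧ Real.log x ≤ ε / 4 * x) ?_
  have h1 := (isLittleO_log_rpow_atTop hη).bound zero_lt_one
  have h2 := (tendsto_rpow_atTop (show 0 < 1 - 2 * η by linarith)).eventually_ge_atTop δ₀
  have h3 := Real.isLittleO_log_id_atTop.bound (show 0 < ε / 4 by positivity)
  filter_upwards [h1, h2, h3, eventually_ge_atTop 1] with x h1 h2 h3 hx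
  have h4 : 0 ≤ x := by linarith
  rw [Real.norm_eq_abs, Real.norm_of_nonneg (by positivity), one_mul] at h1
  rw [Real.norm_eq_abs, id, Real.norm_of_nonneg h4] at h3
  exact ⟨(le_abs_self _).trans h1, h2, (le_abs_self _).trans h3⟩

theorem correspondenceChromaticNumber_bound {ε : ℝ} (hε : 0 < ε) :
    ∃ (η : ℝ) (Δ₀ : ℕ), 0 < η ∧
      ∀ (V : Type u) [Fintype V] (G : SimpleGraph V) [DecidableRel G.Adj] (k : ℕ),
        3 ≤ k → k ≤ G.maxDegree + 1 → (SimpleGraph.cycleGraph k).Free G →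
        Δ₀ ≤ G.maxDegree → (k : ℝ) ≤ (G.maxDegree : ℝ) ^ η →
        (correspondenceChromaticNumber G : ℝ) ≤
          (1 + ε) * ((G.maxDegree : ℝ) / Real.log (G.maxDegree : ℝ)) := by
  obtain ⟨δ₀, Δ₁, hδ, hΔ₁, h⟩ := exists_cover_colouring.{u, 0} (half_pos hε)
  -- Solves `(1 + ε / 2) / (1 - 2 * η) = 1 + 3 * ε / 4`. Both `k` and `log Δ` are at most `Δ ^ η`,
  -- so replacing `log (Δ / M)` by `log Δ` costs the factor `1 / (1 - 2 * η)`.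
  set η := ε / 4 / (1 + 3 * ε / 4) / 2 with hηdef
  have hη : 0 < η := by positivity
  have hη2 : 1 - 2 * η = (1 + ε / 2) / (1 + 3 * ε / 4) := by
    rw [hηdef]; field_simp; ring
  have hη1 : 0 < 1 - 2 * η := by rw [hη2]; positivity
  obtain ⟨Δ₂, hΔ₂⟩ := eventually_atTop.1
    (eventually_correspondence_parameters (δ₀ := δ₀) hε hη (by linarith))
  refine ⟨η, max Δ₁ Δ₂, hη, fun V _ G _ k hk hkΔ hfree hΔ hkη => ?_⟩
  obtain ⟨hlog, hδ₀, hlin⟩ := hΔ₂ G.maxDegree ((le_max_right _ _).trans hΔ)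
  have hΔΔ₁ : Δ₁ ≤ G.maxDegree := (le_max_left _ _).trans hΔ
  set Δ : ℝ := (G.maxDegree : ℝ) with hΔdef
  have hΔ4 : (4 : ℝ) ≤ Δ := by
    rw [hΔdef]; exact_mod_cast hΔ₁.trans hΔΔ₁
  have hΔ0 : 0 < Δ := by linarith
  have hlg : 0 < Real.log Δ := Real.log_pos (by linarith)
  have hk' : (0 : ℝ) < k := by exact_mod_cast (show 0 < k by omega)
  set M := k * Real.log Δ
  have hM0 : 0 < M := by positivity
  have hMle : M ≤ Δ ^ (2 * η) := by
    rw [two_mul, Real.rpow_add hΔ0]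
    exact mul_le_mul hkη hlog hlg.le (by positivity)
  have hprod : Δ ^ (1 - 2 * η) * Δ ^ (2 * η) = Δ := by
    rw [← Real.rpow_add hΔ0]; simp
  have hδM : δ₀ * M ≤ Δ := by
    calc δ₀ * M ≤ Δ ^ (1 - 2 * η) * Δ ^ (2 * η) :=
          mul_le_mul hδ₀ hMle hM0.le (by positivity)
      _ = Δ := hprod
  have hlogM : (1 - 2 * η) * Real.log Δ ≤ Real.log (Δ / M) := by
    rw [← Real.log_rpow hΔ0]
    refine Real.log_le_log (by positivity) ?_
    rw [le_div_iff₀ hM0]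
    calc _ ≤ Δ ^ (1 - 2 * η) * Δ ^ (2 * η) := mul_le_mul_of_nonneg_left hMle (by positivity)
      _ = Δ := hprod
  -- The slack `ε / 4 * (Δ / log Δ) ≥ 1` between `1 + 3 * ε / 4` and `1 + ε` absorbs the rounding.
  set q := ⌊(1 + ε) * (Δ / Real.log Δ)⌋₊
  have hqle : (q : ℝ) ≤ (1 + ε) * (Δ / Real.log Δ) := Nat.floor_le (by positivity)
  refine le_trans (Nat.cast_le.2 (Nat.sInf_le ?_)) hqle
  intro W C hcard
  refine h V G k hk hkΔ hfree hΔΔ₁ W C fun v => ?_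
  rw [hcard v]
  have h1 : max (G.degree v : ℝ) (δ₀ * M) / Real.log (max (G.degree v : ℝ) (δ₀ * M) / M) ≤
      Δ / Real.log (Δ / M) := by
    refine div_log_div_mono hM0 ?_ (max_le ?_ hδM)
    · refine le_trans ?_ (le_max_right _ _)
      exact mul_le_mul_of_nonneg_right ((Real.exp_le_exp.2 (by norm_num)).trans hδ) hM0.le
    · exact Nat.cast_le.2 (G.degree_le_maxDegree v)
  have h2 : (1 + ε / 2) * (Δ / Real.log (Δ / M)) ≤ (1 + 3 * ε / 4) * (Δ / Real.log Δ) := by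
    calc (1 + ε / 2) * (Δ / Real.log (Δ / M)) ≤
          (1 + ε / 2) * (Δ / ((1 - 2 * η) * Real.log Δ)) := by gcongr
      _ = _ := by rw [hη2]; field_simp
  have h3 : 1 ≤ ε / 4 * (Δ / Real.log Δ) := by
    rw [← mul_div_assoc, le_div_iff₀ hlg]; linarith
  have h4 : (1 + ε) * (Δ / Real.log Δ) < q + 1 := Nat.lt_floor_add_one _
  have h5 := mul_le_mul_of_nonneg_left h1 (show 0 ≤ 1 + ε / 2 by linarith)
  linarith

end Main

end LocalOccupancy

end

theorem theorem5p2 :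
    -- (i) the occupancy fraction of the hard-core model
    (∀ (V : Type u) [Fintype V] (G : SimpleGraph V) [DecidableRel G.Adj] (k : ℕ),
      3 ≤ k → k ≤ G.maxDegree + 1 → (SimpleGraph.cycleGraph k).Free G →
      ∀ lam : ℝ, 0 < lam →
        ∃ m : ℝ,
          IsGreatest ((fun x : ℝ => x / (1 + x) *
            (LocalOccupancy.lambertW
                ((G.maxDegree : ℝ) * (1 + x) ^ (k - 3) * Real.log (1 + x)) /
              ((G.maxDegree : ℝ) * (1 + x) ^ (k - 3) * Real.log (1 + x)))) ''
            Set.Icc 0 lam) m ∧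
          m ≤ LocalOccupancy.occupancyFraction G lam) ∧
    -- (ii) local fractional colouring
    (∀ ε : ℝ, 0 < ε → ∃ δ₀ : ℝ, 1 < δ₀ ∧
      ∀ (V : Type u) [Fintype V] (G : SimpleGraph V) [DecidableRel G.Adj] (k : ℕ),
        3 ≤ k → k ≤ G.maxDegree + 1 → (SimpleGraph.cycleGraph k).Free G →
        ∃ (r : ℝ) (c : Finset V → Set ℝ), LocalOccupancy.IsFractionalColouring G r c ∧
          ∀ v : V, LocalOccupancy.colourSet G c v ⊆
            Set.Ico 0 ((1 + ε) * max
              ((G.degree v : ℝ) / Real.log ((G.degree v : ℝ) / (k : ℝ)))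
              (δ₀ / Real.log δ₀ * (k : ℝ)))) ∧
    -- (ii) the consequence for the fractional chromatic number, as `Δ / k → ∞`
    (∀ ε : ℝ, 0 < ε → ∃ K : ℝ, 1 < K ∧
      ∀ (V : Type u) [Fintype V] (G : SimpleGraph V) [DecidableRel G.Adj] (k : ℕ),
        3 ≤ k → k ≤ G.maxDegree + 1 → (SimpleGraph.cycleGraph k).Free G →
        K * (k : ℝ) ≤ (G.maxDegree : ℝ) →
        LocalOccupancy.fractionalChromaticNumber G ≤
          (1 + ε) * ((G.maxDegree : ℝ) / Real.log ((G.maxDegree : ℝ) / (k : ℝ)))) ∧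
    -- (iii) local correspondence colouring
    (∀ ε : ℝ, 0 < ε → ∃ (δ₀ : ℝ) (Δ₀ : ℕ), 1 < δ₀ ∧
      ∀ (V : Type u) [Fintype V] (G : SimpleGraph V) [DecidableRel G.Adj] (k : ℕ),
        3 ≤ k → k ≤ G.maxDegree + 1 → (SimpleGraph.cycleGraph k).Free G →
        Δ₀ ≤ G.maxDegree →
        ∀ (W : Type w) (C : LocalOccupancy.Cover G W),
          (∀ v : V, (1 + ε) * max
              ((G.degree v : ℝ) /
                Real.log ((G.degree v : ℝ) / ((k : ℝ) * Real.log (G.maxDegree : ℝ))))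
              (δ₀ / Real.log δ₀ * (k : ℝ) * Real.log (G.maxDegree : ℝ)) ≤
            ((C.L v).card : ℝ)) →
          C.Colourable) ∧
    -- (iii) the consequence for the correspondence chromatic number when `k = Δ ^ o(1)`
    (∀ ε : ℝ, 0 < ε → ∃ (η : ℝ) (Δ₀ : ℕ), 0 < η ∧
      ∀ (V : Type u) [Fintype V] (G : SimpleGraph V) [DecidableRel G.Adj] (k : ℕ),
        3 ≤ k → k ≤ G.maxDegree + 1 → (SimpleGraph.cycleGraph k).Free G →
        Δ₀ ≤ G.maxDegree → (k : ℝ) ≤ (G.maxDegree : ℝ) ^ η →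
        (LocalOccupancy.correspondenceChromaticNumber G : ℝ) ≤
          (1 + ε) * ((G.maxDegree : ℝ) / Real.log (G.maxDegree : ℝ))) := by
  refine ⟨?_, ?_, ?_, ?_, ?_⟩
  · intro V _ G _ k hk hkΔ hfree lam hlam
    exact LocalOccupancy.occupancy_bound_attained G hk (by omega) hfree hlam
  · intro ε hε
    obtain ⟨δ₀, hδ, h⟩ := LocalOccupancy.exists_fractional_colouring.{u} hε
    refine ⟨δ₀, lt_trans (by simp) hδ, fun V _ G _ k hk _ hfree => ?_⟩
    obtain ⟨c, hc, hcol⟩ := h V G k hk hfree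
    have hk' : (0 : ℝ) < k := by exact_mod_cast (show 0 < k by omega)
    -- The total length `r` only has to exceed all local bounds, which are finitely many.
    obtain ⟨r, hr⟩ := (Set.finite_range fun v : V => (1 + ε) * (max (G.degree v : ℝ) (δ₀ * k) /
      Real.log (max (G.degree v : ℝ) (δ₀ * k) / k))).bddAbove
    refine ⟨r, c, hc r fun v => hr ⟨v, rfl⟩, fun v => (hcol v).trans ?_⟩
    exact Set.Ico_subset_Ico_right
      (mul_le_mul_of_nonneg_left (LocalOccupancy.max_div_log_le hk') (by linarith))
  · intro ε hε
    obtain ⟨K, hK, h⟩ := LocalOccupancy.fractionalChromaticNumber_bound.{u} hε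
    exact ⟨K, hK, fun V _ G _ k hk _ hfree hΔ => h V G k hk hfree hΔ⟩
  · intro ε hε
    obtain ⟨δ₀, Δ₀, hδ, hΔ₀, h⟩ := LocalOccupancy.exists_cover_colouring.{u, w} hε
    refine ⟨δ₀, Δ₀, lt_of_lt_of_le (by simp) hδ, fun V _ G _ k hk hkΔ hfree hΔ W C hC =>
      h V G k hk hkΔ hfree hΔ W C fun v => le_trans ?_ (hC v)⟩
    have hΔ1 : (1 : ℝ) < G.maxDegree := by exact_mod_cast (show 1 < G.maxDegree by omega)
    have hM : (0 : ℝ) < k * Real.log G.maxDegree :=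
      mul_pos (by exact_mod_cast (show 0 < k by omega)) (Real.log_pos hΔ1)
    rw [mul_assoc (δ₀ / Real.log δ₀)]
    exact mul_le_mul_of_nonneg_left (LocalOccupancy.max_div_log_le hM) (by linarith)
  · intro ε hε
    exact LocalOccupancy.correspondenceChromaticNumber_bound.{u} hε
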